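/- **Theorem 1.** For a permutation $\pi$ of length $k$, a sequence $s_1,\dots,s_n$ (repeated values allowed) over a linearly ordered set *contains* $\pi$ if there are indices $i_1<\dots<i_k$ such that for all $j,\ell$: $s_{i_j}<s_{i_\ell}$ if and only if $\pi_j<\pi_\ell$; otherwise it *avoids* $\pi$. A binary matrix contains $\pi$ if the permutation matrix of $\pi$ arises from it by deleting rows and columns and changing some 1-entries to 0; otherwise it avoids $\pi$. Let $\mathrm{ex}_\pi(n)$ be the maximum number of 1-entries in a $\pi$-avoiding $n\times n$ binary matrix ($0$ if there is no such matrix). The limit $c_\pi=\lim_{n\to\infty}\frac1n\,\mathrm{ex}_\pi(n)$ exists for every $\pi$; it is called the Füredi–Hajnal limit of $\pi$. There are a single deterministic comparison-based algorithm and a constant $C$ such that the algorithm, which is given nothing but the length $n$ and the possibility to compare pairs of elements of the input sequence $S=s_1,\dots,s_n$ (from an arbitrary linearly ordered set, repeated values allowed), halts on every input and sorts it, that is, outputs a permutation $\sigma$ of the positions with $s_{\sigma_1}\le\dots\le s_{\sigma_n}$; and for every permutation $\pi$ such that $S$ avoids $\pi$, if $n\ge 1$, its running time on $S$ is at most $$C\cdot(\log_2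 c_\pi+1)\cdot n .$$ In particular, neither the algorithm nor $C$ depends on $\pi$. Here, an algorithm is a program for a word RAM with words of $O(\log n)$ bits that accesses the input elements only by comparisons $s_i\le s_j$; every instruction (an arithmetic operation, a memory access, a comparison of two input elements, a test) takes one unit of time. -/

import Mathlib

open Filter Topology

/-! ### Pattern avoidance -/

/-- A sequence `s` contains the permutation `π` if some subsequence of `s` is order-isomorphic
to `π`. -/
def SeqContains {α : Type*} [LinearOrder α] {n k : ℕ} (s : Fin n → α)
    (π : Equiv.Perm (Fin k)) : Prop :=
  ∃ f : Fin k ↪o Fin n, ∀ i j : Fin k, s (f i) < s (f j) ↔ π i < π j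

/-- A sequence `s`, possibly with repeated values, avoids the permutation `π`. -/
def SeqAvoids {α : Type*} [LinearOrder α] {n k : ℕ} (s : Fin n → α)
    (π : Equiv.Perm (Fin k)) : Prop :=
  ¬ SeqContains s π

/-- A binary matrix `M` contains a binary matrix `P` if `P` arises from `M` by deleting rows and
columns and changing some 1-entries to 0. -/
def MatContains {m n k l : ℕ} (M : Matrix (Fin m) (Fin n) Bool)
    (P : Matrix (Fin k) (Fin l) Bool) : Prop :=
  ∃ (f : Fin k ↪o Fin m) (g : Fin l ↪o Fin n), ∀ i j, P i j = true → M (f i) (g j) = true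

/-- The permutation matrix of `π`; the first index is the position, the second one the value. -/
def patternMatrix {k : ℕ} (π : Equiv.Perm (Fin k)) : Matrix (Fin k) (Fin k) Bool :=
  fun i j => decide (j = π i)

/-- The number of 1-entries of a binary matrix. -/
def numOnes {m n : ℕ} (M : Matrix (Fin m) (Fin n) Bool) : ℕ :=
  (Finset.univ.filter fun p : Fin m × Fin n => M p.1 p.2 = true).card

open Classical in
/-- `exNum π n` is the maximum number of 1-entries of an `n × n` binary matrix that avoids `π`
(and `0` if there is no such matrix, which happens only for degenerate `π`, `n`). -/
noncomputable def exNum {k : ℕ} (π : Equiv.Perm (Fin k)) (n : ℕ) : ℕ :=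
  (Finset.univ.filter fun M : Matrix (Fin n) (Fin n) Bool =>
    ¬ MatContains M (patternMatrix π)).sup numOnes

/-- The Füredi–Hajnal limit of `π`, the limit of `exNum π n / n`. -/
noncomputable def fhLimit {k : ℕ} (π : Equiv.Perm (Fin k)) : ℝ :=
  limUnder atTop fun n : ℕ => (exNum π n : ℝ) / n

/-! ### A comparison-based word RAM

The machine holds natural numbers in registers and in arrays with random access; a program names
only finitely many of both. The input sequence is not in memory: it is accessible only through an
instruction that compares two of its elements, which are referred to by their positions
`0, …, n - 1`. -/

/-- The memory of the machine: register `x` holds `reg x`, cell `i` of array `a` holds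
`arr a i`. -/
structure RamState where
  reg : ℕ → ℕ
  arr : ℕ → ℕ → ℕ

/-- What can be computed by one instruction. Variables `x y i j` are names of registers. -/
inductive Rhs : Type
  /-- a constant of the program -/
  | const (v : ℕ)
  | copy (x : ℕ)
  | add (x y : ℕ)
  /-- truncated subtraction -/
  | sub (x y : ℕ)
  | mul (x y : ℕ)
  /-- integer division (with `_ / 0 = 0`) -/
  | div (x y : ℕ)
  /-- the cell of array `a` whose index is held by register `i` -/
  | load (a i : ℕ)
  /-- `1` if the input element whose position is held by register `i` is at most the one whose
  position is held by register `j`, otherwise `0` (also if a position is out of range) -/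
  | leInput (i j : ℕ)

/-- Programs: deterministic structured code over single instructions. -/
inductive Prog : Type
  | skip
  /-- put the value of `e` into register `x` -/
  | assign (x : ℕ) (e : Rhs)
  /-- put the content of register `x` into the cell of array `a` whose index is held by
  register `i` -/
  | store (a i x : ℕ)
  | seq (p q : Prog)
  /-- if register `x` holds less than register `y`, do `p`, otherwise `q` -/
  | ifLt (x y : ℕ) (p q : Prog)
  /-- as long as register `x` holds less than register `y`, do `p` -/
  | whileLt (x y : ℕ) (p : Prog)

section Semantics

variable {α : Type*} [LinearOrder α] {n : ℕ}

/-- The value of a right-hand side on the input sequence `s` in the state `σ`. -/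
def Rhs.eval (s : Fin n → α) (σ : RamState) : Rhs → ℕ
  | .const v => v
  | .copy x => σ.reg x
  | .add x y => σ.reg x + σ.reg y
  | .sub x y => σ.reg x - σ.reg y
  | .mul x y => σ.reg x * σ.reg y
  | .div x y => σ.reg x / σ.reg y
  | .load a i => σ.arr a (σ.reg i)
  | .leInput i j =>
      if h : σ.reg i < n ∧ σ.reg j < n then
        if s ⟨σ.reg i, h.1⟩ ≤ s ⟨σ.reg j, h.2⟩ then 1 else 0
      else 0

/-- Write `v` into register `x`. -/
def RamState.setReg (σ : RamState) (x v : ℕ) : RamState :=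
  { σ with reg := Function.update σ.reg x v }

/-- Write `v` into cell `i` of array `a`. -/
def RamState.setArr (σ : RamState) (a i v : ℕ) : RamState :=
  { σ with arr := Function.update σ.arr a (Function.update (σ.arr a) i v) }

/-- `Run b s p σ t τ`: on a machine with words of `b` bits and the input sequence `s`, the program
`p`, started in the state `σ`, halts after exactly `t` steps in the state `τ`. Every instruction
and every test costs one step. A program that computes a number of more than `b` bits is stuck: it
has no run. -/
inductive Run (b : ℕ) (s : Fin n → α) : Prog → RamState → ℕ → RamState → Prop
  | skip (σ : RamState) : Run b s .skip σ 1 σ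
  | assign (x : ℕ) (e : Rhs) (σ : RamState) (h : e.eval s σ < 2 ^ b) :
      Run b s (.assign x e) σ 1 (σ.setReg x (e.eval s σ))
  | store (a i x : ℕ) (σ : RamState) :
      Run b s (.store a i x) σ 1 (σ.setArr a (σ.reg i) (σ.reg x))
  | seq {p q : Prog} {σ σ₁ σ₂ : RamState} {t u : ℕ}
      (hp : Run b s p σ t σ₁) (hq : Run b s q σ₁ u σ₂) : Run b s (.seq p q) σ (t + u) σ₂
  | ifTrue {x y : ℕ} {p q : Prog} {σ σ₁ : RamState} {t : ℕ} (h : σ.reg x < σ.reg y)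
      (hp : Run b s p σ t σ₁) : Run b s (.ifLt x y p q) σ (t + 1) σ₁
  | ifFalse {x y : ℕ} {p q : Prog} {σ σ₁ : RamState} {t : ℕ} (h : ¬ σ.reg x < σ.reg y)
      (hq : Run b s q σ t σ₁) : Run b s (.ifLt x y p q) σ (t + 1) σ₁
  | whileTrue {x y : ℕ} {p : Prog} {σ σ₁ σ₂ : RamState} {t u : ℕ} (h : σ.reg x < σ.reg y)
      (hp : Run b s p σ t σ₁) (hq : Run b s (.whileLt x y p) σ₁ u σ₂) :
      Run b s (.whileLt x y p) σ (t + u + 1) σ₂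
  | whileFalse {x y : ℕ} {p : Prog} {σ : RamState} (h : ¬ σ.reg x < σ.reg y) :
      Run b s (.whileLt x y p) σ 1 σ

/-- The machine is deterministic: number of steps and final state are determined. -/
theorem Run.unique {b : ℕ} {s : Fin n → α} {p : Prog} {σ τ τ' : RamState} {t t' : ℕ}
    (h : Run b s p σ t τ) (h' : Run b s p σ t' τ') : t = t' ∧ τ = τ' := by
  induction h generalizing t' τ' with
  | skip | assign | store => cases h'; exact ⟨rfl, rfl⟩
  | seq _ _ ih₁ ih₂ =>
    cases h' with
    | seq hp hq =>
      obtain ⟨rfl, rfl⟩ := ih₁ hp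
      obtain ⟨rfl, rfl⟩ := ih₂ hq
      exact ⟨rfl, rfl⟩
  | ifTrue h _ ih =>
    cases h' with
    | ifTrue _ hp => obtain ⟨rfl, rfl⟩ := ih hp; exact ⟨rfl, rfl⟩
    | ifFalse h2 _ => exact absurd h h2
  | ifFalse h _ ih =>
    cases h' with
    | ifTrue h2 _ => exact absurd h2 h
    | ifFalse _ hp => obtain ⟨rfl, rfl⟩ := ih hp; exact ⟨rfl, rfl⟩
  | whileTrue h _ _ ih₁ ih₂ =>
    cases h' with
    | whileTrue _ hp hq =>
      obtain ⟨rfl, rfl⟩ := ih₁ hp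
      obtain ⟨rfl, rfl⟩ := ih₂ hq
      exact ⟨rfl, rfl⟩
    | whileFalse h2 => exact absurd h h2
  | whileFalse h =>
    cases h' with
    | whileTrue h2 _ _ => exact absurd h2 h
    | whileFalse _ => exact ⟨rfl, rfl⟩

/-- The initial state for inputs of length `n`: register `0` holds `n`, everything else is `0`. -/
def initState (n : ℕ) : RamState where
  reg := fun x => if x = 0 then n else 0
  arr := fun _ _ => 0

/-- In the state `σ`, array `0` holds a sorted rearrangement of the input sequence `s`, as the
list of the positions of its elements. -/
def HoldsSorted (s : Fin n → α) (σ : RamState) : Prop :=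
  ∃ ρ : Equiv.Perm (Fin n), (∀ i : Fin n, σ.arr 0 i = ρ i) ∧ Monotone fun i => s (ρ i)

end Semantics

set_option linter.constructorNameAsVariable false

/-! ### A small imperative language with expressions -/

/-! The sorting method depends on a parameter `q`. A list of at most `q ^ 2` positions is
merge-sorted. A longer list of `N` positions is cut into blocks of `q ^ 2` entries; each block is
sorted and every `q`-th entry of it becomes a sample. The samples are sorted by a recursive call and
cut, by rank, into strips of `q` samples. Every sample owns a group: the (at most) `q` entries of
its sorted block that begin with it. The group is good if the next sample lies in the same block and
in the same strip. A good group is enclosed by two samples of one strip, so the good groups of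
different strips are already in order (`LevelData.separated`), and one strip holds at most `q ^ 2`
good elements, which are merge-sorted at a cost of `O(log q)` per element. The elements of bad
groups are sorted by a second recursive call and merged with the good ones. If more than `N / 4`
elements are bad, the run is abandoned and `q` is replaced by its square. Otherwise the cost
satisfies `T(N) ≤ T(⌈N / q⌉) + T(N / 4) + O(N log q)`, hence is `O(N log q)` (`callTime_step`,
`wp_call`). Since `log q` doubles with every restart, the last round dominates the total
(`wp_attempts`).

It remains to see that an abandoned run forces `q` to be small. A bad group belongs to a jump: a
sample whose successor is in another block or strip. Up to rounding there are `W = N / q ^ 2` blocks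
and as many strips. Jumps in the interior of blocks are entries of a `W × W` matrix with the block
as row and the strip as column. Blocks are ordered by position and strips by value, so an occurrence
of `π` in this matrix would be one in the input; therefore there are at most `ex_π(W) ≤ c_π W` such
entries. Equal values can straddle strip boundaries, which costs constant factors
(`ValuedSamples.card_jumps_le`). More than `N / (4 q)` jumps thus imply `q < 32 c_π`
(`lt_of_obstruction`), so the final `log q` is `O(log c_π + 1)` (`Reached.le`).

The inequality `ex_π(n) ≤ c_π n` for every `n`, not only asymptotically, comes from Fekete's lemma:
`ex_π` is superadditive (`exNum_superadditive`), so the limit is a supremum. Its finiteness is the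
theorem of Marcus and Tardos (`marcus_tardos`).

The program is written in a small structured language and verified there by weakest preconditions
that also count steps; `Cmd.comp_correct` transfers the result to the word RAM with a constant
factor. The language compares positions by value and then by position, so the program itself sees a
strict linear order. -/

/-- The named registers of the sorting program. -/
inductive Reg
  | n | q | K | fail | sp | base | N | ph | lo | hi | w | u
  | p | pe | r | re | o | v | ve | x | i0 | i1 | j | ok | z | nb | M
deriving DecidableEq

/-- The named arrays of the sorting program. -/
inductive Arr
  | X | L | Y | Z | F | I | S | SB | SN | SP | SG
deriving DecidableEq

/-- The code `0` of `n` is forced: a named register occupies the RAM register with twice its code,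
and the input length is delivered in register `0`. -/
def Reg.code : Reg → ℕ
  | n => 0 | q => 1 | K => 2 | fail => 3 | sp => 4 | base => 5 | N => 6 | ph => 7 | lo => 8
  | hi => 9 | w => 10 | u => 11 | p => 12 | pe => 13 | r => 14 | re => 15 | o => 16
  | v => 17 | ve => 18 | x => 19 | i0 => 20 | i1 => 21 | j => 22 | ok => 23 | z => 24
  | nb => 25 | M => 26

/-- A left inverse gives injectivity by one case per register instead of one per pair. -/
def Reg.decode : ℕ → Reg
  | 0 => n | 1 => q | 2 => K | 3 => fail | 4 => sp | 5 => base | 6 => N | 7 => ph | 8 => lo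
  | 9 => hi | 10 => w | 11 => u | 12 => p | 13 => pe | 14 => r | 15 => re | 16 => o
  | 17 => v | 18 => ve | 19 => x | 20 => i0 | 21 => i1 | 22 => j | 23 => ok | 24 => z
  | 25 => nb | _ => M

/-- `X` must be array `0`, where the output is expected. -/
def Arr.code : Arr → ℕ
  | X => 0 | L => 1 | Y => 2 | Z => 3 | F => 4 | I => 5 | S => 6 | SB => 7 | SN => 8 | SP => 9
  | SG => 10

def Arr.decode : ℕ → Arr
  | 0 => X | 1 => L | 2 => Y | 3 => Z | 4 => F | 5 => I | 6 => S | 7 => SB | 8 => SN | 9 => SP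
  | _ => SG

theorem Reg.code_injective : Function.Injective Reg.code :=
  Function.LeftInverse.injective (g := Reg.decode) fun x => by cases x <;> rfl

theorem Arr.code_injective : Function.Injective Arr.code :=
  Function.LeftInverse.injective (g := Arr.decode) fun x => by cases x <;> rfl

/-- Expressions; `le e₁ e₂` compares the input elements at two positions. -/
inductive Ex
  | c (v : ℕ)
  | r (x : Reg)
  | add (e₁ e₂ : Ex)
  | sub (e₁ e₂ : Ex)
  | mul (e₁ e₂ : Ex)
  | div (e₁ e₂ : Ex)
  | ld (a : Arr) (e : Ex)
  | le (e₁ e₂ : Ex)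

/-- Commands. -/
inductive Cmd
  | skip
  | set (x : Reg) (e : Ex)
  | st (a : Arr) (i e : Ex)
  | seq (p q : Cmd)
  | ite (e₁ e₂ : Ex) (p q : Cmd)
  | wh (e₁ e₂ : Ex) (p : Cmd)

/-- Memory and elapsed time. -/
structure HState where
  reg : Reg → ℕ
  arr : Arr → ℕ → ℕ
  time : ℕ

namespace HState

def set (σ : HState) (x : Reg) (v : ℕ) : HState :=
  ⟨Function.update σ.reg x v, σ.arr, σ.time + 1⟩

def st (σ : HState) (a : Arr) (i v : ℕ) : HState :=
  ⟨σ.reg, Function.update σ.arr a (Function.update (σ.arr a) i v), σ.time + 1⟩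

def tick (σ : HState) : HState := ⟨σ.reg, σ.arr, σ.time + 1⟩

variable (σ : HState)

@[simp] theorem set_reg (x y : Reg) (v : ℕ) :
    (σ.set x v).reg y = if y = x then v else σ.reg y := by
  simp [set, Function.update_apply]

@[simp] theorem set_arr (x : Reg) (v : ℕ) : (σ.set x v).arr = σ.arr := rfl

@[simp] theorem set_time (x : Reg) (v : ℕ) : (σ.set x v).time = σ.time + 1 := rfl

@[simp] theorem st_reg (a : Arr) (i v : ℕ) : (σ.st a i v).reg = σ.reg := rfl

@[simp] theorem st_arr (a b : Arr) (i v : ℕ) :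
    (σ.st a i v).arr b = if b = a then Function.update (σ.arr a) i v else σ.arr b := by
  by_cases h : b = a
  · subst h; simp [st]
  · simp [st, h]

@[simp] theorem st_time (a : Arr) (i v : ℕ) : (σ.st a i v).time = σ.time + 1 := rfl

@[simp] theorem tick_reg : σ.tick.reg = σ.reg := rfl

@[simp] theorem tick_arr : σ.tick.arr = σ.arr := rfl

@[simp] theorem tick_time : σ.tick.time = σ.time + 1 := rfl

end HState

/-- The length of the input, a strict bound for all numbers, and the order of the positions
according to the input elements (with ties broken). -/
structure Env where
  n : ℕ
  B : ℕ
  r : ℕ → ℕ → Prop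

open Classical in
/-- The value of an expression. -/
noncomputable def Ex.val (E : Env) (σ : HState) : Ex → ℕ
  | c v => v
  | r x => σ.reg x
  | add e₁ e₂ => e₁.val E σ + e₂.val E σ
  | sub e₁ e₂ => e₁.val E σ - e₂.val E σ
  | mul e₁ e₂ => e₁.val E σ * e₂.val E σ
  | div e₁ e₂ => e₁.val E σ / e₂.val E σ
  | ld a e => σ.arr a (e.val E σ)
  | le e₁ e₂ => if E.r (e₁.val E σ) (e₂.val E σ) then 1 else 0

/-- An expression can be evaluated: no overflow, and only input elements are compared. -/
def Ex.Safe (E : Env) (σ : HState) : Ex → Prop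
  | c v => v < E.B
  | r _ => True
  | add e₁ e₂ => e₁.Safe E σ ∧ e₂.Safe E σ ∧ e₁.val E σ + e₂.val E σ < E.B
  | sub e₁ e₂ => e₁.Safe E σ ∧ e₂.Safe E σ
  | mul e₁ e₂ => e₁.Safe E σ ∧ e₂.Safe E σ ∧ e₁.val E σ * e₂.val E σ < E.B
  | div e₁ e₂ => e₁.Safe E σ ∧ e₂.Safe E σ
  | ld _ e => e.Safe E σ
  | le e₁ e₂ => e₁.Safe E σ ∧ e₂.Safe E σ ∧ e₁.val E σ < E.n ∧ e₂.val E σ < E.n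

/-- Big-step semantics. -/
inductive HRun (E : Env) : Cmd → HState → HState → Prop
  | skip (σ : HState) : HRun E .skip σ σ.tick
  | set (x : Reg) (e : Ex) (σ : HState) (h : e.Safe E σ) :
      HRun E (.set x e) σ (σ.set x (e.val E σ))
  | st (a : Arr) (i e : Ex) (σ : HState) (hi : i.Safe E σ) (h : e.Safe E σ) :
      HRun E (.st a i e) σ (σ.st a (i.val E σ) (e.val E σ))
  | seq {p q : Cmd} {σ σ₁ σ₂ : HState} (hp : HRun E p σ σ₁) (hq : HRun E q σ₁ σ₂) :
      HRun E (.seq p q) σ σ₂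
  | iteTrue {e₁ e₂ : Ex} {p q : Cmd} {σ σ₁ : HState} (h₁ : e₁.Safe E σ) (h₂ : e₂.Safe E σ)
      (h : e₁.val E σ < e₂.val E σ) (hp : HRun E p σ.tick σ₁) : HRun E (.ite e₁ e₂ p q) σ σ₁
  | iteFalse {e₁ e₂ : Ex} {p q : Cmd} {σ σ₁ : HState} (h₁ : e₁.Safe E σ) (h₂ : e₂.Safe E σ)
      (h : ¬ e₁.val E σ < e₂.val E σ) (hq : HRun E q σ.tick σ₁) : HRun E (.ite e₁ e₂ p q) σ σ₁
  | whTrue {e₁ e₂ : Ex} {p : Cmd} {σ σ₁ σ₂ : HState} (h₁ : e₁.Safe E σ) (h₂ : e₂.Safe E σ)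
      (h : e₁.val E σ < e₂.val E σ) (hp : HRun E p σ.tick σ₁) (hw : HRun E (.wh e₁ e₂ p) σ₁ σ₂) :
      HRun E (.wh e₁ e₂ p) σ σ₂
  | whFalse {e₁ e₂ : Ex} {p : Cmd} {σ : HState} (h₁ : e₁.Safe E σ) (h₂ : e₂.Safe E σ)
      (h : ¬ e₁.val E σ < e₂.val E σ) : HRun E (.wh e₁ e₂ p) σ σ.tick

/-! ### Compilation to the word RAM -/

namespace Ex

/-- The register for the temporary number `d`. -/
def tmp (d : ℕ) : ℕ := 2 * d + 1

theorem tmp_inj {d d' : ℕ} : tmp d = tmp d' ↔ d = d' := by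
  unfold tmp; omega

/-- Code that puts the value of the expression into the temporary `d`. -/
def comp : Ex → ℕ → Prog
  | c v, d => .assign (tmp d) (.const v)
  | r x, d => .assign (tmp d) (.copy (2 * x.code))
  | add e₁ e₂, d => .seq (e₁.comp d) (.seq (e₂.comp (d + 1))
      (.assign (tmp d) (.add (tmp d) (tmp (d + 1)))))
  | sub e₁ e₂, d => .seq (e₁.comp d) (.seq (e₂.comp (d + 1))
      (.assign (tmp d) (.sub (tmp d) (tmp (d + 1)))))
  | mul e₁ e₂, d => .seq (e₁.comp d) (.seq (e₂.comp (d + 1))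
      (.assign (tmp d) (.mul (tmp d) (tmp (d + 1)))))
  | div e₁ e₂, d => .seq (e₁.comp d) (.seq (e₂.comp (d + 1))
      (.assign (tmp d) (.div (tmp d) (tmp (d + 1)))))
  | ld a e, d => .seq (e.comp d) (.assign (tmp d) (.load a.code (tmp d)))
  | le e₁ e₂, d => .seq (e₁.comp d) (.seq (e₂.comp (d + 1))
      (.seq (.assign (tmp (d + 2)) (.leInput (tmp d) (tmp (d + 1))))
      (.seq (.assign (tmp (d + 3)) (.leInput (tmp (d + 1)) (tmp d)))
      (.seq (.assign (tmp (d + 4)) (.sub (tmp d) (tmp (d + 1))))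
      (.seq (.assign (tmp (d + 3)) (.mul (tmp (d + 3)) (tmp (d + 4))))
      (.seq (.assign (tmp (d + 4)) (.const 1))
      (.seq (.assign (tmp (d + 3)) (.sub (tmp (d + 4)) (tmp (d + 3))))
      (.assign (tmp d) (.mul (tmp (d + 2)) (tmp (d + 3)))))))))))

/-- The running time of the code for an expression. -/
def cost : Ex → ℕ
  | c _ | r _ => 1
  | add e₁ e₂ | sub e₁ e₂ | mul e₁ e₂ | div e₁ e₂ => e₁.cost + e₂.cost + 1
  | ld _ e => e.cost + 1
  | le e₁ e₂ => e₁.cost + e₂.cost + 7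

end Ex

namespace Cmd

/-- Code for a command. -/
def comp : Cmd → Prog
  | skip => .skip
  | set x e => .seq (e.comp 0) (.assign (2 * x.code) (.copy (Ex.tmp 0)))
  | st a i e => .seq (i.comp 0) (.seq (e.comp 1) (.store a.code (Ex.tmp 0) (Ex.tmp 1)))
  | seq p q => .seq p.comp q.comp
  | ite e₁ e₂ p q => .seq (e₁.comp 0) (.seq (e₂.comp 1)
      (.ifLt (Ex.tmp 0) (Ex.tmp 1) p.comp q.comp))
  | wh e₁ e₂ p => .seq (e₁.comp 0) (.seq (e₂.comp 1)
      (.whileLt (Ex.tmp 0) (Ex.tmp 1) (.seq p.comp (.seq (e₁.comp 0) (e₂.comp 1)))))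

/-- A bound for the number of RAM instructions that make up one step. -/
def maxCost : Cmd → ℕ
  | skip => 1
  | set _ e => e.cost + 1
  | st _ i e => i.cost + e.cost + 1
  | seq p q => max p.maxCost q.maxCost
  | ite e₁ e₂ p q => max (e₁.cost + e₂.cost + 1) (max p.maxCost q.maxCost)
  | wh e₁ e₂ p => max (e₁.cost + e₂.cost + 1) p.maxCost

end Cmd

/-! ### Correctness of the compilation -/

section Compile

variable {α : Type*} [LinearOrder α] {n : ℕ}

/-- The order of the positions `0, …, n - 1` by input element and then by position, extended to
a linear order of all natural numbers. -/
def posLE (s : Fin n → α) (i j : ℕ) : Prop :=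
  if hi : i < n then
    if hj : j < n then s ⟨i, hi⟩ < s ⟨j, hj⟩ ∨ s ⟨i, hi⟩ = s ⟨j, hj⟩ ∧ i ≤ j
    else True
  else i ≤ j

/-- The environment of an input sequence on a machine with words of `b` bits. -/
def inputEnv (b : ℕ) (s : Fin n → α) : Env := ⟨n, 2 ^ b, posLE s⟩

/-- The RAM state `ρ` represents the state `σ`. -/
structure Represents (b : ℕ) (ρ : RamState) (σ : HState) : Prop where
  reg : ∀ x : Reg, ρ.reg (2 * x.code) = σ.reg x
  arr : ∀ a : Arr, ρ.arr a.code = σ.arr a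
  reg_lt : ∀ x, ρ.reg x < 2 ^ b
  arr_lt : ∀ a i, ρ.arr a i < 2 ^ b

/-- Temporaries have odd numbers and named registers even ones, so scratch writes are invisible at
the level of the source language. -/
theorem Represents.setTmp {b : ℕ} {ρ : RamState} {σ : HState} (h : Represents b ρ σ) {d v : ℕ}
    (hv : v < 2 ^ b) : Represents b (ρ.setReg (Ex.tmp d) v) σ where
  reg x := by
    have : 2 * x.code ≠ Ex.tmp d := by unfold Ex.tmp; omega
    simp [RamState.setReg, this, h.reg]
  arr a := h.arr a
  reg_lt x := by
    simp only [RamState.setReg, Function.update_apply]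
    split_ifs
    · exact hv
    · exact h.reg_lt x
  arr_lt := h.arr_lt

/-- What is known after the evaluation of an expression with value `v` to temporary `d`. -/
structure EvalTo (b : ℕ) (ρ ρ' : RamState) (σ : HState) (d v : ℕ) : Prop where
  rep : Represents b ρ' σ
  val : ρ'.reg (Ex.tmp d) = v
  old : ∀ d' < d, ρ'.reg (Ex.tmp d') = ρ.reg (Ex.tmp d')

theorem EvalTo.of_setTmp {b : ℕ} {ρ ρ' : RamState} {σ : HState} {d v : ℕ}
    (h : Represents b ρ' σ) (hv : v < 2 ^ b)
    (old : ∀ d' < d, ρ'.reg (Ex.tmp d') = ρ.reg (Ex.tmp d')) :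
    EvalTo b ρ (ρ'.setReg (Ex.tmp d) v) σ d v where
  rep := h.setTmp hv
  val := by simp [RamState.setReg]
  old d' hd := by
    have : Ex.tmp d' ≠ Ex.tmp d := by unfold Ex.tmp; omega
    simp [RamState.setReg, this, old d' hd]

/-- The temporaries behave like a stack: code for depth `d` leaves all temporaries below `d` alone,
so a left operand survives in `d` while the right one is computed in `d + 1`. The field `old` of
`EvalTo` carries this through the induction. -/
theorem Ex.comp_correct {b : ℕ} (s : Fin n → α) (hb : 1 < 2 ^ b) {σ : HState} (e : Ex) :
    ∀ (d : ℕ) (ρ : RamState), Represents b ρ σ → e.Safe (inputEnv b s) σ →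
      ∃ ρ', Run b s (e.comp d) ρ e.cost ρ' ∧ EvalTo b ρ ρ' σ d (e.val (inputEnv b s) σ) := by
  have binary : ∀ (e₁ e₂ : Ex) (f : Rhs) (d : ℕ) (ρ : RamState) (v : ℕ),
      (∀ (d : ℕ) (ρ : RamState), Represents b ρ σ →
        ∃ ρ', Run b s (e₁.comp d) ρ e₁.cost ρ' ∧
          EvalTo b ρ ρ' σ d (e₁.val (inputEnv b s) σ)) →
      (∀ (d : ℕ) (ρ : RamState), Represents b ρ σ →
        ∃ ρ', Run b s (e₂.comp d) ρ e₂.cost ρ' ∧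
          EvalTo b ρ ρ' σ d (e₂.val (inputEnv b s) σ)) →
      Represents b ρ σ → v < 2 ^ b →
      (∀ ρ' : RamState, ρ'.reg (tmp d) = e₁.val (inputEnv b s) σ →
        ρ'.reg (tmp (d + 1)) = e₂.val (inputEnv b s) σ → f.eval s ρ' = v) →
      ∃ ρ', Run b s (.seq (e₁.comp d) (.seq (e₂.comp (d + 1)) (.assign (tmp d) f))) ρ
        (e₁.cost + e₂.cost + 1) ρ' ∧ EvalTo b ρ ρ' σ d v := by
    intro e₁ e₂ f d ρ v ih₁ ih₂ hρ hv hf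
    obtain ⟨ρ₁, r₁, h₁⟩ := ih₁ d ρ hρ
    obtain ⟨ρ₂, r₂, h₂⟩ := ih₂ (d + 1) ρ₁ h₁.rep
    have hfv := hf ρ₂ ((h₂.old d (by omega)).trans h₁.val) h₂.val
    refine ⟨_, ?_, EvalTo.of_setTmp (ρ := ρ) h₂.rep hv fun d' hd => ?_⟩
    · rw [add_assoc]
      refine Run.seq r₁ (Run.seq r₂ ?_)
      rw [← hfv]
      exact Run.assign _ _ _ (hfv ▸ hv)
    · rw [h₂.old d' (by omega), h₁.old d' hd]
  induction e with
  | c v =>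
    intro d ρ hρ hs
    exact ⟨_, Run.assign _ _ _ hs, EvalTo.of_setTmp hρ hs fun _ _ => rfl⟩
  | r x =>
    intro d ρ hρ hs
    refine ⟨_, Run.assign _ _ _ (hρ.reg_lt _), ?_⟩
    have := EvalTo.of_setTmp (ρ := ρ) (d := d) hρ (hρ.reg_lt (2 * x.code)) fun _ _ => rfl
    rw [show (Ex.r x).val (inputEnv b s) σ = ρ.reg (2 * x.code) from (hρ.reg x).symm]
    exact this
  | add e₁ e₂ ih₁ ih₂ =>
    intro d ρ hρ hs
    refine binary e₁ e₂ _ d ρ _ (fun d ρ h => ih₁ d ρ h hs.1) (fun d ρ h => ih₂ d ρ h hs.2.1) hρ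
      hs.2.2 fun ρ' h₁ h₂ => ?_
    simp [Rhs.eval, Ex.val, h₁, h₂]
  | mul e₁ e₂ ih₁ ih₂ =>
    intro d ρ hρ hs
    refine binary e₁ e₂ _ d ρ _ (fun d ρ h => ih₁ d ρ h hs.1) (fun d ρ h => ih₂ d ρ h hs.2.1) hρ
      hs.2.2 fun ρ' h₁ h₂ => ?_
    simp [Rhs.eval, Ex.val, h₁, h₂]
  | sub e₁ e₂ ih₁ ih₂ =>
    intro d ρ hρ hs
    refine binary e₁ e₂ _ d ρ _ (fun d ρ h => ih₁ d ρ h hs.1) (fun d ρ h => ih₂ d ρ h hs.2) hρ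
      ?_ fun ρ' h₁ h₂ => ?_
    · obtain ⟨ρ₁, -, h₁⟩ := ih₁ d ρ hρ hs.1
      exact lt_of_le_of_lt (Nat.sub_le _ _) (h₁.val ▸ h₁.rep.reg_lt _)
    · simp [Rhs.eval, Ex.val, h₁, h₂]
  | div e₁ e₂ ih₁ ih₂ =>
    intro d ρ hρ hs
    refine binary e₁ e₂ _ d ρ _ (fun d ρ h => ih₁ d ρ h hs.1) (fun d ρ h => ih₂ d ρ h hs.2) hρ
      ?_ fun ρ' h₁ h₂ => ?_
    · obtain ⟨ρ₁, -, h₁⟩ := ih₁ d ρ hρ hs.1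
      exact lt_of_le_of_lt (Nat.div_le_self _ _) (h₁.val ▸ h₁.rep.reg_lt _)
    · simp [Rhs.eval, Ex.val, h₁, h₂]
  | ld a e ih =>
    intro d ρ hρ hs
    obtain ⟨ρ₁, r₁, h₁⟩ := ih d ρ hρ hs
    have hv : (Rhs.load a.code (tmp d)).eval s ρ₁ = (Ex.ld a e).val (inputEnv b s) σ := by
      simp [Rhs.eval, h₁.val, Ex.val, h₁.rep.arr]
    have hlt : (Rhs.load a.code (tmp d)).eval s ρ₁ < 2 ^ b := h₁.rep.arr_lt _ _
    refine ⟨_, Run.seq r₁ (Run.assign _ _ _ hlt), ?_⟩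
    rw [hv] at hlt ⊢
    exact EvalTo.of_setTmp h₁.rep hlt h₁.old
  | le e₁ e₂ ih₁ ih₂ =>
    intro d ρ hρ hs
    obtain ⟨ρ₁, r₁, h₁⟩ := ih₁ d ρ hρ hs.1
    obtain ⟨ρ₂, r₂, h₂⟩ := ih₂ (d + 1) ρ₁ h₁.rep hs.2.1
    have v₁ : ρ₂.reg (tmp d) = e₁.val (inputEnv b s) σ := (h₂.old d (by omega)).trans h₁.val
    have v₂ : ρ₂.reg (tmp (d + 1)) = e₂.val (inputEnv b s) σ := h₂.val
    obtain ⟨-, -, hi, hj⟩ := hs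
    have hiB : e₁.val (inputEnv b s) σ < 2 ^ b := v₁ ▸ h₂.rep.reg_lt _
    generalize hv : (Ex.le e₁ e₂).val (inputEnv b s) σ = v
    simp only [Ex.val] at hv
    generalize e₁.val (inputEnv b s) σ = i at *
    generalize e₂.val (inputEnv b s) σ = j at *
    replace hi : i < n := hi
    replace hj : j < n := hj
    have h0 : (0 : ℕ) < 2 ^ b := by omega
    set a := if s ⟨i, hi⟩ ≤ s ⟨j, hj⟩ then 1 else 0 with ha
    set a' := if s ⟨j, hj⟩ ≤ s ⟨i, hi⟩ then 1 else 0 with ha'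
    have ha1 : a ≤ 1 := by rw [ha]; split_ifs <;> simp
    have ha1' : a' ≤ 1 := by rw [ha']; split_ifs <;> simp
    have hm : a' * (i - j) < 2 ^ b :=
      lt_of_le_of_lt ((Nat.mul_le_mul_right _ ha1').trans (by omega)) hiB
    -- Ties are broken without branching. If both `a` and `a'` are `1`, the values agree, and then
    -- the truncated difference `i - j` is positive exactly when `i` comes after `j`, which turns
    -- the second factor into `0`.
    have hval : a * (1 - a' * (i - j)) = v := by
      rw [← hv, ha, ha']
      simp only [inputEnv, posLE, hi, hj, dite_true]
      rcases lt_trichotomy (s ⟨i, hi⟩) (s ⟨j, hj⟩) with h | h | h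
      · simp [h, h.le, h.not_ge]
      · by_cases hij : i ≤ j
        · simp [h, hij, Nat.sub_eq_zero_of_le hij]
        · simp [h, hij]; omega
      · simp [h.le, h.not_ge, h.not_gt, h.ne']
    have hv1 : v ≤ 1 := by
      rw [← hv]; split_ifs <;> simp
    have t2 := h₂.rep.setTmp (d := d + 2) (v := a) (by omega)
    have t3 := t2.setTmp (d := d + 3) (v := a') (by omega)
    have t4 := t3.setTmp (d := d + 4) (v := i - j) (by omega)
    have t5 := t4.setTmp (d := d + 3) (v := a' * (i - j)) hm
    have t6 := t5.setTmp (d := d + 4) (v := 1) hb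
    have t7 := t6.setTmp (d := d + 3) (v := 1 - a' * (i - j)) (by omega)
    refine ⟨_, ?_, EvalTo.of_setTmp (ρ := ρ) (v := v) t7 (by omega) fun d' hd => ?_⟩
    · have e : (Ex.le e₁ e₂).cost =
          e₁.cost + (e₂.cost + (1 + (1 + (1 + (1 + (1 + (1 + 1))))))) := by
        simp only [Ex.cost]; ring
      rw [e]
      have assign : ∀ {x : ℕ} {f : Rhs} {ρ : RamState} {w : ℕ}, f.eval s ρ = w → w < 2 ^ b →
          Run b s (.assign x f) ρ 1 (ρ.setReg x w) := by
        intro x f ρ w h hw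
        subst h
        exact Run.assign _ _ _ hw
      refine Run.seq r₁ (Run.seq r₂ (Run.seq (assign (w := a) ?_ (by omega)) (Run.seq
        (assign (w := a') ?_ (by omega)) (Run.seq (assign (w := i - j) ?_ (by omega)) (Run.seq
        (assign (w := a' * (i - j)) ?_ hm) (Run.seq (assign (w := 1) ?_ hb) (Run.seq
        (assign (w := 1 - a' * (i - j)) ?_ (by omega)) (assign ?_ (by omega)))))))))
      all_goals
        simp [Rhs.eval, RamState.setReg, tmp_inj, v₁, v₂, hi, hj, ha, ha']
      rw [← hval, ha, ha']
      simp
    · simp only [RamState.setReg, Function.update_apply, tmp]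
      rw [if_neg (by omega), if_neg (by omega), if_neg (by omega), if_neg (by omega),
        if_neg (by omega), if_neg (by omega)]
      rw [← tmp, h₂.old d' (by omega), h₁.old d' hd]

theorem Represents.setReg {b : ℕ} {ρ : RamState} {σ : HState} (h : Represents b ρ σ) (x : Reg)
    {v : ℕ} (hv : v < 2 ^ b) : Represents b (ρ.setReg (2 * x.code) v) (σ.set x v) where
  reg y := by
    have : (2 * y.code = 2 * x.code) ↔ y = x := by
      rw [← Reg.code_injective.eq_iff (a := y)]; omega
    simp [RamState.setReg, Function.update_apply, this, h.reg]
  arr a := h.arr a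
  reg_lt y := by
    simp only [RamState.setReg, Function.update_apply]
    split_ifs
    · exact hv
    · exact h.reg_lt y
  arr_lt := h.arr_lt

theorem Represents.setArr {b : ℕ} {ρ : RamState} {σ : HState} (h : Represents b ρ σ) (a : Arr)
    (i : ℕ) {v : ℕ} (hv : v < 2 ^ b) : Represents b (ρ.setArr a.code i v) (σ.st a i v) where
  reg := h.reg
  arr a' := by
    simp only [RamState.setArr, Function.update_apply, Arr.code_injective.eq_iff, HState.st_arr,
      h.arr]
  reg_lt := h.reg_lt
  arr_lt a' j := by
    simp only [RamState.setArr, Function.update_apply]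
    split_ifs with h1
    · rw [Function.update_apply]
      split_ifs
      · exact hv
      · exact h.arr_lt _ _
    · exact h.arr_lt _ _

theorem Represents.tick {b : ℕ} {ρ : RamState} {σ : HState} (h : Represents b ρ σ) :
    Represents b ρ σ.tick := ⟨h.reg, h.arr, h.reg_lt, h.arr_lt⟩

/-- A source step expands to at most `D` RAM steps. The bound is written additively, without a
difference of times, so that it telescopes along sequences and loops. -/
theorem Cmd.comp_correct {b D : ℕ} (s : Fin n → α) (hb : 1 < 2 ^ b) {c : Cmd} {σ τ : HState}
    (h : HRun (inputEnv b s) c σ τ) (hD : c.maxCost ≤ D) (ρ : RamState) (hρ : Represents b ρ σ) :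
    ∃ t ρ', Run b s c.comp ρ t ρ' ∧ Represents b ρ' τ ∧ t + D * σ.time ≤ D * τ.time := by
  have pair : ∀ {e₁ e₂ : Ex} {σ : HState}, e₁.Safe (inputEnv b s) σ → e₂.Safe (inputEnv b s) σ →
      ∀ ρ : RamState, Represents b ρ σ → ∃ ρ₁ ρ₂, Run b s (e₁.comp 0) ρ e₁.cost ρ₁ ∧
        Run b s (e₂.comp 1) ρ₁ e₂.cost ρ₂ ∧ Represents b ρ₂ σ ∧
        ρ₂.reg (Ex.tmp 0) = e₁.val (inputEnv b s) σ ∧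
        ρ₂.reg (Ex.tmp 1) = e₂.val (inputEnv b s) σ := by
    intro e₁ e₂ σ h₁ h₂ ρ hρ
    obtain ⟨ρ₁, r₁, k₁⟩ := Ex.comp_correct s hb e₁ 0 ρ hρ h₁
    obtain ⟨ρ₂, r₂, k₂⟩ := Ex.comp_correct s hb e₂ 1 ρ₁ k₁.rep h₂
    exact ⟨ρ₁, ρ₂, r₁, r₂, k₂.rep, (k₂.old 0 (by omega)).trans k₁.val, k₂.val⟩
  induction h generalizing ρ with
  | skip σ =>
    refine ⟨1, ρ, Run.skip _, hρ.tick, ?_⟩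
    simp only [maxCost] at hD
    simp only [HState.tick_time, mul_add]
    omega
  | set x e σ hs =>
    obtain ⟨ρ₁, r₁, k₁⟩ := Ex.comp_correct s hb e 0 ρ hρ hs
    have hlt := k₁.rep.reg_lt (Ex.tmp 0)
    refine ⟨_, _, Run.seq r₁ (Run.assign _ _ _ hlt), ?_, ?_⟩
    · have := k₁.rep.setReg x hlt
      rw [← k₁.val]
      exact this
    · simp only [maxCost] at hD
      simp only [HState.set_time, mul_add]
      omega
  | st a i e σ hi hs =>
    obtain ⟨ρ₁, ρ₂, r₁, r₂, k, v₁, v₂⟩ := pair hi hs ρ hρ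
    refine ⟨_, _, Run.seq r₁ (Run.seq r₂ (Run.store _ _ _ _)), ?_, ?_⟩
    · have := k.setArr a (ρ₂.reg (Ex.tmp 0)) (k.reg_lt (Ex.tmp 1))
      rwa [v₁, v₂] at this ⊢
    · simp only [maxCost] at hD
      simp only [HState.st_time, mul_add]
      omega
  | seq _ _ ih₁ ih₂ =>
    simp only [maxCost] at hD
    obtain ⟨t₁, ρ₁, r₁, k₁, l₁⟩ := ih₁ (by omega) ρ hρ
    obtain ⟨t₂, ρ₂, r₂, k₂, l₂⟩ := ih₂ (by omega) ρ₁ k₁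
    exact ⟨_, _, Run.seq r₁ r₂, k₂, by omega⟩
  | iteTrue h₁ h₂ h _ ih =>
    simp only [maxCost] at hD
    obtain ⟨ρ₁, ρ₂, r₁, r₂, k, v₁, v₂⟩ := pair h₁ h₂ ρ hρ
    obtain ⟨t, ρ₃, r₃, k₃, l₃⟩ := ih (by omega) ρ₂ k.tick
    refine ⟨_, _, Run.seq r₁ (Run.seq r₂ (Run.ifTrue (by rwa [v₁, v₂]) r₃)), k₃, ?_⟩
    simp only [HState.tick_time, mul_add] at l₃
    omega
  | iteFalse h₁ h₂ h _ ih =>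
    simp only [maxCost] at hD
    obtain ⟨ρ₁, ρ₂, r₁, r₂, k, v₁, v₂⟩ := pair h₁ h₂ ρ hρ
    obtain ⟨t, ρ₃, r₃, k₃, l₃⟩ := ih (by omega) ρ₂ k.tick
    refine ⟨_, _, Run.seq r₁ (Run.seq r₂ (Run.ifFalse (by rwa [v₁, v₂]) r₃)), k₃, ?_⟩
    simp only [HState.tick_time, mul_add] at l₃
    omega
  | whTrue h₁ h₂ h _ _ ih₁ ih₂ =>
    have hD' := hD
    simp only [maxCost] at hD'
    obtain ⟨ρ₁, ρ₂, r₁, r₂, k, v₁, v₂⟩ := pair h₁ h₂ ρ hρ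
    obtain ⟨t, ρ₃, r₃, k₃, l₃⟩ := ih₁ (by omega) ρ₂ k.tick
    obtain ⟨t', ρ₄, r₄, k₄, l₄⟩ := ih₂ hD ρ₃ k₃
    -- The compiled loop evaluates its guard once in front and again at the end of the body. The
    -- guard evaluation that opens the run of the remaining iterations is therefore detached and
    -- becomes the end of the current body.
    cases r₄ with
    | seq ra rb =>
      cases rb with
      | seq rb rc =>
        refine ⟨_, _, Run.seq r₁ (Run.seq r₂ (Run.whileTrue (by rwa [v₁, v₂])
          (Run.seq r₃ (Run.seq ra rb)) rc)), k₄, ?_⟩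
        simp only [HState.tick_time, mul_add] at l₃
        omega
  | whFalse h₁ h₂ h =>
    simp only [maxCost] at hD
    obtain ⟨ρ₁, ρ₂, r₁, r₂, k, v₁, v₂⟩ := pair h₁ h₂ ρ hρ
    refine ⟨_, _, Run.seq r₁ (Run.seq r₂ (Run.whileFalse (by rwa [v₁, v₂]))), k.tick, ?_⟩
    simp only [HState.tick_time, mul_add]
    omega

end Compile

/-! ### Weakest preconditions -/

attribute [simp] Ex.val Ex.Safe

/-- The command halts in a state with property `Q`. -/
def wp (E : Env) (c : Cmd) (Q : HState → Prop) (σ : HState) : Prop := ∃ τ, HRun E c σ τ ∧ Q τ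

section WP

variable {E : Env} {Q Q' : HState → Prop} {σ : HState}

@[simp] theorem wp_skip : wp E .skip Q σ ↔ Q σ.tick :=
  ⟨fun ⟨_, h, hq⟩ => by cases h; exact hq, fun h => ⟨_, .skip _, h⟩⟩

@[simp] theorem wp_set {x : Reg} {e : Ex} :
    wp E (.set x e) Q σ ↔ e.Safe E σ ∧ Q (σ.set x (e.val E σ)) :=
  ⟨fun ⟨_, h, hq⟩ => by cases h; exact ⟨‹_›, hq⟩, fun h => ⟨_, .set _ _ _ h.1, h.2⟩⟩

@[simp] theorem wp_st {a : Arr} {i e : Ex} :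
    wp E (.st a i e) Q σ ↔ i.Safe E σ ∧ e.Safe E σ ∧ Q (σ.st a (i.val E σ) (e.val E σ)) :=
  ⟨fun ⟨_, h, hq⟩ => by cases h; exact ⟨‹_›, ‹_›, hq⟩,
    fun h => ⟨_, .st _ _ _ _ h.1 h.2.1, h.2.2⟩⟩

@[simp] theorem wp_seq {p q : Cmd} : wp E (.seq p q) Q σ ↔ wp E p (wp E q Q) σ := by
  constructor
  · rintro ⟨_, h, hq⟩
    cases h with
    | seq h₁ h₂ => exact ⟨_, h₁, _, h₂, hq⟩
  · rintro ⟨_, h₁, _, h₂, hq⟩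
    exact ⟨_, .seq h₁ h₂, hq⟩

@[simp] theorem wp_ite {e₁ e₂ : Ex} {p q : Cmd} :
    wp E (.ite e₁ e₂ p q) Q σ ↔ e₁.Safe E σ ∧ e₂.Safe E σ ∧
      (e₁.val E σ < e₂.val E σ → wp E p Q σ.tick) ∧
      (¬ e₁.val E σ < e₂.val E σ → wp E q Q σ.tick) := by
  constructor
  · rintro ⟨_, h, hq⟩
    cases h with
    | iteTrue h₁ h₂ h hp => exact ⟨h₁, h₂, fun _ => ⟨_, hp, hq⟩, fun h' => absurd h h'⟩
    | iteFalse h₁ h₂ h hp => exact ⟨h₁, h₂, fun h' => absurd h' h, fun _ => ⟨_, hp, hq⟩⟩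
  · rintro ⟨h₁, h₂, ht, hf⟩
    by_cases h : e₁.val E σ < e₂.val E σ
    · obtain ⟨τ, hp, hq⟩ := ht h
      exact ⟨τ, .iteTrue h₁ h₂ h hp, hq⟩
    · obtain ⟨τ, hp, hq⟩ := hf h
      exact ⟨τ, .iteFalse h₁ h₂ h hp, hq⟩

/-- Deliberately not a simp lemma: the loop reappears on the right-hand side. -/
theorem wp_wh {e₁ e₂ : Ex} {p : Cmd} :
    wp E (.wh e₁ e₂ p) Q σ ↔ e₁.Safe E σ ∧ e₂.Safe E σ ∧
      (e₁.val E σ < e₂.val E σ → wp E p (wp E (.wh e₁ e₂ p) Q) σ.tick) ∧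
      (¬ e₁.val E σ < e₂.val E σ → Q σ.tick) := by
  constructor
  · rintro ⟨_, h, hq⟩
    cases h with
    | whTrue h₁ h₂ h hp hw => exact ⟨h₁, h₂, fun _ => ⟨_, hp, _, hw, hq⟩, fun h' => absurd h h'⟩
    | whFalse h₁ h₂ h => exact ⟨h₁, h₂, fun h' => absurd h' h, fun _ => hq⟩
  · rintro ⟨h₁, h₂, ht, hf⟩
    by_cases h : e₁.val E σ < e₂.val E σ
    · obtain ⟨τ, hp, τ', hw, hq⟩ := ht h
      exact ⟨τ', .whTrue h₁ h₂ h hp hw, hq⟩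
    · exact ⟨_, .whFalse h₁ h₂ h, hf h⟩

theorem wp.mono {c : Cmd} (h : wp E c Q σ) (hQ : ∀ τ, Q τ → Q' τ) : wp E c Q' σ :=
  let ⟨τ, hr, hq⟩ := h
  ⟨τ, hr, hQ τ hq⟩

end WP

namespace Cmd

/-- The registers that a command may change. -/
def modR : Cmd → List Reg
  | skip | st _ _ _ => []
  | set x _ => [x]
  | seq p q | ite _ _ p q => p.modR ++ q.modR
  | wh _ _ p => p.modR

/-- The arrays that a command may change. -/
def modA : Cmd → List Arr
  | skip | set _ _ => []
  | st a _ _ => [a]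
  | seq p q | ite _ _ p q => p.modA ++ q.modA
  | wh _ _ p => p.modA

end Cmd

/-- Everything a command does not mention on a left-hand side keeps its value. -/
structure Frame (c : Cmd) (σ τ : HState) : Prop where
  reg : ∀ x ∉ c.modR, τ.reg x = σ.reg x
  arr : ∀ a ∉ c.modA, τ.arr a = σ.arr a

theorem HRun.frame {E : Env} {c : Cmd} {σ τ : HState} (h : HRun E c σ τ) : Frame c σ τ := by
  induction h with
  | skip => exact ⟨fun _ _ => rfl, fun _ _ => rfl⟩
  | set x e σ => exact ⟨fun y hy => by simp_all [Cmd.modR], fun _ _ => rfl⟩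
  | st a i e σ => exact ⟨fun _ _ => rfl, fun y hy => by simp_all [Cmd.modA]⟩
  | seq _ _ ih₁ ih₂ =>
    refine ⟨fun x hx => ?_, fun x hx => ?_⟩ <;>
      simp only [Cmd.modR, Cmd.modA, List.mem_append, not_or] at hx
    · rw [ih₂.reg x hx.2, ih₁.reg x hx.1]
    · rw [ih₂.arr x hx.2, ih₁.arr x hx.1]
  | iteTrue _ _ _ _ ih =>
    refine ⟨fun x hx => ?_, fun x hx => ?_⟩ <;>
      simp only [Cmd.modR, Cmd.modA, List.mem_append, not_or] at hx
    · exact ih.reg x hx.1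
    · exact ih.arr x hx.1
  | iteFalse _ _ _ _ ih =>
    refine ⟨fun x hx => ?_, fun x hx => ?_⟩ <;>
      simp only [Cmd.modR, Cmd.modA, List.mem_append, not_or] at hx
    · exact ih.reg x hx.2
    · exact ih.arr x hx.2
  | whTrue _ _ _ _ _ ih₁ ih₂ =>
    refine ⟨fun x hx => ?_, fun x hx => ?_⟩
    · rw [ih₂.reg x hx, ih₁.reg x hx, HState.tick_reg]
    · rw [ih₂.arr x hx, ih₁.arr x hx, HState.tick_arr]
  | whFalse => exact ⟨fun _ _ => rfl, fun _ _ => rfl⟩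

/-- What a command leaves unchanged can be read off its text, so inductions over loops need to track
only what changes. -/
theorem wp.frame {E : Env} {c : Cmd} {Q Q' : HState → Prop} {σ : HState} (h : wp E c Q σ)
    (hQ : ∀ τ, Q τ → Frame c σ τ → Q' τ) : wp E c Q' σ :=
  let ⟨τ, hr, hq⟩ := h
  ⟨τ, hr, hQ τ hq hr.frame⟩

/-! ### Segments of arrays -/

/-- The list of the entries `f lo, …, f (lo + k - 1)`. -/
def seg (f : ℕ → ℕ) : ℕ → ℕ → List ℕ
  | _, 0 => []
  | lo, k + 1 => f lo :: seg f (lo + 1) k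

@[simp] theorem seg_zero (f : ℕ → ℕ) (lo : ℕ) : seg f lo 0 = [] := rfl

theorem seg_succ (f : ℕ → ℕ) (lo k : ℕ) : seg f lo (k + 1) = f lo :: seg f (lo + 1) k := rfl

@[simp] theorem length_seg (f : ℕ → ℕ) (lo k : ℕ) : (seg f lo k).length = k := by
  induction k generalizing lo with
  | zero => rfl
  | succ k ih => simp [seg_succ, ih]

theorem seg_congr {f g : ℕ → ℕ} {lo k : ℕ} (h : ∀ i, lo ≤ i → i < lo + k → f i = g i) :
    seg f lo k = seg g lo k := by
  induction k generalizing lo with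
  | zero => rfl
  | succ k ih =>
    rw [seg_succ, seg_succ, h lo le_rfl (by omega),
      ih fun i h₁ h₂ => h i (by omega) (by omega)]

theorem seg_add (f : ℕ → ℕ) (lo k l : ℕ) :
    seg f lo (k + l) = seg f lo k ++ seg f (lo + k) l := by
  induction k generalizing lo with
  | zero => simp
  | succ k ih =>
    rw [show k + 1 + l = k + l + 1 by ring, seg_succ, seg_succ, ih,
      show lo + 1 + k = lo + (k + 1) by ring]
    rfl

theorem mem_seg {f : ℕ → ℕ} {lo k x : ℕ} :
    x ∈ seg f lo k ↔ ∃ i, lo ≤ i ∧ i < lo + k ∧ f i = x := by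
  induction k generalizing lo with
  | zero => simp; omega
  | succ k ih =>
    rw [seg_succ, List.mem_cons, ih]
    constructor
    · rintro (rfl | ⟨i, h₁, h₂, rfl⟩)
      · exact ⟨lo, le_rfl, by omega, rfl⟩
      · exact ⟨i, by omega, by omega, rfl⟩
    · rintro ⟨i, h₁, h₂, rfl⟩
      rcases h₁.eq_or_lt with rfl | h
      · exact .inl rfl
      · exact .inr ⟨i, by omega, by omega, rfl⟩

theorem getElem_seg {f : ℕ → ℕ} {lo k i : ℕ} (h : i < (seg f lo k).length) :
    (seg f lo k)[i] = f (lo + i) := by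
  induction k generalizing lo i with
  | zero => simp at h
  | succ k ih =>
    cases i with
    | zero => rfl
    | succ i =>
      simp only [seg_succ, List.getElem_cons_succ]
      rw [ih]
      congr 1
      omega

theorem seg_eq_of_forall {f : ℕ → ℕ} {lo k : ℕ} {l : List ℕ} (hl : l.length = k)
    (h : ∀ i (hi : i < l.length), f (lo + i) = l[i]) : seg f lo k = l :=
  List.ext_getElem (by simp [hl]) fun i _ h₂ => by rw [getElem_seg, h i h₂]

/-! ### Environments for sorting -/

/-- The relation is a linear order, and numbers may be large compared to the input length. -/
structure Env.Valid (E : Env) : Prop where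
  total : ∀ i j, E.r i j ∨ E.r j i
  trans : ∀ i j k, E.r i j → E.r j k → E.r i k
  antisymm : ∀ i j, E.r i j → E.r j i → i = j
  large : 1000 * (E.n + 1) ^ 2 ≤ E.B

theorem Env.Valid.large' {E : Env} (h : E.Valid) : 1000 * (E.n + 1) ≤ E.B :=
  le_trans (Nat.mul_le_mul_left _ (Nat.le_self_pow (by norm_num) _)) h.large

open Classical in
/-- The order as a Boolean function. -/
noncomputable def Env.leb (E : Env) (i j : ℕ) : Bool := decide (E.r i j)

namespace Cmd

/-- Copy the cell with the index in register `i` of `a` to cell `o` of `d`, and advance `i`. -/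
def take (a d : Arr) (i : Reg) : Cmd :=
  .seq (.st d (.r .o) (.ld a (.r i))) (.set i (.add (.r i) (.c 1)))

/-- Merge the segments `p, …, pe - 1` and `r, …, re - 1` of `a` to the segment of `d` that starts
at `o`. -/
def merge (a d : Arr) : Cmd :=
  .wh (.c 0) (.add (.sub (.r .pe) (.r .p)) (.sub (.r .re) (.r .r)))
    (.seq
      (.ite (.r .r) (.r .re)
        (.ite (.r .p) (.r .pe)
          (.ite (.c 0) (.le (.ld a (.r .p)) (.ld a (.r .r)))
            (take a d .p)
            (take a d .r))
          (take a d .r))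
        (take a d .p))
      (.set .o (.add (.r .o) (.c 1))))

end Cmd

/-- Induction on the number of elements left, parallel to the recursion of `List.merge`. The arrays
have to differ, since a store must not disturb what is still to be read. An element costs seven
steps: at most four tests and three assignments. -/
theorem wp_merge_core {E : Env} (hE : E.Valid) {a d : Arr} (had : a ≠ d) (m : ℕ) :
    ∀ (σ : HState), σ.reg .pe - σ.reg .p + (σ.reg .re - σ.reg .r) = m →
      σ.reg .pe ≤ 4 * E.n → σ.reg .re ≤ 4 * E.n → σ.reg .o + m ≤ 4 * E.n →
      (∀ i, σ.reg .p ≤ i → i < σ.reg .pe → σ.arr a i < E.n) →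
      (∀ i, σ.reg .r ≤ i → i < σ.reg .re → σ.arr a i < E.n) →
      wp E (Cmd.merge a d) (fun τ =>
        seg (τ.arr d) (σ.reg .o) m =
          List.merge (seg (σ.arr a) (σ.reg .p) (σ.reg .pe - σ.reg .p))
            (seg (σ.arr a) (σ.reg .r) (σ.reg .re - σ.reg .r)) E.leb ∧
        (∀ i, i < σ.reg .o ∨ σ.reg .o + m ≤ i → τ.arr d i = σ.arr d i) ∧
        τ.time ≤ σ.time + 7 * m + 1) σ := by
  have hB := hE.large'
  induction m with
  | zero =>
    intro σ hm hpe hre ho hp hr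
    rw [Cmd.merge, wp_wh]
    simp only [Ex.Safe, Ex.val, hm]
    have h1 : σ.reg .pe - σ.reg .p = 0 := by omega
    have h2 : σ.reg .re - σ.reg .r = 0 := by omega
    simp [h1, h2]
    omega
  | succ m ih =>
    intro σ hm hpe hre ho hp hr
    -- `k` is the number of tests passed on the way to this assignment, so one statement serves all
    -- branches that end here.
    have takeP : σ.reg .p < σ.reg .pe → (∀ (h : σ.reg .r < σ.reg .re),
        E.r (σ.arr a (σ.reg .p)) (σ.arr a (σ.reg .r))) → ∀ k ≤ 4,
        wp E (Cmd.take a d .p) (wp E (.set .o (.add (.r .o) (.c 1))) (wp E (Cmd.merge a d) fun τ =>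
        seg (τ.arr d) (σ.reg .o) (m + 1) =
          List.merge (seg (σ.arr a) (σ.reg .p) (σ.reg .pe - σ.reg .p))
            (seg (σ.arr a) (σ.reg .r) (σ.reg .re - σ.reg .r)) E.leb ∧
        (∀ i, i < σ.reg .o ∨ σ.reg .o + (m + 1) ≤ i → τ.arr d i = σ.arr d i) ∧
        τ.time ≤ σ.time + 7 * (m + 1) + 1)) ⟨σ.reg, σ.arr, σ.time + k⟩ := by
      intro hlt hle k hk
      simp only [Cmd.take, wp_seq, wp_set, wp_st, Ex.val, Ex.Safe]
      simp only [HState.st_reg, HState.set_reg, reduceCtorEq, if_false, true_and]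
      refine ⟨by omega, by omega, (ih _ ?_ ?_ ?_ ?_ ?_ ?_).mono ?_⟩
      all_goals simp [had]
      all_goals try omega
      · intro i hi; exact hp i (by omega)
      · intro τ h1 h2 h3
        refine ⟨?_, fun i hi => ?_, by omega⟩
        · rw [seg_succ, h1, h2 _ (by omega)]
          rw [show σ.reg .pe - σ.reg .p = σ.reg .pe - (σ.reg .p + 1) + 1 by omega, seg_succ]
          by_cases h : σ.reg .r < σ.reg .re
          · rw [show σ.reg .re - σ.reg .r = σ.reg .re - (σ.reg .r + 1) + 1 by omega, seg_succ]
            simp [Env.leb, hle h]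
          · rw [show σ.reg .re - σ.reg .r = 0 by omega]
            simp
        · rw [h2 i (by omega), Function.update_of_ne (by omega)]
    have takeR : σ.reg .r < σ.reg .re → (∀ (h : σ.reg .p < σ.reg .pe),
        ¬ E.r (σ.arr a (σ.reg .p)) (σ.arr a (σ.reg .r))) → ∀ k ≤ 4,
        wp E (Cmd.take a d .r) (wp E (.set .o (.add (.r .o) (.c 1))) (wp E (Cmd.merge a d) fun τ =>
        seg (τ.arr d) (σ.reg .o) (m + 1) =
          List.merge (seg (σ.arr a) (σ.reg .p) (σ.reg .pe - σ.reg .p))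
            (seg (σ.arr a) (σ.reg .r) (σ.reg .re - σ.reg .r)) E.leb ∧
        (∀ i, i < σ.reg .o ∨ σ.reg .o + (m + 1) ≤ i → τ.arr d i = σ.arr d i) ∧
        τ.time ≤ σ.time + 7 * (m + 1) + 1)) ⟨σ.reg, σ.arr, σ.time + k⟩ := by
      intro hlt hle k hk
      simp only [Cmd.take, wp_seq, wp_set, wp_st, Ex.val, Ex.Safe]
      simp only [HState.st_reg, HState.set_reg, reduceCtorEq, if_false, true_and]
      refine ⟨by omega, by omega, (ih _ ?_ ?_ ?_ ?_ ?_ ?_).mono ?_⟩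
      all_goals simp [had]
      all_goals try omega
      · intro i hi; exact hr i (by omega)
      · intro τ h1 h2 h3
        refine ⟨?_, fun i hi => ?_, by omega⟩
        · rw [seg_succ, h1, h2 _ (by omega)]
          rw [show σ.reg .re - σ.reg .r = σ.reg .re - (σ.reg .r + 1) + 1 by omega, seg_succ]
          by_cases h : σ.reg .p < σ.reg .pe
          · rw [show σ.reg .pe - σ.reg .p = σ.reg .pe - (σ.reg .p + 1) + 1 by omega, seg_succ]
            simp [Env.leb, hle h]
          · rw [show σ.reg .pe - σ.reg .p = 0 by omega]
            simp
        · rw [h2 i (by omega), Function.update_of_ne (by omega)]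
    rw [Cmd.merge, wp_wh, ← Cmd.merge]
    simp only [Ex.Safe, Ex.val, hm, wp_seq, wp_ite]
    refine ⟨by omega, ⟨by simp, by simp, by omega⟩, fun _ => ?_, fun h => by omega⟩
    refine ⟨trivial, trivial, fun h1 => ⟨trivial, trivial, fun h2 => ⟨by omega, ?_, fun h3 => ?_,
      fun h3 => ?_⟩, fun h2 => ?_⟩, fun h1 => ?_⟩
    · exact ⟨trivial, trivial, hp _ le_rfl h2, hr _ le_rfl h1⟩
    · refine takeP h2 (fun _ => ?_) 4 (by omega)
      by_contra hc
      simp [hc] at h3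
    · refine takeR h1 (fun _ => ?_) 4 (by omega)
      intro hc
      simp [hc] at h3
    · exact takeR h1 (fun h => absurd h h2) 3 (by omega)
    · simp at h1
      exact takeP (by omega) (fun h => absurd h (by omega)) 2 (by omega)

/-- The usable form of the core statement, with an arbitrary continuation `Q` and with the unchanged
registers and arrays supplied by the frame rule. Most of the later loops come in the same two forms.
-/
theorem wp_merge {E : Env} (hE : E.Valid) {a d : Arr} (had : a ≠ d) {σ : HState} {m : ℕ}
    {Q : HState → Prop} (hm : σ.reg .pe - σ.reg .p + (σ.reg .re - σ.reg .r) = m)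
    (hpe : σ.reg .pe ≤ 4 * E.n) (hre : σ.reg .re ≤ 4 * E.n) (ho : σ.reg .o + m ≤ 4 * E.n)
    (hp : ∀ i, σ.reg .p ≤ i → i < σ.reg .pe → σ.arr a i < E.n)
    (hr : ∀ i, σ.reg .r ≤ i → i < σ.reg .re → σ.arr a i < E.n)
    (hQ : ∀ τ : HState,
      seg (τ.arr d) (σ.reg .o) m =
        List.merge (seg (σ.arr a) (σ.reg .p) (σ.reg .pe - σ.reg .p))
          (seg (σ.arr a) (σ.reg .r) (σ.reg .re - σ.reg .r)) E.leb →
      (∀ i, i < σ.reg .o ∨ σ.reg .o + m ≤ i → τ.arr d i = σ.arr d i) →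
      τ.time ≤ σ.time + 7 * m + 1 →
      (∀ x, x ≠ .p → x ≠ .r → x ≠ .o → τ.reg x = σ.reg x) →
      (∀ b, b ≠ d → τ.arr b = σ.arr b) → Q τ) :
    wp E (Cmd.merge a d) Q σ := by
  refine (wp_merge_core hE had m σ hm hpe hre ho hp hr).frame fun τ h hF => ?_
  refine hQ τ h.1 h.2.1 h.2.2 (fun x h₁ h₂ h₃ => hF.reg x ?_) fun b hb => hF.arr b ?_
  · simp [Cmd.merge, Cmd.take, Cmd.modR, h₁, h₂, h₃]
  · simp [Cmd.merge, Cmd.take, Cmd.modA, hb]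

theorem Env.Valid.pairwise_merge {E : Env} (hE : E.Valid) {l₁ l₂ : List ℕ} (h₁ : l₁.Pairwise E.r)
    (h₂ : l₂.Pairwise E.r) : (List.merge l₁ l₂ E.leb).Pairwise E.r := by
  have := List.pairwise_merge (le := E.leb)
    (fun a b c h h' => by simp [Env.leb] at *; exact hE.trans _ _ _ h h')
    (fun a b => by simp [Env.leb]; exact hE.total a b) l₁ l₂
    (h₁.imp (by simp [Env.leb])) (h₂.imp (by simp [Env.leb]))
  exact this.imp (by simp [Env.leb])

namespace Cmd

/-- Copy the segment `i0, …, i1 - 1` of `a` to the segment of `d` that starts at `j`. -/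
def copy (a d : Arr) : Cmd :=
  .wh (.r .i0) (.r .i1) (.seq (.st d (.r .j) (.ld a (.r .i0)))
    (.seq (.set .i0 (.add (.r .i0) (.c 1))) (.set .j (.add (.r .j) (.c 1)))))

end Cmd

theorem wp_copy_core {E : Env} (hE : E.Valid) {a d : Arr} (had : a ≠ d) (m : ℕ) :
    ∀ (σ : HState), σ.reg .i1 - σ.reg .i0 = m → σ.reg .i1 ≤ 4 * E.n → σ.reg .j + m ≤ 4 * E.n →
      wp E (Cmd.copy a d) (fun τ =>
        seg (τ.arr d) (σ.reg .j) m = seg (σ.arr a) (σ.reg .i0) m ∧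
        (∀ i, i < σ.reg .j ∨ σ.reg .j + m ≤ i → τ.arr d i = σ.arr d i) ∧
        τ.time = σ.time + 4 * m + 1 ∧ τ.reg .j = σ.reg .j + m) σ := by
  have hB := hE.large'
  induction m with
  | zero =>
    intro σ hm hi hj
    rw [Cmd.copy, wp_wh]
    simp only [Ex.Safe, Ex.val]
    refine ⟨trivial, trivial, fun h => by omega, fun h => ?_⟩
    simp
  | succ m ih =>
    intro σ hm hi hj
    rw [Cmd.copy, wp_wh, ← Cmd.copy]
    simp only [Ex.Safe, Ex.val, wp_seq, wp_set, wp_st]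
    simp only [HState.st_reg, HState.set_reg, reduceCtorEq, if_false, HState.tick_reg, true_and]
    refine ⟨fun h => ⟨by omega, by omega, (ih _ ?_ ?_ ?_).mono ?_⟩, fun h => by omega⟩
    all_goals simp [had]
    all_goals try omega
    intro τ h1 h2 h3 h4
    refine ⟨?_, fun i hi => ?_, by omega, by omega⟩
    · rw [seg_succ, seg_succ, h1, h2 _ (by omega)]
      simp
    · rw [h2 i (by omega), Function.update_of_ne (by omega)]

theorem wp_copy {E : Env} (hE : E.Valid) {a d : Arr} (had : a ≠ d) {σ : HState} {m : ℕ}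
    {Q : HState → Prop} (hm : σ.reg .i1 - σ.reg .i0 = m) (hi : σ.reg .i1 ≤ 4 * E.n)
    (hj : σ.reg .j + m ≤ 4 * E.n)
    (hQ : ∀ τ : HState, seg (τ.arr d) (σ.reg .j) m = seg (σ.arr a) (σ.reg .i0) m →
      (∀ i, i < σ.reg .j ∨ σ.reg .j + m ≤ i → τ.arr d i = σ.arr d i) →
      τ.time = σ.time + 4 * m + 1 → τ.reg .j = σ.reg .j + m →
      (∀ x, x ≠ .i0 → x ≠ .j → τ.reg x = σ.reg x) →
      (∀ b, b ≠ d → τ.arr b = σ.arr b) → Q τ) :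
    wp E (Cmd.copy a d) Q σ := by
  refine (wp_copy_core hE had m σ hm hi hj).frame fun τ h hF => ?_
  refine hQ τ h.1 h.2.1 h.2.2.1 h.2.2.2 (fun x h₁ h₂ => hF.reg x ?_) fun b hb => hF.arr b ?_
  · simp [Cmd.copy, Cmd.modR, h₁, h₂]
  · simp [Cmd.copy, Cmd.modA, hb]

/-! ### Merge sort -/

/-- Each of the consecutive chunks of length `w` of the segment is sorted. -/
def ChunkSorted (E : Env) (f : ℕ → ℕ) (lo len w : ℕ) : Prop :=
  ∀ k, (seg f (lo + k * w) (min w (len - k * w))).Pairwise E.r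

/-- The minimum of two expressions. -/
def Ex.min (e₁ e₂ : Ex) : Ex := .sub e₁ (.sub e₁ e₂)

namespace Cmd

/-- Merge pairs of consecutive chunks of length `w` of the segment `u, …, hi - 1` of `a`. -/
def pass (a d : Arr) : Cmd :=
  .wh (.r .u) (.r .hi)
    (.seq (.set .p (.r .u))
    (.seq (.set .pe (.min (.add (.r .u) (.r .w)) (.r .hi)))
    (.seq (.set .r (.r .pe))
    (.seq (.set .re (.min (.add (.r .u) (.add (.r .w) (.r .w))) (.r .hi)))
    (.seq (.set .o (.r .u))
    (.seq (merge a d)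
    (.set .u (.r .re))))))))

/-- Sort the segment `lo, …, hi - 1` of `a` given that its chunks of length `w` are sorted. -/
def msortLoop (a d : Arr) : Cmd :=
  .wh (.r .w) (.sub (.r .hi) (.r .lo))
    (.seq (.set .u (.r .lo))
    (.seq (pass a d)
    (.seq (.set .i0 (.r .lo))
    (.seq (.set .i1 (.r .hi))
    (.seq (.set .j (.r .lo))
    (.seq (copy d a)
    (.set .w (.add (.r .w) (.r .w)))))))))

/-- Sort the segment `lo, …, hi - 1` of `a`. -/
def msort (a d : Arr) : Cmd := .seq (.set .w (.c 1)) (msortLoop a d)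

end Cmd

/-- A round consumes `min (2 * w) len` entries, whence strong induction. If at most `w` entries are
left, the second chunk is empty and merging only copies. -/
theorem wp_pass_core {E : Env} (hE : E.Valid) {a d : Arr} (had : a ≠ d) (len : ℕ) :
    ∀ (σ : HState), σ.reg .hi - σ.reg .u = len → σ.reg .hi ≤ 4 * E.n → 0 < σ.reg .w →
      σ.reg .w ≤ 4 * E.n →
      (∀ i, σ.reg .u ≤ i → i < σ.reg .hi → σ.arr a i < E.n) →
      wp E (Cmd.pass a d) (fun τ =>
        (seg (τ.arr d) (σ.reg .u) len).Perm (seg (σ.arr a) (σ.reg .u) len) ∧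
        (ChunkSorted E (σ.arr a) (σ.reg .u) len (σ.reg .w) →
          ChunkSorted E (τ.arr d) (σ.reg .u) len (2 * σ.reg .w)) ∧
        (∀ i, i < σ.reg .u ∨ σ.reg .u + len ≤ i → τ.arr d i = σ.arr d i) ∧
        τ.time ≤ σ.time + 16 * len + 1) σ := by
  have hB := hE.large'
  induction len using Nat.strong_induction_on with
  | _ len ih =>
    intro σ hlen hhi hw hw' ha
    rw [Cmd.pass, wp_wh, ← Cmd.pass]
    simp only [Ex.Safe, Ex.val, Ex.min, wp_seq, wp_set]
    simp only [HState.set_reg, reduceCtorEq, if_false, if_true, HState.tick_reg, true_and,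
      and_true, and_self]
    refine ⟨fun h => ⟨by omega, by omega, ?_⟩, fun h => ?_⟩
    swap
    · obtain rfl : len = 0 := by omega
      simp [ChunkSorted]
    set m := min (2 * σ.reg .w) len with hm
    refine wp_merge hE had (m := m) ?_ ?_ ?_ ?_ ?_ ?_ ?_
    all_goals simp
    all_goals try omega
    · intro i h1 h2; exact ha i (by omega) (by omega)
    · intro i h1 h2; exact ha i (by omega) (by omega)
    intro τ h1 h2 h3 h4 h5
    refine (ih (len - m) (by omega) _ ?_ ?_ ?_ ?_ ?_).mono ?_
    all_goals simp [h4, h5, had]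
    all_goals try omega
    · intro i h1 h2; exact ha i (by omega) (by omega)
    intro τ' k1 k2 k3 k4
    have hu : σ.reg .u + (σ.reg .w + σ.reg .w) -
        (σ.reg .u + (σ.reg .w + σ.reg .w) - σ.reg .hi) = σ.reg .u + m := by omega
    rw [hu] at k1 k2 k3
    have e : ∀ f, seg f (σ.reg .u) len = seg f (σ.reg .u) m ++ seg f (σ.reg .u + m) (len - m) := by
      intro f
      rw [← seg_add]
      congr 1
      omega
    set m₁ := min (σ.reg .w) len with hm₁
    have hpe : σ.reg .u + σ.reg .w - (σ.reg .u + σ.reg .w - σ.reg .hi) = σ.reg .u + m₁ := by omega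
    have heq : seg (τ'.arr d) (σ.reg .u) m = seg (τ.arr d) (σ.reg .u) m :=
      seg_congr fun i hi hi' => k3 i (by omega)
    rw [hu, hpe, show σ.reg .u + m₁ - σ.reg .u = m₁ by omega,
      show σ.reg .u + m - (σ.reg .u + m₁) = m - m₁ by omega] at h1
    refine ⟨?_, fun hc k => ?_, fun i hi => ?_, by omega⟩
    · rw [e, e, heq]
      refine List.Perm.append ?_ k1
      rw [h1]
      refine (List.merge_perm_append (le := E.leb)).trans ?_
      rw [← seg_add, show m₁ + (m - m₁) = m by omega]
    · cases k with
      | zero =>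
        simp only [zero_mul, add_zero, Nat.sub_zero]
        rw [← hm, heq, h1]
        refine hE.pairwise_merge ?_ ?_
        · have := hc 0
          simp only [zero_mul, add_zero, Nat.sub_zero] at this
          exact this
        · have := hc 1
          rw [one_mul] at this
          by_cases hlt : len ≤ σ.reg .w
          · rw [show m - m₁ = 0 by omega]; simp
          · rwa [show m₁ = σ.reg .w by omega, show m - σ.reg .w = min (σ.reg .w) (len - σ.reg .w)
              by omega]
      | succ k =>
        by_cases hlt : len ≤ 2 * σ.reg .w
        · have : len - (k + 1) * (2 * σ.reg .w) = 0 := by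
            rw [add_mul]; omega
          rw [this]; simp
        -- A full pair has been consumed, so the doubled chunk number `k + 1` of the segment is
        -- number `k` of the rest, and its two halves shift by two chunks of length `w`.
        · have hm2 : m = 2 * σ.reg .w := by omega
          have := k2 (fun k => ?_) k
          · rw [hm2] at this
            convert this using 2 <;> rw [add_mul] <;> omega
          · have := hc (k + 2)
            rw [hm2]
            convert this using 2 <;> rw [add_mul] <;> omega
    · rw [k3 i (by omega), h2 i (by omega)]

theorem wp_pass {E : Env} (hE : E.Valid) {a d : Arr} (had : a ≠ d) {σ : HState} {len : ℕ}
    {Q : HState → Prop} (hlen : σ.reg .hi - σ.reg .u = len) (hhi : σ.reg .hi ≤ 4 * E.n)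
    (hw : 0 < σ.reg .w) (hw' : σ.reg .w ≤ 4 * E.n)
    (ha : ∀ i, σ.reg .u ≤ i → i < σ.reg .hi → σ.arr a i < E.n)
    (hQ : ∀ τ : HState, (seg (τ.arr d) (σ.reg .u) len).Perm (seg (σ.arr a) (σ.reg .u) len) →
      (ChunkSorted E (σ.arr a) (σ.reg .u) len (σ.reg .w) →
        ChunkSorted E (τ.arr d) (σ.reg .u) len (2 * σ.reg .w)) →
      (∀ i, i < σ.reg .u ∨ σ.reg .u + len ≤ i → τ.arr d i = σ.arr d i) →
      τ.time ≤ σ.time + 16 * len + 1 →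
      (∀ x, x ≠ .p → x ≠ .pe → x ≠ .r → x ≠ .re → x ≠ .o → x ≠ .u → τ.reg x = σ.reg x) →
      (∀ b, b ≠ d → τ.arr b = σ.arr b) → Q τ) :
    wp E (Cmd.pass a d) Q σ := by
  refine (wp_pass_core hE had len σ hlen hhi hw hw' ha).frame fun τ h hF => ?_
  refine hQ τ h.1 h.2.1 h.2.2.1 h.2.2.2 (fun x h₁ h₂ h₃ h₄ h₅ h₆ => hF.reg x ?_)
    fun b hb => hF.arr b ?_
  · simp [Cmd.pass, Cmd.merge, Cmd.take, Cmd.modR, h₁, h₂, h₃, h₄, h₅, h₆]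
  · simp [Cmd.pass, Cmd.merge, Cmd.take, Cmd.modA, hb]

/-- `j` bounds the number of doublings of `w` that are still needed. A doubling costs 16 steps per
element for merging and 4 for copying back. -/
theorem wp_msortLoop {E : Env} (hE : E.Valid) {a d : Arr} (had : a ≠ d) (len j : ℕ) :
    ∀ (σ : HState), σ.reg .hi - σ.reg .lo = len → σ.reg .lo ≤ σ.reg .hi →
      σ.reg .hi ≤ 4 * E.n → 0 < σ.reg .w →
      len ≤ σ.reg .w * 2 ^ j → (∀ i, σ.reg .lo ≤ i → i < σ.reg .hi → σ.arr a i < E.n) →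
      ChunkSorted E (σ.arr a) (σ.reg .lo) len (σ.reg .w) →
      wp E (Cmd.msortLoop a d) (fun τ =>
        (seg (τ.arr a) (σ.reg .lo) len).Perm (seg (σ.arr a) (σ.reg .lo) len) ∧
        (seg (τ.arr a) (σ.reg .lo) len).Pairwise E.r ∧
        (∀ i, i < σ.reg .lo ∨ σ.reg .lo + len ≤ i → τ.arr a i = σ.arr a i) ∧
        τ.time ≤ σ.time + j * (20 * len + 10) + 1) σ := by
  have hB := hE.large'
  induction j with
  | zero =>
    intro σ hlen hlo hhi hw hw' ha hc
    rw [Cmd.msortLoop, wp_wh]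
    simp only [Ex.Safe, Ex.val]
    refine ⟨trivial, ⟨trivial, trivial⟩, fun h => by omega, fun h => ?_⟩
    have := hc 0
    simp only [zero_mul, add_zero, Nat.sub_zero] at this
    rw [Nat.min_eq_right (by omega)] at this
    simpa using this
  | succ j ih =>
    intro σ hlen hlo hhi hw hw' ha hc
    rw [Cmd.msortLoop, wp_wh, ← Cmd.msortLoop]
    simp only [Ex.Safe, Ex.val, wp_seq, wp_set]
    simp only [true_and]
    refine ⟨fun h => ?_, fun h => ?_⟩
    swap
    · have := hc 0
      simp only [zero_mul, add_zero, Nat.sub_zero] at this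
      rw [Nat.min_eq_right (by omega)] at this
      simp [this]
    refine wp_pass hE had (len := len) ?_ ?_ ?_ ?_ ?_ ?_
    all_goals simp
    all_goals try omega
    intro τ h1 h2 h3 h4 h5 h6
    refine wp_copy hE had.symm (m := len) ?_ ?_ ?_ ?_
    all_goals simp [h5]
    all_goals try omega
    intro τ' k1 k2 k3 k4 k5 k6
    simp [k5, h5]
    refine ⟨by omega, (ih _ ?_ ?_ ?_ ?_ ?_ ?_ ?_).mono ?_⟩
    all_goals simp [k5, h5]
    all_goals try omega
    · refine hw'.trans_eq ?_
      ring
    · intro i hi hi'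
      have hmem : τ'.arr a i ∈ seg (τ'.arr a) (σ.reg .lo) len := mem_seg.2 ⟨i, hi, by omega, rfl⟩
      rw [k1] at hmem
      obtain ⟨i', g1, g2, g3⟩ := mem_seg.1 (h1.subset hmem)
      rw [← g3]
      exact ha i' g1 (by omega)
    · intro k
      rw [← two_mul]
      have := h2 hc k
      convert this using 1
      -- Copying back is known as an equality of whole segments; cutting both sides at the two ends
      -- of chunk `k` yields the equality for that chunk.
      by_cases hk : k * (2 * σ.reg .w) < len
      · have e1 : ∀ f, seg f (σ.reg .lo) len = seg f (σ.reg .lo) (k * (2 * σ.reg .w)) ++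
            (seg f (σ.reg .lo + k * (2 * σ.reg .w)) (min (2 * σ.reg .w) (len - k * (2 * σ.reg .w))) ++
            seg f (σ.reg .lo + k * (2 * σ.reg .w) + min (2 * σ.reg .w) (len - k * (2 * σ.reg .w)))
              (len - (k * (2 * σ.reg .w) + min (2 * σ.reg .w) (len - k * (2 * σ.reg .w))))) := by
          intro f
          rw [← seg_add, ← seg_add]
          congr 1
          omega
        rw [e1, e1 (τ.arr d)] at k1
        exact (List.append_inj (List.append_inj k1 (by simp)).2 (by simp)).1
      · rw [show len - k * (2 * σ.reg .w) = 0 by omega]; simp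
    · intro τ'' l1 l2 l3 l4
      refine ⟨l1.trans (k1 ▸ h1), l2, fun i hi => ?_, ?_⟩
      · rw [l3 i hi, k2 i hi, h6 a had]
      · rw [add_mul]; omega

theorem wp_msort {E : Env} (hE : E.Valid) {a d : Arr} (had : a ≠ d) {σ : HState} {len j : ℕ}
    {Q : HState → Prop} (hlen : σ.reg .hi - σ.reg .lo = len) (hlo : σ.reg .lo ≤ σ.reg .hi)
    (hhi : σ.reg .hi ≤ 4 * E.n) (hj : len ≤ 2 ^ j)
    (ha : ∀ i, σ.reg .lo ≤ i → i < σ.reg .hi → σ.arr a i < E.n)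
    (hQ : ∀ τ : HState, (seg (τ.arr a) (σ.reg .lo) len).Perm (seg (σ.arr a) (σ.reg .lo) len) →
      (seg (τ.arr a) (σ.reg .lo) len).Pairwise E.r →
      (∀ i, i < σ.reg .lo ∨ σ.reg .lo + len ≤ i → τ.arr a i = σ.arr a i) →
      τ.time ≤ σ.time + j * (20 * len + 10) + 2 →
      (∀ x, x ≠ .p → x ≠ .pe → x ≠ .r → x ≠ .re → x ≠ .o → x ≠ .u → x ≠ .w → x ≠ .i0 →
        x ≠ .i1 → x ≠ .j → τ.reg x = σ.reg x) →
      (∀ b, b ≠ a → b ≠ d → τ.arr b = σ.arr b) → Q τ) :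
    wp E (Cmd.msort a d) Q σ := by
  have hB := hE.large'
  rw [Cmd.msort, wp_seq, wp_set]
  refine ⟨by simp only [Ex.Safe]; omega, ?_⟩
  refine (wp_msortLoop hE had len j _ ?_ ?_ ?_ ?_ ?_ ?_ ?_).frame ?_
  all_goals simp [Ex.val]
  all_goals try assumption
  · intro k
    have : min 1 (len - k * 1) = 0 ∨ min 1 (len - k * 1) = 1 := by omega
    rcases this with h | h <;> rw [h] <;> simp [seg_succ]
  · intro τ h1 h2 h3 h4 hF
    refine hQ τ h1 h2 h3 (by omega) (fun x g1 g2 g3 g4 g5 g6 g7 g8 g9 g10 => ?_) fun b hb hb' => ?_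
    · rw [hF.reg x]
      · simp [g7]
      · simp [Cmd.msortLoop, Cmd.pass, Cmd.merge, Cmd.copy, Cmd.take, Cmd.modR, *]
    · rw [hF.arr b]
      · simp
      · simp [Cmd.msortLoop, Cmd.pass, Cmd.merge, Cmd.copy, Cmd.take, Cmd.modA, *]

/-! ### The loops of one level of the sorting algorithm -/

namespace Cmd

/-- The end of the current list. -/
def listEnd : Ex := .add (.r .base) (.r .N)

/-- Sort the blocks of length `K` of the current list, from index `v` on. -/
def blockSort : Cmd :=
  .wh (.r .v) listEnd
    (.seq (.set .lo (.r .v))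
    (.seq (.set .hi (.min (.add (.r .v) (.r .K)) listEnd))
    (.seq (msort .X .Y)
    (.set .v (.r .hi)))))

/-- Store a number, which may depend on the index, in `a` for every `q`-th element of the current
list, from index `v` on. -/
def mark (a : Arr) (e : Ex) : Cmd :=
  .wh (.r .v) listEnd
    (.seq (.st a (.ld .X (.r .v)) e)
    (.set .v (.add (.r .v) (.r .q))))

/-- Append the flagged elements of `L` from index `v` on at `o`, and remove the flags. -/
def collect : Cmd :=
  .wh (.r .v) listEnd
    (.seq (.set .x (.ld .L (.r .v)))
    (.seq (.ite (.c 0) (.ld .F (.r .x))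
      (.seq (.st .L (.r .o) (.r .x))
      (.seq (.st .F (.r .x) (.c 0))
      (.set .o (.add (.r .o) (.c 1)))))
      .skip)
    (.set .v (.add (.r .v) (.c 1)))))

/-- Store for every sample the number of its strip, from rank `v` on. -/
def rank : Cmd :=
  .wh (.r .v) (.r .M)
    (.seq (.st .S (.ld .X (.add listEnd (.r .v))) (.div (.r .v) (.r .q)))
    (.set .v (.add (.r .v) (.c 1))))

end Cmd

/-- The permutation is recorded block by block, not only globally: that no element leaves its block
is what later makes the order of the blocks agree with the order of positions. -/
theorem wp_blockSort_core {E : Env} (hE : E.Valid) {κ : ℕ} (len : ℕ) :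
    ∀ σ : HState, σ.reg .base + σ.reg .N - σ.reg .v = len →
      σ.reg .base + σ.reg .N ≤ 4 * E.n →
      0 < σ.reg .K → σ.reg .K ≤ 2 ^ κ → σ.reg .K ≤ 4 * (E.n + 1) ^ 2 + 64 →
      (∀ i, σ.reg .v ≤ i → i < σ.reg .base + σ.reg .N → σ.arr .X i < E.n) →
      wp E Cmd.blockSort (fun τ =>
        (∀ k, (seg (τ.arr .X) (σ.reg .v + k * σ.reg .K) (min (σ.reg .K) (len - k * σ.reg .K))).Perm
          (seg (σ.arr .X) (σ.reg .v + k * σ.reg .K) (min (σ.reg .K) (len - k * σ.reg .K)))) ∧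
        ChunkSorted E (τ.arr .X) (σ.reg .v) len (σ.reg .K) ∧
        (seg (τ.arr .X) (σ.reg .v) len).Perm (seg (σ.arr .X) (σ.reg .v) len) ∧
        (∀ i, i < σ.reg .v ∨ σ.reg .v + len ≤ i → τ.arr .X i = σ.arr .X i) ∧
        τ.time ≤ σ.time + (30 * κ + 10) * len + 1) σ := by
  have hB := hE.large'
  have hBB := hE.large
  induction len using Nat.strong_induction_on with
  | _ len ih =>
    intro σ hlen hhi hK hK' hKn ha
    have hsq : (E.n + 1) ≤ (E.n + 1) ^ 2 := Nat.le_self_pow (by norm_num) _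
    rw [Cmd.blockSort, wp_wh, ← Cmd.blockSort]
    simp [Cmd.listEnd, Ex.min]
    refine ⟨by omega, fun h => ⟨by omega, ?_⟩, fun h => ?_⟩
    swap
    · obtain rfl : len = 0 := by omega
      simp [ChunkSorted]
    set m := min (σ.reg .K) len with hm
    have hu : σ.reg .v + σ.reg .K - (σ.reg .v + σ.reg .K - (σ.reg .base + σ.reg .N)) =
        σ.reg .v + m := by omega
    simp only [hu]
    refine wp_msort hE (by simp) (len := m) (j := κ) ?_ ?_ ?_ ?_ ?_ ?_
    all_goals try simp
    all_goals try omega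
    · intro i h1 h2; exact ha i (by omega) (by omega)
    intro τ h1 h2 h3 h4 h5 h6
    refine (ih (len - m) (by omega) _ ?_ ?_ ?_ ?_ ?_ ?_).mono ?_
    all_goals simp [h5]
    all_goals try omega
    · intro i g1 g2
      rw [h3 i (by omega)]
      exact ha i (by omega) g2
    intro τ' k1 k2 k3 k4 k5
    have e : ∀ f, seg f (σ.reg .v) len = seg f (σ.reg .v) m ++ seg f (σ.reg .v + m) (len - m) := by
      intro f
      rw [← seg_add]
      congr 1
      omega
    have heq : seg (τ'.arr .X) (σ.reg .v) m = seg (τ.arr .X) (σ.reg .v) m :=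
      seg_congr fun i hi hi' => k4 i (by omega)
    have heq' : seg (τ.arr .X) (σ.reg .v + m) (len - m) = seg (σ.arr .X) (σ.reg .v + m) (len - m) :=
      seg_congr fun i hi hi' => h3 i (by omega)
    have shift : ∀ k, σ.reg .K < len →
        σ.reg .v + (k + 1) * σ.reg .K = σ.reg .v + m + k * σ.reg .K ∧
        len - (k + 1) * σ.reg .K = len - m - k * σ.reg .K := by
      intro k hk
      rw [add_mul]
      omega
    have hz : ∀ k, ¬ σ.reg .K < len → len - (k + 1) * σ.reg .K = 0 := by
      intro k hk
      rw [add_mul]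
      omega
    refine ⟨fun k => ?_, fun k => ?_, ?_, fun i hi => ?_, ?_⟩
    · cases k with
      | zero =>
        simp only [zero_mul, add_zero, Nat.sub_zero]
        rw [← hm, heq]
        exact h1
      | succ k =>
        by_cases hlt : σ.reg .K < len
        · rw [(shift k hlt).1, (shift k hlt).2]
          refine (k1 k).trans (List.Perm.of_eq (seg_congr fun i hi hi' => h3 i ?_))
          omega
        · rw [hz k hlt]; simp
    · cases k with
      | zero =>
        simp only [zero_mul, add_zero, Nat.sub_zero]
        rw [← hm, heq]
        exact h2
      | succ k =>
        by_cases hlt : σ.reg .K < len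
        · rw [(shift k hlt).1, (shift k hlt).2]
          exact k2 k
        · rw [hz k hlt]; simp
    · rw [e, e, heq]
      refine List.Perm.append h1 ?_
      rw [← heq']
      exact k3
    · rw [k4 i (by omega), h3 i (by omega)]
    · obtain ⟨r, hr⟩ : ∃ r, len = m + r := ⟨len - m, by omega⟩
      rw [show len - m = r by omega] at k5
      rw [hr]
      -- A block is nonempty, so the part of its sorting cost that does not depend on its length can
      -- be charged to its elements.
      have : κ ≤ κ * m := Nat.le_mul_of_pos_right _ (by omega)
      have e1 : κ * (20 * m + 10) = 20 * (κ * m) + 10 * κ := by ring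
      have e2 : (30 * κ + 10) * (m + r) = 30 * (κ * m) + 10 * m + (30 * κ + 10) * r := by ring
      omega

theorem wp_blockSort {E : Env} (hE : E.Valid) {κ : ℕ} {len : ℕ} {σ : HState} {Q : HState → Prop}
    (hlen : σ.reg .base + σ.reg .N - σ.reg .v = len)
    (hhi : σ.reg .base + σ.reg .N ≤ 4 * E.n) (hK : 0 < σ.reg .K) (hK' : σ.reg .K ≤ 2 ^ κ)
    (hKn : σ.reg .K ≤ 4 * (E.n + 1) ^ 2 + 64)
    (ha : ∀ i, σ.reg .v ≤ i → i < σ.reg .base + σ.reg .N → σ.arr .X i < E.n)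
    (hQ : ∀ τ : HState,
      (∀ k, (seg (τ.arr .X) (σ.reg .v + k * σ.reg .K) (min (σ.reg .K) (len - k * σ.reg .K))).Perm
        (seg (σ.arr .X) (σ.reg .v + k * σ.reg .K) (min (σ.reg .K) (len - k * σ.reg .K)))) →
      ChunkSorted E (τ.arr .X) (σ.reg .v) len (σ.reg .K) →
      (seg (τ.arr .X) (σ.reg .v) len).Perm (seg (σ.arr .X) (σ.reg .v) len) →
      (∀ i, i < σ.reg .v ∨ σ.reg .v + len ≤ i → τ.arr .X i = σ.arr .X i) →
      τ.time ≤ σ.time + (30 * κ + 10) * len + 1 →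
      (∀ x, x ≠ .p → x ≠ .pe → x ≠ .r → x ≠ .re → x ≠ .o → x ≠ .u → x ≠ .w → x ≠ .i0 →
        x ≠ .i1 → x ≠ .j → x ≠ .v → x ≠ .lo → x ≠ .hi → τ.reg x = σ.reg x) →
      (∀ b, b ≠ .X → b ≠ .Y → τ.arr b = σ.arr b) → Q τ) :
    wp E Cmd.blockSort Q σ := by
  refine (wp_blockSort_core hE len σ hlen hhi hK hK' hKn ha).frame fun τ h hF => ?_
  refine hQ τ h.1 h.2.1 h.2.2.1 h.2.2.2.1 h.2.2.2.2
    (fun x h₁ h₂ h₃ h₄ h₅ h₆ h₇ h₈ h₉ h₁₀ h₁₁ h₁₂ h₁₃ => hF.reg x ?_) fun b hb hb' => hF.arr b ?_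
  · simp [Cmd.blockSort, Cmd.msort, Cmd.msortLoop, Cmd.pass, Cmd.merge, Cmd.copy, Cmd.take,
      Cmd.modR, *]
  · simp [Cmd.blockSort, Cmd.msort, Cmd.msortLoop, Cmd.pass, Cmd.merge, Cmd.copy, Cmd.take,
      Cmd.modA, *]

/-- The entries of `X` are distinct, so no later store overwrites an earlier one. The function `f`
covers both uses: a constant flag, and the index of a sample. -/
theorem wp_mark_core {E : Env} (hE : E.Valid) {a : Arr} (ha : .X ≠ a) {e : Ex} {f : ℕ → ℕ}
    (he : ∀ σ, e.Safe E σ) (hf : ∀ σ, e.val E σ = f (σ.reg .v)) (len : ℕ) :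
    ∀ σ : HState, σ.reg .base + σ.reg .N - σ.reg .v = len →
      σ.reg .base + σ.reg .N ≤ 4 * E.n → 0 < σ.reg .q → σ.reg .q ≤ 4 * E.n + 64 →
      (∀ i, σ.reg .v ≤ i → i < σ.reg .base + σ.reg .N →
        ∀ j, σ.reg .v ≤ j → j < σ.reg .base + σ.reg .N → σ.arr .X i = σ.arr .X j → i = j) →
      wp E (Cmd.mark a e) (fun τ =>
        (∀ g, σ.reg .v + g * σ.reg .q < σ.reg .base + σ.reg .N →
          τ.arr a (σ.arr .X (σ.reg .v + g * σ.reg .q)) = f (σ.reg .v + g * σ.reg .q)) ∧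
        (∀ x, (∀ g, σ.reg .v + g * σ.reg .q < σ.reg .base + σ.reg .N →
          σ.arr .X (σ.reg .v + g * σ.reg .q) ≠ x) → τ.arr a x = σ.arr a x) ∧
        τ.time ≤ σ.time + 3 * len + 1) σ := by
  have hB := hE.large'
  induction len using Nat.strong_induction_on with
  | _ len ih =>
    intro σ hlen hhi hq hqn hinj
    rw [Cmd.mark, wp_wh, ← Cmd.mark]
    simp [Cmd.listEnd, he]
    refine ⟨by omega, fun h => ⟨by omega, ?_⟩, fun h => ?_⟩
    swap
    · intro g hg; omega
    refine (ih (len - σ.reg .q) (by omega) _ ?_ ?_ ?_ ?_ ?_).mono ?_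
    all_goals simp [ha]
    all_goals try omega
    · intro i h1 h2 j h3 h4; exact hinj i (by omega) h2 j (by omega) h4
    intro τ h1 h2 h3
    refine ⟨fun g hg => ?_, fun x hx => ?_, by omega⟩
    · cases g with
      | zero =>
        have := h2 (σ.arr .X (σ.reg .v)) fun g' hg' heq => by
          have := hinj _ (by omega) hg' _ le_rfl h heq
          omega
        simp [this, hf]
      | succ g =>
        have e : σ.reg .v + (g + 1) * σ.reg .q = σ.reg .v + σ.reg .q + g * σ.reg .q := by ring
        rw [e] at hg ⊢
        exact h1 g hg
    · have hne : x ≠ σ.arr .X (σ.reg .v) := by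
        have := hx 0 (by simpa using h)
        exact fun h => this (by simpa using h.symm)
      have := h2 x fun g hg => by
        have e : σ.reg .v + (g + 1) * σ.reg .q = σ.reg .v + σ.reg .q + g * σ.reg .q := by ring
        rw [← e] at hg ⊢
        exact hx _ hg
      rw [this, Function.update_of_ne hne]

theorem wp_mark {E : Env} (hE : E.Valid) {a : Arr} (ha : .X ≠ a) {e : Ex} {f : ℕ → ℕ}
    (he : ∀ σ, e.Safe E σ) (hf : ∀ σ, e.val E σ = f (σ.reg .v)) {len : ℕ} {σ : HState}
    {Q : HState → Prop} (hlen : σ.reg .base + σ.reg .N - σ.reg .v = len)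
    (hhi : σ.reg .base + σ.reg .N ≤ 4 * E.n) (hq : 0 < σ.reg .q) (hqn : σ.reg .q ≤ 4 * E.n + 64)
    (hinj : ∀ i, σ.reg .v ≤ i → i < σ.reg .base + σ.reg .N →
      ∀ j, σ.reg .v ≤ j → j < σ.reg .base + σ.reg .N → σ.arr .X i = σ.arr .X j → i = j)
    (hQ : ∀ τ : HState,
      (∀ g, σ.reg .v + g * σ.reg .q < σ.reg .base + σ.reg .N →
        τ.arr a (σ.arr .X (σ.reg .v + g * σ.reg .q)) = f (σ.reg .v + g * σ.reg .q)) →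
      (∀ x, (∀ g, σ.reg .v + g * σ.reg .q < σ.reg .base + σ.reg .N →
        σ.arr .X (σ.reg .v + g * σ.reg .q) ≠ x) → τ.arr a x = σ.arr a x) →
      τ.time ≤ σ.time + 3 * len + 1 → (∀ x, x ≠ .v → τ.reg x = σ.reg x) →
      (∀ b, b ≠ a → τ.arr b = σ.arr b) → Q τ) :
    wp E (Cmd.mark a e) Q σ := by
  refine (wp_mark_core hE ha he hf len σ hlen hhi hq hqn hinj).frame fun τ h hF => ?_
  refine hQ τ h.1 h.2.1 h.2.2 (fun x h₁ => hF.reg x ?_) fun b hb => hF.arr b ?_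
  · simp [Cmd.mark, Cmd.modR, *]
  · simp [Cmd.mark, Cmd.modA, *]

/-- Scanning `L` for flags, instead of writing down the flagged elements directly, produces a
sublist of `L`; so the list handed to a recursive call is again increasing in position, at linear
cost. -/
theorem wp_collect_core {E : Env} (hE : E.Valid) (len : ℕ) :
    ∀ σ : HState, σ.reg .base + σ.reg .N - σ.reg .v = len →
      σ.reg .base + σ.reg .N ≤ σ.reg .o → σ.reg .o + len ≤ 4 * E.n →
      (seg (σ.arr .L) (σ.reg .v) len).Nodup →
      wp E Cmd.collect (fun τ => ∃ l : List ℕ,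
        l = (seg (σ.arr .L) (σ.reg .v) len).filter (fun x => 0 < σ.arr .F x) ∧
        seg (τ.arr .L) (σ.reg .o) l.length = l ∧ τ.reg .o = σ.reg .o + l.length ∧
        (∀ i < σ.reg .o, τ.arr .L i = σ.arr .L i) ∧
        (∀ x, τ.arr .F x = if x ∈ seg (σ.arr .L) (σ.reg .v) len then 0 else σ.arr .F x) ∧
        τ.time ≤ σ.time + 7 * len + 1) σ := by
  have hB := hE.large'
  induction len with
  | zero =>
    intro σ hlen ho hon hnd
    rw [Cmd.collect, wp_wh]
    simp [Cmd.listEnd]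
    refine ⟨by omega, fun h => by omega⟩
  | succ len ih =>
    intro σ hlen ho hon hnd
    rw [seg_succ, List.nodup_cons] at hnd
    rw [Cmd.collect, wp_wh, ← Cmd.collect]
    simp [Cmd.listEnd]
    refine ⟨by omega, fun h => ⟨by omega, fun hf => ⟨by omega, by omega, by omega, ?_⟩,
      fun hf => ⟨by omega, ?_⟩⟩, fun h => by omega⟩
    · have hLeq : seg (Function.update (σ.arr .L) (σ.reg .o) (σ.arr .L (σ.reg .v)))
          (σ.reg .v + 1) len = seg (σ.arr .L) (σ.reg .v + 1) len :=
        seg_congr fun i hi hi' => Function.update_of_ne (by omega) _ _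
      refine (ih _ ?_ ?_ ?_ ?_).mono ?_
      all_goals simp
      all_goals try omega
      · rw [hLeq]; exact hnd.2
      rw [hLeq]
      intro τ h1 h2 h3 h4 h5
      -- Removing the flag of the head does not affect the tail, as the list has no duplicates.
      have hfilter : List.filter (fun x => decide (0 < Function.update (σ.arr .F)
          (σ.arr .L (σ.reg .v)) 0 x)) (seg (σ.arr .L) (σ.reg .v + 1) len) =
          List.filter (fun x => decide (0 < σ.arr .F x)) (seg (σ.arr .L) (σ.reg .v + 1) len) := by
        refine List.filter_congr fun x hx => ?_
        rw [Function.update_of_ne]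
        rintro rfl
        exact hnd.1 hx
      rw [hfilter] at h1 h2
      have hhead : List.filter (fun x => decide (0 < σ.arr .F x)) (seg (σ.arr .L) (σ.reg .v)
          (len + 1)) = σ.arr .L (σ.reg .v) ::
          List.filter (fun x => decide (0 < σ.arr .F x)) (seg (σ.arr .L) (σ.reg .v + 1) len) := by
        rw [seg_succ, List.filter_cons_of_pos (by simpa using hf)]
      rw [hhead]
      refine ⟨?_, by simp; omega, fun i hi => ?_, fun x => ?_, by omega⟩
      · rw [List.length_cons, seg_succ, h1, h3 _ (by omega)]
        simp
      · rw [h3 i (by omega), Function.update_of_ne (by omega)]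
      · simp only [h4, seg_succ, List.mem_cons]
        by_cases hx : x = σ.arr .L (σ.reg .v)
        · simp [hx]
        · simp [hx]
    · refine (ih _ ?_ ?_ ?_ ?_).mono ?_
      all_goals simp
      all_goals try omega
      · exact hnd.2
      intro τ h1 h2 h3 h4 h5
      have hhead : List.filter (fun x => decide (0 < σ.arr .F x)) (seg (σ.arr .L) (σ.reg .v)
          (len + 1)) =
          List.filter (fun x => decide (0 < σ.arr .F x)) (seg (σ.arr .L) (σ.reg .v + 1) len) := by
        rw [seg_succ, List.filter_cons_of_neg (by simpa using hf)]
      rw [hhead]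
      refine ⟨h1, h2, h3, fun x => ?_, by omega⟩
      simp only [h4, seg_succ, List.mem_cons]
      by_cases hx : x = σ.arr .L (σ.reg .v)
      · simp [hx, hf]
      · simp [hx]

theorem wp_collect {E : Env} (hE : E.Valid) {len : ℕ} {σ : HState} {Q : HState → Prop}
    (hlen : σ.reg .base + σ.reg .N - σ.reg .v = len)
    (ho : σ.reg .base + σ.reg .N ≤ σ.reg .o) (hon : σ.reg .o + len ≤ 4 * E.n)
    (hnd : (seg (σ.arr .L) (σ.reg .v) len).Nodup)
    (hQ : ∀ (τ : HState) (l : List ℕ), l.Sublist (seg (σ.arr .L) (σ.reg .v) len) →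
      (∀ x, x ∈ l ↔ x ∈ seg (σ.arr .L) (σ.reg .v) len ∧ 0 < σ.arr .F x) →
      seg (τ.arr .L) (σ.reg .o) l.length = l → τ.reg .o = σ.reg .o + l.length →
      (∀ i < σ.reg .o, τ.arr .L i = σ.arr .L i) →
      (∀ x, τ.arr .F x = if x ∈ seg (σ.arr .L) (σ.reg .v) len then 0 else σ.arr .F x) →
      τ.time ≤ σ.time + 7 * len + 1 →
      (∀ x, x ≠ .v → x ≠ .x → x ≠ .o → τ.reg x = σ.reg x) →
      (∀ b, b ≠ .F → b ≠ .L → τ.arr b = σ.arr b) → Q τ) :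
    wp E Cmd.collect Q σ := by
  refine (wp_collect_core hE len σ hlen ho hon hnd).frame fun τ ⟨l, h⟩ hF => ?_
  refine hQ τ l (h.1 ▸ List.filter_sublist) (by simp [h.1]) h.2.1 h.2.2.1 h.2.2.2.1 h.2.2.2.2.1
    h.2.2.2.2.2 (fun x h₁ h₂ h₃ => hF.reg x ?_) fun b hb hb' => hF.arr b ?_
  · simp [Cmd.collect, Cmd.modR, *]
  · simp [Cmd.collect, Cmd.modA, *]

theorem wp_rank_core {E : Env} (hE : E.Valid) (len : ℕ) :
    ∀ σ : HState, σ.reg .M - σ.reg .v = len →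
      σ.reg .base + σ.reg .N + σ.reg .M ≤ 4 * E.n →
      (∀ i, σ.reg .v ≤ i → i < σ.reg .M → ∀ j, σ.reg .v ≤ j → j < σ.reg .M →
        σ.arr .X (σ.reg .base + σ.reg .N + i) = σ.arr .X (σ.reg .base + σ.reg .N + j) → i = j) →
      wp E Cmd.rank (fun τ =>
        (∀ i, σ.reg .v ≤ i → i < σ.reg .M →
          τ.arr .S (σ.arr .X (σ.reg .base + σ.reg .N + i)) = i / σ.reg .q) ∧
        (∀ x, (∀ i, σ.reg .v ≤ i → i < σ.reg .M →
          σ.arr .X (σ.reg .base + σ.reg .N + i) ≠ x) → τ.arr .S x = σ.arr .S x) ∧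
        τ.time ≤ σ.time + 3 * len + 1) σ := by
  have hB := hE.large'
  induction len with
  | zero =>
    intro σ hlen hhi hinj
    rw [Cmd.rank, wp_wh]
    simp [Cmd.listEnd]
    exact ⟨fun h => by omega, fun h => fun i h1 h2 => by omega⟩
  | succ len ih =>
    intro σ hlen hhi hinj
    rw [Cmd.rank, wp_wh, ← Cmd.rank]
    simp [Cmd.listEnd]
    refine ⟨fun h => ⟨by omega, by omega, ?_⟩, fun h => by omega⟩
    refine (ih _ ?_ ?_ ?_).mono ?_
    all_goals simp
    all_goals try omega
    · intro i h1 h2 j h3 h4; exact hinj i (by omega) h2 j (by omega) h4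
    intro τ h1 h2 h3
    refine ⟨fun i hi hi' => ?_, fun x hx => ?_, by omega⟩
    · rcases hi.eq_or_lt with rfl | hlt
      · rw [h2 _ fun j hj hj' heq => ?_]
        · simp
        · have := hinj j (by omega) hj' _ le_rfl h heq
          omega
      · exact h1 i hlt hi'
    · rw [h2 x fun i hi hi' => hx i (by omega) hi', Function.update_of_ne]
      exact fun h' => hx _ le_rfl h h'.symm

theorem wp_rank {E : Env} (hE : E.Valid) {len : ℕ} {σ : HState} {Q : HState → Prop}
    (hlen : σ.reg .M - σ.reg .v = len) (hhi : σ.reg .base + σ.reg .N + σ.reg .M ≤ 4 * E.n)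
    (hinj : ∀ i, σ.reg .v ≤ i → i < σ.reg .M → ∀ j, σ.reg .v ≤ j → j < σ.reg .M →
      σ.arr .X (σ.reg .base + σ.reg .N + i) = σ.arr .X (σ.reg .base + σ.reg .N + j) → i = j)
    (hQ : ∀ τ : HState, (∀ i, σ.reg .v ≤ i → i < σ.reg .M →
        τ.arr .S (σ.arr .X (σ.reg .base + σ.reg .N + i)) = i / σ.reg .q) →
      τ.time ≤ σ.time + 3 * len + 1 → (∀ x, x ≠ .v → τ.reg x = σ.reg x) →
      (∀ b, b ≠ .S → τ.arr b = σ.arr b) → Q τ) :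
    wp E Cmd.rank Q σ := by
  refine (wp_rank_core hE len σ hlen hhi hinj).frame fun τ h hF => ?_
  refine hQ τ h.1 h.2.2 (fun x h₁ => hF.reg x ?_) fun b hb => hF.arr b ?_
  · simp [Cmd.rank, Cmd.modR, *]
  · simp [Cmd.rank, Cmd.modA, *]

/-! ### Distribution of the groups -/

/-- The concatenation of `g v, …, g (v + k - 1)`. -/
def cat (g : ℕ → List ℕ) : ℕ → ℕ → List ℕ
  | _, 0 => []
  | v, k + 1 => g v ++ cat g (v + 1) k

@[simp] theorem cat_zero (g : ℕ → List ℕ) (v : ℕ) : cat g v 0 = [] := rfl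

theorem cat_succ (g : ℕ → List ℕ) (v k : ℕ) : cat g v (k + 1) = g v ++ cat g (v + 1) k := rfl

theorem cat_add (g : ℕ → List ℕ) (v k l : ℕ) : cat g v (k + l) = cat g v k ++ cat g (v + k) l := by
  induction k generalizing v with
  | zero => simp
  | succ k ih =>
    rw [show k + 1 + l = k + l + 1 by ring, cat_succ, cat_succ, ih, List.append_assoc,
      show v + 1 + k = v + (k + 1) by ring]

theorem mem_cat {g : ℕ → List ℕ} {v k x : ℕ} :
    x ∈ cat g v k ↔ ∃ i, v ≤ i ∧ i < v + k ∧ x ∈ g i := by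
  induction k generalizing v with
  | zero => simp; omega
  | succ k ih =>
    rw [cat_succ, List.mem_append, ih]
    constructor
    · rintro (h | ⟨i, h₁, h₂, h₃⟩)
      · exact ⟨v, le_rfl, by omega, h⟩
      · exact ⟨i, by omega, by omega, h₃⟩
    · rintro ⟨i, h₁, h₂, h₃⟩
      rcases h₁.eq_or_lt with rfl | h
      · exact .inl h₃
      · exact .inr ⟨i, by omega, by omega, h₃⟩

/-- The data that determine the groups: the sorted blocks of the current list and, after it, the
sorted samples (`X`), the indices of the samples (`I`) and the numbers of their strips (`S`). -/
structure GroupData where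
  X : ℕ → ℕ
  I : ℕ → ℕ
  S : ℕ → ℕ
  base : ℕ
  N : ℕ
  q : ℕ
  K : ℕ

namespace GroupData

variable (G : GroupData)

/-- The sample of rank `i`. -/
def sample (i : ℕ) : ℕ := G.X (G.base + G.N + i)

/-- The group of a sample. -/
def group (x : ℕ) : List ℕ := seg G.X (G.I x) (min G.q (G.base + G.N - G.I x))

/-- A group is good if the next group is in the same block and its sample is in the same strip. -/
abbrev Good (x : ℕ) : Prop :=
  G.I x + G.q < G.base + G.N ∧
  (G.I x + G.q - G.base) / G.K < (G.I x - G.base) / G.K + 1 ∧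
  G.S (G.X (G.I x + G.q)) < G.S x + 1

/-- The group of the sample of rank `i`, if it is good. -/
def good (i : ℕ) : List ℕ := if G.Good (G.sample i) then G.group (G.sample i) else []

/-- The group of the sample of rank `i`, if it is bad. -/
def bad (i : ℕ) : List ℕ := if G.Good (G.sample i) then [] else G.group (G.sample i)

theorem length_group_le (x : ℕ) : (G.group x).length ≤ G.q := by
  simp [group]

theorem length_good_le (i : ℕ) : (G.good i).length ≤ G.q := by
  unfold good
  split_ifs
  · exact G.length_group_le _
  · simp

/-- The data are in the memory. -/
structure Fits (σ : HState) : Prop where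
  X : σ.arr .X = G.X
  I : σ.arr .I = G.I
  S : σ.arr .S = G.S
  base : σ.reg .base = G.base
  N : σ.reg .N = G.N
  q : σ.reg .q = G.q
  K : σ.reg .K = G.K

/-- All numbers are small enough. -/
structure Bounded (n M : ℕ) : Prop where
  e_le : G.base + G.N + M ≤ 4 * n
  q_le : G.q ≤ 4 * n + 64
  I_lt : ∀ i < M, G.I (G.sample i) < G.base + G.N
  S_le : ∀ i < M, G.S (G.sample i) ≤ 4 * n
  X_lt : ∀ i < G.base + G.N, G.base ≤ i → G.X i < n
  base_le : ∀ i < M, G.base ≤ G.I (G.sample i)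
  q_pos : 0 < G.q

variable {G}

theorem Fits.of_eq {σ τ : HState} (h : G.Fits σ) (hX : τ.arr .X = σ.arr .X)
    (hI : τ.arr .I = σ.arr .I) (hS : τ.arr .S = σ.arr .S) (hb : τ.reg .base = σ.reg .base)
    (hN : τ.reg .N = σ.reg .N) (hq : τ.reg .q = σ.reg .q) (hK : τ.reg .K = σ.reg .K) :
    G.Fits τ :=
  ⟨hX.trans h.X, hI.trans h.I, hS.trans h.S, hb.trans h.base, hN.trans h.N, hq.trans h.q,
    hK.trans h.K⟩

end GroupData

namespace Cmd

/-- Flag the elements with indices `i0, …, i1 - 1`. -/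
def flag : Cmd :=
  .wh (.r .i0) (.r .i1) (.seq (.st .F (.ld .X (.r .i0)) (.c 1))
    (.set .i0 (.add (.r .i0) (.c 1))))

/-- Find out whether the group of the sample `x` with index `i0` is good. -/
def goodTest : Cmd :=
  .seq (.set .ok (.c 0))
    (.ite (.add (.r .i0) (.r .q)) listEnd
      (.ite (.div (.sub (.add (.r .i0) (.r .q)) (.r .base)) (.r .K))
          (.add (.div (.sub (.r .i0) (.r .base)) (.r .K)) (.c 1))
        (.ite (.ld .S (.ld .X (.add (.r .i0) (.r .q)))) (.add (.ld .S (.r .x)) (.c 1))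
          (.set .ok (.c 1))
          .skip)
        .skip)
      .skip)

/-- Append the group of the sample of rank `v` to `Z` if it is good, otherwise flag it. -/
def addGroup : Cmd :=
  .seq (.set .x (.ld .X (.add listEnd (.r .v))))
  (.seq (.set .i0 (.ld .I (.r .x)))
  (.seq (.set .i1 (.min (.add (.r .i0) (.r .q)) listEnd))
  (.seq goodTest
  (.seq (.ite (.c 0) (.r .ok)
    (.seq (.set .j (.r .z)) (.seq (copy .X .Z) (.set .z (.r .j))))
    (.seq (.set .nb (.add (.r .nb) (.sub (.r .i1) (.r .i0)))) flag))
  (.set .v (.add (.r .v) (.c 1)))))))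

/-- Handle the groups of the samples of ranks `v, …, ve - 1`. -/
def addGroups : Cmd := .wh (.r .v) (.r .ve) addGroup

/-- Handle all groups, and sort the good ones strip by strip. -/
def strips : Cmd :=
  .wh (.r .v) (.r .M)
    (.seq (.set .ve (.min (.add (.r .v) (.r .q)) (.r .M)))
    (.seq (.set .lo (.r .z))
    (.seq addGroups
    (.seq (.set .hi (.r .z))
    (msort .Z .Y)))))

end Cmd

theorem wp_flag_core {E : Env} (hE : E.Valid) (m : ℕ) :
    ∀ σ : HState, σ.reg .i1 - σ.reg .i0 = m → σ.reg .i1 ≤ 4 * E.n →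
      wp E Cmd.flag (fun τ =>
        (∀ x, τ.arr .F x = if x ∈ seg (σ.arr .X) (σ.reg .i0) m then 1 else σ.arr .F x) ∧
        τ.time = σ.time + 3 * m + 1) σ := by
  have hB := hE.large'
  induction m with
  | zero =>
    intro σ hm hi
    rw [Cmd.flag, wp_wh]
    simp
    omega
  | succ m ih =>
    intro σ hm hi
    rw [Cmd.flag, wp_wh, ← Cmd.flag]
    simp
    refine ⟨fun h => ⟨by omega, by omega, (ih _ ?_ ?_).mono ?_⟩, by omega⟩
    all_goals simp
    all_goals try omega
    intro τ h1 h2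
    refine ⟨fun x => ?_, by omega⟩
    simp only [h1, seg_succ, List.mem_cons]
    by_cases hx : x = σ.arr .X (σ.reg .i0)
    · simp [hx]
    · simp [hx]

theorem wp_flag {E : Env} (hE : E.Valid) {m : ℕ} {σ : HState} {Q : HState → Prop}
    (hm : σ.reg .i1 - σ.reg .i0 = m) (hi : σ.reg .i1 ≤ 4 * E.n)
    (hQ : ∀ τ : HState,
      (∀ x, τ.arr .F x = if x ∈ seg (σ.arr .X) (σ.reg .i0) m then 1 else σ.arr .F x) →
      τ.time = σ.time + 3 * m + 1 → (∀ x, x ≠ .i0 → τ.reg x = σ.reg x) →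
      (∀ b, b ≠ .F → τ.arr b = σ.arr b) → Q τ) :
    wp E Cmd.flag Q σ := by
  refine (wp_flag_core hE m σ hm hi).frame fun τ h hF => ?_
  refine hQ τ h.1 h.2 (fun x h₁ => hF.reg x ?_) fun b hb => hF.arr b ?_
  · simp [Cmd.flag, Cmd.modR, *]
  · simp [Cmd.flag, Cmd.modA, *]

theorem wp_goodTest {E : Env} (hE : E.Valid) {G : GroupData} {σ : HState} {Q : HState → Prop}
    (hG : G.Fits σ) (hi : σ.reg .i0 = G.I (σ.reg .x)) (he : G.base + G.N ≤ 4 * E.n)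
    (hq : G.q ≤ 4 * E.n + 64) (hI : G.I (σ.reg .x) < G.base + G.N)
    (hS : G.S (σ.reg .x) ≤ 4 * E.n)
    (hQ : ∀ τ : HState, (0 < τ.reg .ok ↔ G.Good (σ.reg .x)) → τ.time ≤ σ.time + 5 →
      (∀ x, x ≠ .ok → τ.reg x = σ.reg x) → (∀ b, τ.arr b = σ.arr b) → Q τ) :
    wp E Cmd.goodTest Q σ := by
  have hB := hE.large'
  have hdiv : (G.I (σ.reg .x) - G.base) / G.K ≤ G.I (σ.reg .x) :=
    (Nat.div_le_self _ _).trans (Nat.sub_le _ _)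
  unfold Cmd.goodTest
  simp [Cmd.listEnd, hG.X, hG.S, hG.base, hG.N, hG.q, hG.K, hi]
  refine ⟨by omega, by omega, by omega, fun h1 => ⟨by omega, by omega, fun h2 => ⟨by omega,
    by omega, fun h3 => ⟨by omega, ?_⟩, fun h3 => ?_⟩, fun h2 => ?_⟩, fun h1 => ?_⟩
  · refine hQ _ (by simp [GroupData.Good]; omega) (by simp) (fun x hx => by simp [hx])
      fun b => by simp
  · refine hQ _ (by simp [GroupData.Good]; omega) (by simp) (fun x hx => by simp [hx])
      fun b => by simp
  · refine hQ _ (by simp [GroupData.Good]; omega) (by simp) (fun x hx => by simp [hx])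
      fun b => by simp
  · refine hQ _ (by simp [GroupData.Good]; omega) (by simp) (fun x hx => by simp [hx])
      fun b => by simp

theorem wp_addGroup {E : Env} (hE : E.Valid) {G : GroupData} {M : ℕ} (hGb : G.Bounded E.n M)
    {σ : HState} {Q : HState → Prop} (hG : G.Fits σ) (hv : σ.reg .v < M)
    (hz : σ.reg .z + (G.good (σ.reg .v)).length ≤ 4 * E.n)
    (hnb : σ.reg .nb + (G.bad (σ.reg .v)).length ≤ 4 * E.n)
    (hQ : ∀ τ : HState,
      seg (τ.arr .Z) (σ.reg .z) (G.good (σ.reg .v)).length = G.good (σ.reg .v) →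
      (∀ i, i < σ.reg .z → τ.arr .Z i = σ.arr .Z i) →
      τ.reg .z = σ.reg .z + (G.good (σ.reg .v)).length →
      τ.reg .nb = σ.reg .nb + (G.bad (σ.reg .v)).length →
      (∀ x, τ.arr .F x = if x ∈ G.bad (σ.reg .v) then 1 else σ.arr .F x) →
      τ.reg .v = σ.reg .v + 1 →
      τ.time ≤ σ.time + 18 * ((G.good (σ.reg .v)).length + (G.bad (σ.reg .v)).length) →
      (∀ x, x ≠ .x → x ≠ .i0 → x ≠ .i1 → x ≠ .ok → x ≠ .j → x ≠ .z → x ≠ .nb → x ≠ .v →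
        τ.reg x = σ.reg x) →
      (∀ b, b ≠ .Z → b ≠ .F → τ.arr b = σ.arr b) → Q τ) :
    wp E Cmd.addGroup Q σ := by
  have hB := hE.large'
  have he := hGb.e_le
  have hqb := hGb.q_le
  have hI := hGb.I_lt _ hv
  have hS := hGb.S_le _ hv
  have hqp := hGb.q_pos
  have hsample : G.X (G.base + G.N + σ.reg .v) = G.sample (σ.reg .v) := rfl
  unfold Cmd.addGroup
  simp [Cmd.listEnd, Ex.min, hG.X, hG.I, hG.base, hG.N, hG.q, hsample]
  refine ⟨by omega, by omega, ?_⟩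
  refine wp_goodTest hE (G := G) ?_ ?_ ?_ ?_ ?_ ?_ ?_
  · exact hG.of_eq (by simp) (by simp) (by simp) (by simp) (by simp) (by simp) (by simp)
  all_goals try simp
  all_goals try omega
  intro τ h1 h2 h3 h4
  simp [h3]
  have hlen : G.I (G.sample (σ.reg .v)) + G.q -
      (G.I (G.sample (σ.reg .v)) + G.q - (G.base + G.N)) - G.I (G.sample (σ.reg .v)) =
      min G.q (G.base + G.N - G.I (G.sample (σ.reg .v))) := by omega
  have hposlen : 0 < min G.q (G.base + G.N - G.I (G.sample (σ.reg .v))) := by omega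
  refine ⟨by omega, fun hok => ?_, fun hok => ?_⟩
  · have hgood := h1.1 hok
    have hg : G.good (σ.reg .v) = G.group (G.sample (σ.reg .v)) := if_pos hgood
    have hb : G.bad (σ.reg .v) = [] := if_pos hgood
    simp [hg, hb, GroupData.group] at hQ hz hnb ⊢
    refine wp_copy hE (by simp) (m := min G.q (G.base + G.N - G.I (G.sample (σ.reg .v))))
      ?_ ?_ ?_ ?_
    all_goals try simp [h3, h4]
    all_goals try omega
    intro τ' k1 k2 k3 k4 k5 k6
    simp [k5, k4]
    have hvv : τ.reg .v = σ.reg .v := by simp [h3]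
    refine ⟨by omega, hQ _ ?_ ?_ ?_ ?_ ?_ ?_ ?_ ?_ ?_⟩
    all_goals try simp [k5, k6, h3, k3]
    · simpa [h3, h4, hG.X] using k1
    · intro i hi; rw [k2 i (by omega)]
    · omega
    · intro x g1 g2 g3 g4 g5 g6 g7 g8; simp [*]
    · intro b g1 g2; simp [k6 b g1]
  · have hgood : ¬ G.Good (G.sample (σ.reg .v)) := by
      rw [← h1]; omega
    have hg : G.good (σ.reg .v) = [] := if_neg hgood
    have hb : G.bad (σ.reg .v) = G.group (G.sample (σ.reg .v)) := if_neg hgood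
    simp [hg, hb, GroupData.group] at hQ hz hnb ⊢
    refine ⟨by omega, wp_flag hE (m := min G.q (G.base + G.N - G.I (G.sample (σ.reg .v))))
      ?_ ?_ ?_⟩
    all_goals try simp [h3, h4]
    all_goals try omega
    intro τ' k1 k2 k3 k4
    simp [k3, h3]
    refine ⟨by omega, hQ _ ?_ ?_ ?_ ?_ ?_ ?_ ?_ ?_⟩
    all_goals try simp [k1, k3, k4, h3, hlen, hG.X, k2]
    · omega
    · intro x g1 g2 g3 g4 g5 g6 g7 g8; simp [*]
    · intro b g1 g2; simp [k4 b g2]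

/-- A group contains at least its sample, so constant overhead per group can be charged to elements.
-/
theorem GroupData.Bounded.length_pos {G : GroupData} {n M : ℕ} (h : G.Bounded n M) {i : ℕ}
    (hi : i < M) : 0 < (G.good i).length + (G.bad i).length := by
  have := h.I_lt i hi
  have := h.q_pos
  unfold GroupData.good GroupData.bad
  split_ifs <;> simp [GroupData.group] <;> omega

theorem wp_addGroups_core {E : Env} (hE : E.Valid) {G : GroupData} {M : ℕ}
    (hGb : G.Bounded E.n M) (len : ℕ) :
    ∀ σ : HState, G.Fits σ → σ.reg .ve - σ.reg .v = len → σ.reg .ve ≤ M →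
      σ.reg .z + (cat G.good (σ.reg .v) len).length ≤ 4 * E.n →
      σ.reg .nb + (cat G.bad (σ.reg .v) len).length ≤ 4 * E.n →
      wp E Cmd.addGroups (fun τ =>
        seg (τ.arr .Z) (σ.reg .z) (cat G.good (σ.reg .v) len).length =
          cat G.good (σ.reg .v) len ∧
        (∀ i, i < σ.reg .z → τ.arr .Z i = σ.arr .Z i) ∧
        τ.reg .z = σ.reg .z + (cat G.good (σ.reg .v) len).length ∧
        τ.reg .nb = σ.reg .nb + (cat G.bad (σ.reg .v) len).length ∧
        (∀ x, τ.arr .F x = if x ∈ cat G.bad (σ.reg .v) len then 1 else σ.arr .F x) ∧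
        τ.reg .v = σ.reg .v + len ∧
        τ.time ≤ σ.time + 19 * ((cat G.good (σ.reg .v) len).length +
          (cat G.bad (σ.reg .v) len).length) + 1) σ := by
  induction len with
  | zero =>
    intro σ hG hlen hve hz hnb
    rw [Cmd.addGroups, wp_wh]
    simp
    omega
  | succ len ih =>
    intro σ hG hlen hve hz hnb
    rw [cat_succ, List.length_append] at hz hnb
    rw [Cmd.addGroups, wp_wh, ← Cmd.addGroups]
    simp
    refine ⟨fun h => ?_, by omega⟩
    have hpos := hGb.length_pos (i := σ.reg .v) (by omega)
    refine wp_addGroup hE hGb (hG.of_eq rfl rfl rfl rfl rfl rfl rfl) ?_ ?_ ?_ ?_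
    all_goals try simp
    all_goals try omega
    intro τ h1 h2 h3 h4 h5 h6 h7 h8 h9
    refine (ih τ ?_ ?_ ?_ ?_ ?_).mono ?_
    · exact hG.of_eq (h9 _ (by simp) (by simp)) (h9 _ (by simp) (by simp))
        (h9 _ (by simp) (by simp)) (by simp [h8]) (by simp [h8]) (by simp [h8]) (by simp [h8])
    · simp [h8, h6]; omega
    · simp [h8]; omega
    · rw [h3, h6]; omega
    · rw [h4, h6]; omega
    rintro τ' ⟨k1, k2, k3, k4, k5, k6, k7⟩
    rw [h6, h3] at *
    rw [h4] at *
    simp only [cat_succ, List.length_append]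
    refine ⟨?_, fun i hi => ?_, by omega, by omega, fun x => ?_, by omega, by omega⟩
    · rw [seg_add, k1, ← h1]
      congr 1
      simp only [length_seg]
      exact seg_congr fun i hi hi' => k2 i (by omega)
    · rw [k2 i (by omega), h2 i hi]
    · simp only [k5, h5, List.mem_append]
      by_cases hx : x ∈ cat G.bad (σ.reg .v + 1) len <;>
        by_cases hx' : x ∈ G.bad (σ.reg .v) <;> simp [hx, hx']

theorem wp_addGroups {E : Env} (hE : E.Valid) {G : GroupData} {M : ℕ}
    (hGb : G.Bounded E.n M) {len : ℕ} {σ : HState} {Q : HState → Prop} (hG : G.Fits σ)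
    (hlen : σ.reg .ve - σ.reg .v = len) (hve : σ.reg .ve ≤ M)
    (hz : σ.reg .z + (cat G.good (σ.reg .v) len).length ≤ 4 * E.n)
    (hnb : σ.reg .nb + (cat G.bad (σ.reg .v) len).length ≤ 4 * E.n)
    (hQ : ∀ τ : HState, seg (τ.arr .Z) (σ.reg .z) (cat G.good (σ.reg .v) len).length =
          cat G.good (σ.reg .v) len →
        (∀ i, i < σ.reg .z → τ.arr .Z i = σ.arr .Z i) →
        τ.reg .z = σ.reg .z + (cat G.good (σ.reg .v) len).length →
        τ.reg .nb = σ.reg .nb + (cat G.bad (σ.reg .v) len).length →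
        (∀ x, τ.arr .F x = if x ∈ cat G.bad (σ.reg .v) len then 1 else σ.arr .F x) →
        τ.reg .v = σ.reg .v + len →
        τ.time ≤ σ.time + 19 * ((cat G.good (σ.reg .v) len).length +
          (cat G.bad (σ.reg .v) len).length) + 1 →
      (∀ x, x ≠ .x → x ≠ .i0 → x ≠ .i1 → x ≠ .ok → x ≠ .j → x ≠ .z → x ≠ .nb → x ≠ .v →
        τ.reg x = σ.reg x) →
      (∀ b, b ≠ .Z → b ≠ .F → τ.arr b = σ.arr b) → Q τ) :
    wp E Cmd.addGroups Q σ := by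
  refine (wp_addGroups_core hE hGb len σ hG hlen hve hz hnb).frame fun τ h hF => ?_
  refine hQ τ h.1 h.2.1 h.2.2.1 h.2.2.2.1 h.2.2.2.2.1 h.2.2.2.2.2.1 h.2.2.2.2.2.2
    (fun x g1 g2 g3 g4 g5 g6 g7 g8 => hF.reg x ?_) fun b g1 g2 => hF.arr b ?_
  · simp [Cmd.addGroups, Cmd.addGroup, Cmd.goodTest, Cmd.copy, Cmd.flag, Cmd.modR, *]
  · simp [Cmd.addGroups, Cmd.addGroup, Cmd.goodTest, Cmd.copy, Cmd.flag, Cmd.modA, *]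

/-- For `k ≤ q` this bounds the good part of a strip by `q * q`, so `κ` doublings suffice to
merge-sort it. -/
theorem GroupData.length_cat_good_le (G : GroupData) (v k : ℕ) :
    (cat G.good v k).length ≤ k * G.q := by
  induction k generalizing v with
  | zero => simp
  | succ k ih =>
    rw [cat_succ, List.length_append, add_mul]
    have := G.length_good_le v
    have := ih (v + 1)
    omega

theorem GroupData.Bounded.le_length_cat {G : GroupData} {n M : ℕ} (h : G.Bounded n M) {v k : ℕ}
    (hk : v + k ≤ M) : k ≤ (cat G.good v k).length + (cat G.bad v k).length := by
  induction k generalizing v with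
  | zero => simp
  | succ k ih =>
    rw [cat_succ, cat_succ, List.length_append, List.length_append]
    have := h.length_pos (i := v) (by omega)
    have := ih (v := v + 1) (by omega)
    omega

/-- A round starts at a multiple of `q` or at the end, hence covers exactly one strip. The strips
are sorted separately, and `hsep` makes their concatenation sorted. -/
theorem wp_strips_core {E : Env} (hE : E.Valid) {G : GroupData} {M κ : ℕ}
    (hGb : G.Bounded E.n M) (hκ : G.q * G.q ≤ 2 ^ κ)
    (hsep : ∀ i j, i / G.q < j / G.q → j < M → ∀ a ∈ G.good i, ∀ b ∈ G.good j, E.r a b)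
    (hlt : ∀ i < M, ∀ a ∈ G.good i, a < E.n) (len : ℕ) :
    ∀ σ : HState, G.Fits σ → σ.reg .M = M → M - σ.reg .v = len →
      (∃ t, σ.reg .v = t * G.q ∨ σ.reg .v = M) →
      σ.reg .z + (cat G.good (σ.reg .v) len).length ≤ 4 * E.n →
      σ.reg .nb + (cat G.bad (σ.reg .v) len).length ≤ 4 * E.n →
      wp E Cmd.strips (fun τ =>
        (seg (τ.arr .Z) (σ.reg .z) (cat G.good (σ.reg .v) len).length).Perm
          (cat G.good (σ.reg .v) len) ∧
        (seg (τ.arr .Z) (σ.reg .z) (cat G.good (σ.reg .v) len).length).Pairwise E.r ∧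
        (∀ i, i < σ.reg .z → τ.arr .Z i = σ.arr .Z i) ∧
        τ.reg .z = σ.reg .z + (cat G.good (σ.reg .v) len).length ∧
        τ.reg .nb = σ.reg .nb + (cat G.bad (σ.reg .v) len).length ∧
        (∀ x, τ.arr .F x = if x ∈ cat G.bad (σ.reg .v) len then 1 else σ.arr .F x) ∧
        τ.time ≤ σ.time + (30 * κ + 30) * ((cat G.good (σ.reg .v) len).length +
          (cat G.bad (σ.reg .v) len).length) + 1) σ := by
  have hB := hE.large'
  have hqb := hGb.q_le
  have hqp := hGb.q_pos
  have heb := hGb.e_le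
  induction len using Nat.strong_induction_on with
  | _ len ih =>
    intro σ hG hM hlen hmul hz hnb
    rw [Cmd.strips, wp_wh, ← Cmd.strips]
    simp [hM, hG.q, Ex.min]
    refine ⟨fun h => ⟨by omega, ?_⟩, fun h => ?_⟩
    swap
    · obtain rfl : len = 0 := by omega
      simp
    obtain ⟨t, ht⟩ := hmul
    replace ht : σ.reg .v = t * G.q := by omega
    set m := min G.q len with hm
    obtain ⟨l', hl'⟩ : ∃ l', len = m + l' := ⟨len - m, by omega⟩
    have hve : σ.reg .v + G.q - (σ.reg .v + G.q - M) = σ.reg .v + m := by omega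
    rw [hl', cat_add, List.length_append] at hz hnb
    rw [hl', cat_add, cat_add]
    simp only [List.length_append]
    have hgl : (cat G.good (σ.reg .v) m).length ≤ 2 ^ κ :=
      (G.length_cat_good_le _ _).trans ((Nat.mul_le_mul_right _ (by omega)).trans hκ)
    have hpos := hGb.le_length_cat (v := σ.reg .v) (k := m) (by omega)
    refine wp_addGroups hE hGb (len := m) (hG.of_eq rfl rfl rfl rfl rfl rfl rfl) ?_ ?_ ?_ ?_ ?_
    all_goals try simp
    all_goals try omega
    intro τ h1 h2 h3 h4 h5 h6 h7 h8 h9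
    refine wp_msort hE (by simp) (len := (cat G.good (σ.reg .v) m).length) (j := κ)
      ?_ ?_ ?_ hgl ?_ ?_
    all_goals try simp [h8, h3]
    all_goals try omega
    · intro i hi hi'
      have hmem : τ.arr .Z i ∈ seg (τ.arr .Z) (σ.reg .z) (cat G.good (σ.reg .v) m).length :=
        mem_seg.2 ⟨i, hi, hi', rfl⟩
      rw [h1] at hmem
      obtain ⟨i', g1, g2, g3⟩ := mem_cat.1 hmem
      exact hlt i' (by omega) _ g3
    intro τ' k1 k2 k3 k4 k5 k6
    have hv' : τ'.reg .v = σ.reg .v + m := by simp [k5, h6]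
    have hz' : τ'.reg .z = σ.reg .z + (cat G.good (σ.reg .v) m).length := by simp [k5, h3]
    have hnb' : τ'.reg .nb = σ.reg .nb + (cat G.bad (σ.reg .v) m).length := by simp [k5, h4]
    refine (ih l' (by omega) τ' ?_ ?_ ?_ ?_ ?_ ?_).mono ?_
    · refine hG.of_eq ?_ ?_ ?_ ?_ ?_ ?_ ?_ <;> simp [k5, k6, h8, h9]
    · simp [k5, h8, hM]
    · omega
    · by_cases hc : G.q ≤ len
      · exact ⟨t + 1, .inl (by rw [hv', ht, add_mul]; omega)⟩
      · exact ⟨0, .inr (by omega)⟩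
    · rw [hz', hv']; omega
    · rw [hnb', hv']; omega
    rw [hz', hnb', hv']
    rintro τ'' ⟨l1, l2, l3, l4, l5, l6, l7⟩
    have heq : seg (τ''.arr .Z) (σ.reg .z) (cat G.good (σ.reg .v) m).length =
        seg (τ'.arr .Z) (σ.reg .z) (cat G.good (σ.reg .v) m).length :=
      seg_congr fun i hi hi' => l3 i (by omega)
    rw [h1] at k1
    refine ⟨?_, ?_, fun i hi => ?_, by omega, by omega, fun x => ?_, ?_⟩
    · rw [seg_add, heq]
      exact k1.append l1
    · rw [seg_add, heq, List.pairwise_append]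
      refine ⟨k2, l2, fun a ha b hb => ?_⟩
      obtain ⟨i, hi, hi', ha'⟩ := mem_cat.1 (k1.subset ha)
      obtain ⟨j, hj, hj', hb'⟩ := mem_cat.1 (l1.subset hb)
      refine hsep i j ?_ (by omega) a ha' b hb'
      -- Ranks of the current round have strip number at most `t`, ranks of later rounds at least `t
      -- + 1`.
      have e1 : i / G.q < t + 1 := by
        rw [Nat.div_lt_iff_lt_mul hqp, add_mul]; omega
      have e2 : t + 1 ≤ j / G.q := by
        rw [Nat.le_div_iff_mul_le hqp, add_mul]; omega
      omega
    · rw [l3 i (by omega), k3 i (by omega), h2 i (by simpa using hi)]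
    · simp only [l6, k6 .F (by simp) (by simp), h5]
      by_cases hx : x ∈ cat G.bad (σ.reg .v + m) l' <;>
        by_cases hx' : x ∈ cat G.bad (σ.reg .v) m <;> simp [hx, hx']
    · generalize (cat G.good (σ.reg .v) m).length = a at *
      generalize (cat G.bad (σ.reg .v) m).length = b at *
      have e1 : κ * (20 * a + 10) = 20 * (κ * a) + 10 * κ := by ring
      have e2 : (30 * κ + 30) * (a + (cat G.good (σ.reg .v + m) l').length +
          (b + (cat G.bad (σ.reg .v + m) l').length)) =
          30 * (κ * (a + b)) + 30 * (a + b) + (30 * κ + 30) *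
          ((cat G.good (σ.reg .v + m) l').length + (cat G.bad (σ.reg .v + m) l').length) := by ring
      -- The length-independent cost of sorting a strip is charged to all elements of its groups;
      -- the good ones alone may be none.
      have e3 : κ ≤ κ * (a + b) := Nat.le_mul_of_pos_right _ (by omega)
      have e4 : κ * a ≤ κ * (a + b) := Nat.mul_le_mul_left _ (by omega)
      omega

theorem wp_strips {E : Env} (hE : E.Valid) {G : GroupData} {M κ : ℕ}
    (hGb : G.Bounded E.n M) (hκ : G.q * G.q ≤ 2 ^ κ)
    (hsep : ∀ i j, i / G.q < j / G.q → j < M → ∀ a ∈ G.good i, ∀ b ∈ G.good j, E.r a b)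
    (hlt : ∀ i < M, ∀ a ∈ G.good i, a < E.n) {σ : HState} {Q : HState → Prop}
    (hG : G.Fits σ) (hM : σ.reg .M = M) (hv : σ.reg .v = 0) (hnb : σ.reg .nb = 0)
    (hzl : σ.reg .z + (cat G.good 0 M).length ≤ 4 * E.n)
    (hbl : (cat G.bad 0 M).length ≤ 4 * E.n)
    (hQ : ∀ τ : HState,
      (seg (τ.arr .Z) (σ.reg .z) (cat G.good 0 M).length).Perm (cat G.good 0 M) →
      (seg (τ.arr .Z) (σ.reg .z) (cat G.good 0 M).length).Pairwise E.r →
      (∀ i, i < σ.reg .z → τ.arr .Z i = σ.arr .Z i) →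
      τ.reg .z = σ.reg .z + (cat G.good 0 M).length →
      τ.reg .nb = (cat G.bad 0 M).length →
      (∀ x, τ.arr .F x = if x ∈ cat G.bad 0 M then 1 else σ.arr .F x) →
      τ.time ≤ σ.time + (30 * κ + 30) * ((cat G.good 0 M).length + (cat G.bad 0 M).length) + 1 →
      (∀ x, x ∉ Cmd.strips.modR → τ.reg x = σ.reg x) →
      (∀ b, b ≠ .Z → b ≠ .Y → b ≠ .F → τ.arr b = σ.arr b) → Q τ) :
    wp E Cmd.strips Q σ := by
  have h0 := wp_strips_core hE hGb hκ hsep hlt M σ hG hM (by omega) ⟨0, .inl (by omega)⟩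
    (by rwa [hv]) (by rw [hv]; omega)
  rw [hv, hnb] at h0
  refine h0.frame fun τ h hF => ?_
  refine hQ τ h.1 h.2.1 h.2.2.1 h.2.2.2.1 (by simpa using h.2.2.2.2.1) h.2.2.2.2.2.1
    h.2.2.2.2.2.2 hF.reg fun b g1 g2 g3 => hF.arr b ?_
  simp [Cmd.strips, Cmd.addGroups, Cmd.addGroup, Cmd.goodTest, Cmd.copy, Cmd.flag, Cmd.msort,
    Cmd.msortLoop, Cmd.pass, Cmd.merge, Cmd.copy, Cmd.take, Cmd.modA, *]

/-! ### Properties of the groups -/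

/-- As a `flatMap` over the list of samples, a concatenation in rank order can be permuted to the
order of the blocks. -/
theorem cat_eq_flatMap_seg (X : ℕ → ℕ) (h : ℕ → List ℕ) (c v k : ℕ) :
    cat (fun i => h (X (c + i))) v k = (seg X (c + v) k).flatMap h := by
  induction k generalizing v with
  | zero => rfl
  | succ k ih => rw [cat_succ, seg_succ, List.flatMap_cons, ih]; rfl

theorem seg_chunks (X : ℕ → ℕ) (b N q k : ℕ) :
    (List.range k).flatMap (fun g => seg X (b + g * q) (min q (N - g * q))) =
      seg X b (min (k * q) N) := by
  induction k with
  | zero => simp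
  | succ k ih =>
    rw [List.range_succ, List.flatMap_append, ih]
    simp only [List.flatMap_cons, List.flatMap_nil, List.append_nil]
    by_cases h : k * q ≤ N
    · rw [Nat.min_eq_left h, ← seg_add]
      congr 1
      rw [add_mul]
      omega
    · rw [show N - k * q = 0 by omega, Nat.min_zero, seg_zero, List.append_nil]
      congr 1
      rw [add_mul]
      omega

theorem pairwise_seg {R : ℕ → ℕ → Prop} {f : ℕ → ℕ} {lo k : ℕ} :
    (seg f lo k).Pairwise R ↔ ∀ i j, lo ≤ i → i < j → j < lo + k → R (f i) (f j) := by
  rw [List.pairwise_iff_getElem]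
  constructor
  · intro h i j hi hij hj
    have := h (i - lo) (j - lo) (by simp; omega) (by simp; omega) (by omega)
    rw [getElem_seg, getElem_seg] at this
    rwa [show lo + (i - lo) = i by omega, show lo + (j - lo) = j by omega] at this
  · intro h i j hi hj hij
    rw [getElem_seg, getElem_seg]
    simp at hi hj
    exact h _ _ (by omega) (by omega) (by omega)

/-- `X` holds the sorted blocks of length `q * q` of the list of increasing positions in `L`. -/
structure Blocks (E : Env) (L X : ℕ → ℕ) (b N q : ℕ) : Prop where
  q_pos : 0 < q
  incr : ∀ i j, b ≤ i → i < j → j < b + N → L i < L j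
  lt : ∀ i, b ≤ i → i < b + N → L i < E.n
  perm : (seg X b N).Perm (seg L b N)
  block_perm : ∀ k, (seg X (b + k * (q * q)) (min (q * q) (N - k * (q * q)))).Perm
    (seg L (b + k * (q * q)) (min (q * q) (N - k * (q * q))))
  sorted : ChunkSorted E X b N (q * q)

namespace Blocks

variable {E : Env} {L X : ℕ → ℕ} {b N q : ℕ} (h : Blocks E L X b N q)

include h

theorem nodup : (seg X b N).Nodup := by
  rw [h.perm.nodup_iff]
  refine (pairwise_seg.2 fun i j h₁ h₂ h₃ => ?_)
  exact (h.incr i j h₁ h₂ h₃).ne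

theorem inj {i j : ℕ} (hi : b ≤ i) (hi' : i < b + N) (hj : b ≤ j) (hj' : j < b + N)
    (hij : X i = X j) : i = j := by
  have := pairwise_seg.1 h.nodup
  rcases lt_trichotomy i j with h' | h' | h'
  · exact absurd hij (this i j hi h' hj')
  · exact h'
  · exact absurd hij.symm (this j i hj h' hi')

theorem X_lt {i : ℕ} (hi : b ≤ i) (hi' : i < b + N) : X i < E.n := by
  obtain ⟨j, h₁, h₂, h₃⟩ := mem_seg.1 (h.perm.subset (mem_seg.2 ⟨i, hi, hi', rfl⟩))
  rw [← h₃]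
  exact h.lt j h₁ h₂

theorem index_bounds {u : ℕ} (hu : u < N) :
    u / (q * q) * (q * q) ≤ u ∧ u < u / (q * q) * (q * q) + min (q * q)
      (N - u / (q * q) * (q * q)) := by
  have hq := Nat.mul_pos h.q_pos h.q_pos
  have h₁ := Nat.div_mul_le_self u (q * q)
  have h₂ := Nat.lt_div_mul_add (a := u) hq
  omega

theorem le_of_same_block {u w : ℕ} (huw : u < w) (hw : w < N)
    (hb : u / (q * q) = w / (q * q)) : E.r (X (b + u)) (X (b + w)) := by
  obtain ⟨h₁, h₂⟩ := h.index_bounds (huw.trans hw)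
  obtain ⟨h₃, h₄⟩ := h.index_bounds hw
  rw [← hb] at h₃ h₄
  exact pairwise_seg.1 (h.sorted (u / (q * q))) _ _ (by omega) (by omega) (by omega)

/-- Each block is a rearrangement of the same block of `L`, and `L` is increasing. -/
theorem lt_of_block_lt {u w : ℕ} (hu : u < N) (hw : w < N)
    (hb : u / (q * q) < w / (q * q)) : X (b + u) < X (b + w) := by
  obtain ⟨h₁, h₂⟩ := h.index_bounds hu
  obtain ⟨h₃, h₄⟩ := h.index_bounds hw
  obtain ⟨i, h₅, h₆, h₇⟩ := mem_seg.1 ((h.block_perm (u / (q * q))).subset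
    (mem_seg.2 ⟨b + u, by omega, by omega, rfl⟩))
  obtain ⟨j, h₈, h₉, h₁₀⟩ := mem_seg.1 ((h.block_perm (w / (q * q))).subset
    (mem_seg.2 ⟨b + w, by omega, by omega, rfl⟩))
  rw [← h₇, ← h₁₀]
  have := Nat.mul_le_mul_right (q * q) (Nat.succ_le_of_lt hb)
  rw [Nat.succ_mul] at this
  exact h.incr i j (by omega) (by omega) (by omega)

end Blocks

/-! ### Samples, strips and jumps -/

/-- A system of `M` samples in blocks of `q` samples: the sample number `g` is the position `p g`,
and `st g` is the number of its strip. -/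
structure SampleSystem (E : Env) (q M : ℕ) (p st : ℕ → ℕ) : Prop where
  lt : ∀ g < M, p g < E.n
  block : ∀ g g', g' < M → g / q < g' / q → p g < p g'
  within : ∀ g g', g < g' → g' < M → g / q = g' / q → E.r (p g) (p g')
  mono : ∀ g < M, ∀ g' < M, E.r (p g) (p g') → st g ≤ st g'
  strip_lt : ∀ g < M, st g * q < M

/-- The numbers of those samples that are not followed by a sample of the same block and strip. -/
def jumps (q M : ℕ) (st : ℕ → ℕ) : Finset ℕ :=
  (Finset.range M).filter fun g => ¬ (g + 1 < M ∧ (g + 1) / q = g / q ∧ st (g + 1) = st g)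

/-- A system of samples with many jumps. -/
def Obstruction (E : Env) (q : ℕ) : Prop :=
  ∃ (N M : ℕ) (p st : ℕ → ℕ), N ≤ 2 * E.n ∧ q * q < N ∧ (∀ g, g < M ↔ g * q < N) ∧
    SampleSystem E q M p st ∧ N < 4 * (q * (jumps q M st).card)

theorem length_flatMap_range_le {h : ℕ → List ℕ} {q : ℕ} (P : ℕ → Prop) [DecidablePred P]
    (hq : ∀ g, (h g).length ≤ q) (M : ℕ) (hP : ∀ g < M, ¬ P g → h g = []) :
    ((List.range M).flatMap h).length ≤ q * ((Finset.range M).filter P).card := by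
  induction M with
  | zero => simp
  | succ M ih =>
    rw [List.range_succ, List.flatMap_append, List.length_append, Finset.range_add_one,
      Finset.filter_insert]
    have := ih fun g hg => hP g (by omega)
    simp only [List.flatMap_cons, List.flatMap_nil, List.append_nil]
    split_ifs with hM
    · rw [Finset.card_insert_of_notMem (by simp), mul_add]
      have := hq M
      omega
    · rw [hP M (by omega) hM]
      simpa using this

/-- The data of a level of the sorting algorithm after the samples have been sorted. -/
structure LevelData (E : Env) (L : ℕ → ℕ) (G : GroupData) (M : ℕ) : Prop where
  blocks : Blocks E L G.X G.base G.N G.q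
  K_eq : G.K = G.q * G.q
  lt_iff : ∀ g, g < M ↔ g * G.q < G.N
  I_eq : ∀ g, g < M → G.I (G.X (G.base + g * G.q)) = G.base + g * G.q
  perm : (seg G.X (G.base + G.N) M).Perm
    ((List.range M).map fun g => G.X (G.base + g * G.q))
  sorted : (seg G.X (G.base + G.N) M).Pairwise E.r
  S_eq : ∀ i < M, G.S (G.X (G.base + G.N + i)) = i / G.q

namespace LevelData

variable {E : Env} {L : ℕ → ℕ} {G : GroupData} {M : ℕ} (h : LevelData E L G M)

include h

theorem M_le : M ≤ G.N := by
  rcases Nat.eq_zero_or_pos M with rfl | hM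
  · exact Nat.zero_le _
  · have := (h.lt_iff (M - 1)).1 (by omega)
    have := Nat.le_mul_of_pos_right (M - 1) h.blocks.q_pos
    omega

theorem sample_eq {i : ℕ} (hi : i < M) : ∃ g < M, G.sample i = G.X (G.base + g * G.q) := by
  have := h.perm.subset (mem_seg.2 ⟨G.base + G.N + i, by omega, by omega, rfl⟩)
  obtain ⟨g, hg, he⟩ := List.mem_map.1 this
  exact ⟨g, List.mem_range.1 hg, he.symm⟩

theorem eq_sample {g : ℕ} (hg : g < M) : ∃ i < M, G.X (G.base + g * G.q) = G.sample i := by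
  have := h.perm.symm.subset (List.mem_map.2 ⟨g, List.mem_range.2 hg, rfl⟩)
  obtain ⟨i, h₁, h₂, h₃⟩ := mem_seg.1 this
  refine ⟨i - (G.base + G.N), by omega, ?_⟩
  rw [GroupData.sample, ← h₃]
  congr 1
  omega

theorem nodup : (seg G.X (G.base + G.N) M).Nodup := by
  rw [h.perm.nodup_iff]
  refine List.Nodup.map_on ?_ List.nodup_range
  intro g hg g' hg' he
  rw [List.mem_range, h.lt_iff] at hg hg'
  have := h.blocks.inj (by omega) (by omega) (by omega) (by omega) he
  exact Nat.eq_of_mul_eq_mul_right h.blocks.q_pos (by omega)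

theorem sample_inj {i j : ℕ} (hi : i < M) (hj : j < M) (he : G.sample i = G.sample j) :
    i = j := by
  have := pairwise_seg.1 h.nodup
  rcases lt_trichotomy i j with h' | h' | h'
  · exact absurd he (this _ _ (by omega) (by omega) (by omega))
  · exact h'
  · exact absurd he.symm (this _ _ (by omega) (by omega) (by omega))

theorem sample_le {i j : ℕ} (hij : i < j) (hj : j < M) : E.r (G.sample i) (G.sample j) :=
  pairwise_seg.1 h.sorted _ _ (by omega) (by omega) (by omega)

theorem group_eq {g : ℕ} (hg : g < M) :
    G.group (G.X (G.base + g * G.q)) =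
      seg G.X (G.base + g * G.q) (min G.q (G.N - g * G.q)) := by
  rw [GroupData.group, h.I_eq g hg]
  congr 2
  omega

/-- Good and bad groups together are all groups; reordered from ranks to indices of samples, the
groups tile the list, the last one being truncated at its end. -/
theorem cat_perm : (cat G.good 0 M ++ cat G.bad 0 M).Perm (seg G.X G.base G.N) := by
  have h₁ : ∀ k v, (cat G.good v k ++ cat G.bad v k).Perm
      (cat (fun i => G.group (G.sample i)) v k) := by
    intro k
    induction k with
    | zero => simp
    | succ k ih =>
      intro v
      simp only [cat_succ]
      have e : (G.good v ++ G.bad v) = G.group (G.sample v) := by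
        unfold GroupData.good GroupData.bad
        split_ifs <;> simp
      rw [← e]
      refine List.Perm.trans ?_ ((List.Perm.refl _).append (ih (v + 1)))
      simp only [List.append_assoc]
      refine (List.Perm.refl _).append ?_
      rw [← List.append_assoc, ← List.append_assoc]
      exact List.perm_append_comm.append (List.Perm.refl _)
  refine (h₁ M 0).trans ?_
  have h₂ := cat_eq_flatMap_seg G.X G.group (G.base + G.N) 0 M
  simp only [add_zero] at h₂
  unfold GroupData.sample
  rw [h₂]
  refine (h.perm.flatMap_right _).trans ?_
  rw [List.flatMap_map]
  have h₃ : (List.range M).flatMap (fun g => G.group (G.X (G.base + g * G.q))) =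
      (List.range M).flatMap
        (fun g => seg G.X (G.base + g * G.q) (min G.q (G.N - g * G.q))) :=
    List.flatMap_congr fun g hg => h.group_eq (List.mem_range.1 hg)
  rw [h₃, seg_chunks]
  have : ¬ M * G.q < G.N := by rw [← h.lt_iff]; omega
  rw [Nat.min_eq_right (by omega)]

theorem bounded (hb : G.base + 2 * G.N ≤ 4 * E.n) (hq : G.q ≤ 4 * E.n + 64) :
    G.Bounded E.n M where
  e_le := by have := h.M_le; omega
  q_le := hq
  I_lt i hi := by
    obtain ⟨g, hg, he⟩ := h.sample_eq hi
    rw [he, h.I_eq g hg]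
    have := (h.lt_iff g).1 hg
    omega
  S_le i hi := by
    rw [GroupData.sample, h.S_eq i hi]
    have := Nat.div_le_self i G.q
    have := h.M_le
    omega
  X_lt i hi hi' := h.blocks.X_lt hi' hi
  base_le i hi := by
    obtain ⟨g, hg, he⟩ := h.sample_eq hi
    rw [he, h.I_eq g hg]
    omega
  q_pos := h.blocks.q_pos

/-- Let `y` be the sample after that of rank `i`. As group `i` is good, `a` precedes `y` in a sorted
block, and `y` lies in the strip of `i`; so `y` has smaller rank than `j`, and sample `j` is the
first element of the group of `c`. Hence `a ≤ y ≤ sample j ≤ c`. Goodness is needed for group `i`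
only. -/
theorem separated (hE : E.Valid) (i j : ℕ) (hij : i / G.q < j / G.q) (hj : j < M) (a : ℕ)
    (ha : a ∈ G.good i) (c : ℕ) (hc : c ∈ G.good j) : E.r a c := by
  have hi : i < M := by
    by_contra hcon
    have := Nat.div_le_div_right (c := G.q) (show j ≤ i by omega)
    omega
  have hq := h.blocks.q_pos
  have member : ∀ i < M, ∀ a ∈ G.group (G.sample i), ∃ g < M, ∃ u,
      G.sample i = G.X (G.base + g * G.q) ∧ g * G.q ≤ u ∧ u < g * G.q + G.q ∧ u < G.N ∧
      a = G.X (G.base + u) := by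
    intro i hi a ha
    obtain ⟨g, hg, he⟩ := h.sample_eq hi
    rw [he, h.group_eq hg] at ha
    obtain ⟨u, h₁, h₂, rfl⟩ := mem_seg.1 ha
    refine ⟨g, hg, u - G.base, he, by omega, by omega, by omega, ?_⟩
    congr 1
    omega
  unfold GroupData.good at ha hc
  split_ifs at ha with hgood
  swap
  · simp at ha
  replace hc : c ∈ G.group (G.sample j) := by
    split_ifs at hc
    · exact hc
    · simp at hc
  obtain ⟨g, hg, u, he, hu₁, hu₂, hu₃, rfl⟩ := member i hi a ha
  obtain ⟨g', hg', u', he', hu₁', hu₂', hu₃', rfl⟩ := member j hj c hc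
  rw [he] at hgood
  obtain ⟨k₁, k₂, k₃⟩ := hgood
  rw [h.I_eq g hg, h.K_eq] at k₂
  rw [h.I_eq g hg] at k₁ k₃
  have e₁ : G.base + g * G.q + G.q = G.base + (g + 1) * G.q := by ring
  rw [e₁] at k₁ k₂ k₃
  rw [Nat.add_sub_cancel_left, Nat.add_sub_cancel_left] at k₂
  have hg1 : g + 1 < M := by rw [h.lt_iff]; omega
  obtain ⟨i', hi', hy⟩ := h.eq_sample hg1
  have e₂ : (g + 1) * G.q = g * G.q + G.q := by ring
  have s₁ : E.r (G.X (G.base + u)) (G.X (G.base + (g + 1) * G.q)) := by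
    refine h.blocks.le_of_same_block (by omega) (by omega) ?_
    have m₁ := Nat.div_le_div_right (c := G.q * G.q) hu₁
    have m₂ := Nat.div_le_div_right (c := G.q * G.q) (show u ≤ (g + 1) * G.q by omega)
    omega
  have s₂ : E.r (G.sample i') (G.sample j) := by
    refine h.sample_le ?_ hj
    rw [hy, ← he, GroupData.sample, GroupData.sample, h.S_eq i' hi', h.S_eq i hi] at k₃
    by_contra hcon
    have := Nat.div_le_div_right (c := G.q) (show j ≤ i' by omega)
    omega
  have s₃ : E.r (G.sample j) (G.X (G.base + u')) := by
    rw [he']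
    rcases hu₁'.eq_or_lt with heq | hlt
    · rw [heq]
      rcases hE.total (G.X (G.base + u')) (G.X (G.base + u')) with t | t <;> exact t
    · refine h.blocks.le_of_same_block hlt hu₃' ?_
      -- A group never crosses a block boundary, because `q` divides `q * q`: the block of an index
      -- depends only on its quotient by `q`.
      rw [← Nat.div_div_eq_div_mul, ← Nat.div_div_eq_div_mul]
      congr 1
      rw [Nat.mul_div_cancel _ hq]
      symm
      rw [Nat.div_eq_iff hq]
      omega
  rw [← hy] at s₂
  exact hE.trans _ _ _ s₁ (hE.trans _ _ _ s₂ s₃)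

theorem good_lt (i : ℕ) (hi : i < M) (a : ℕ) (ha : a ∈ G.good i) : a < E.n := by
  have : a ∈ seg G.X G.base G.N := h.cat_perm.subset
    (List.mem_append_left _ (mem_cat.2 ⟨i, Nat.zero_le _, by omega, ha⟩))
  obtain ⟨j, h₁, h₂, rfl⟩ := mem_seg.1 this
  exact h.blocks.X_lt h₁ h₂

/-- With `q * q` entries per block and `q` per group, sample number `g` lies in block `g / q`.
Monotonicity of strips holds because the order of two samples is the order of their ranks. -/
theorem sampleSystem (hE : E.Valid) :
    SampleSystem E G.q M (fun g => G.X (G.base + g * G.q))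
      (fun g => G.S (G.X (G.base + g * G.q))) where
  lt g hg := by
    have := (h.lt_iff g).1 hg
    exact h.blocks.X_lt (by omega) (by omega)
  block g g' hg' hgg := by
    have hq := h.blocks.q_pos
    have hlt : g < g' := by
      by_contra hcon
      have := Nat.div_le_div_right (c := G.q) (show g' ≤ g by omega)
      omega
    have h₁ := (h.lt_iff g').1 hg'
    have h₂ := (h.lt_iff g).1 (hlt.trans hg')
    refine h.blocks.lt_of_block_lt h₂ h₁ ?_
    rwa [Nat.mul_div_mul_right _ _ hq, Nat.mul_div_mul_right _ _ hq]
  within g g' hgg hg' hb := by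
    have hq := h.blocks.q_pos
    refine h.blocks.le_of_same_block (Nat.mul_lt_mul_of_pos_right hgg hq) ((h.lt_iff g').1 hg') ?_
    rwa [Nat.mul_div_mul_right _ _ hq, Nat.mul_div_mul_right _ _ hq]
  mono g hg g' hg' hr := by
    obtain ⟨i, hi, he⟩ := h.eq_sample hg
    obtain ⟨i', hi', he'⟩ := h.eq_sample hg'
    rw [he, he'] at hr ⊢
    rw [GroupData.sample, GroupData.sample, h.S_eq i hi, h.S_eq i' hi']
    refine Nat.div_le_div_right ?_
    by_contra hcon
    have := hE.antisymm _ _ hr (h.sample_le (i := i') (j := i) (by omega) hi)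
    have := h.sample_inj hi hi' this
    omega
  strip_lt g hg := by
    obtain ⟨i, hi, he⟩ := h.eq_sample hg
    rw [he, GroupData.sample, h.S_eq i hi]
    exact lt_of_le_of_lt (Nat.div_mul_le_self _ _) hi

/-- A sample that is not a jump has a good group, and every group has at most `q` elements. -/
theorem length_bad_le : (cat G.bad 0 M).length ≤
    G.q * (jumps G.q M fun g => G.S (G.X (G.base + g * G.q))).card := by
  have hq := h.blocks.q_pos
  have h₂ := cat_eq_flatMap_seg G.X (fun x => if G.Good x then [] else G.group x)
    (G.base + G.N) 0 M
  simp only [add_zero] at h₂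
  have h₃ : cat G.bad 0 M = _ := h₂
  rw [h₃, (h.perm.flatMap_right _).length_eq, List.flatMap_map]
  refine length_flatMap_range_le _ (fun g => ?_) M fun g hg hj => ?_
  · split_ifs
    · simp
    · exact G.length_group_le _
  · simp only [not_not] at hj
    obtain ⟨k₁, k₂, k₃⟩ := hj
    have e₁ : G.base + g * G.q + G.q = G.base + (g + 1) * G.q := by ring
    refine if_pos ⟨?_, ?_, ?_⟩
    · rw [h.I_eq g hg, e₁]
      have := (h.lt_iff _).1 k₁
      omega
    · rw [h.I_eq g hg, e₁, h.K_eq, Nat.add_sub_cancel_left, Nat.add_sub_cancel_left,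
        Nat.mul_div_mul_right _ _ hq, Nat.mul_div_mul_right _ _ hq]
      omega
    · rw [h.I_eq g hg, e₁]
      omega

end LevelData

/-! ### The phases of one call of the sorting algorithm -/

namespace Cmd

/-- Suspend the current call, to be resumed at phase `ph` with the number `e` at hand, and call the
algorithm for the list that was stored after the current list. -/
def call (ph : ℕ) (e : Ex) : Cmd :=
  .seq (.st .SG (.r .sp) e)
  (.seq (.st .SP (.r .sp) (.c ph))
  (.seq (.set .sp (.add (.r .sp) (.c 1)))
  (.seq (.st .SB (.r .sp) listEnd)
  (.seq (.st .SN (.r .sp) (.sub (.r .o) listEnd))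
  (.st .SP (.r .sp) (.c 0))))))

/-- Sort a short list. -/
def leaf : Cmd :=
  .seq (.set .i0 (.r .base))
  (.seq (.set .i1 listEnd)
  (.seq (.set .j (.r .base))
  (.seq (copy .L .X)
  (.seq (.set .lo (.r .base))
  (.seq (.set .hi listEnd)
  (.seq (msort .X .Y)
  (.set .sp (.sub (.r .sp) (.c 1)))))))))

/-- Sort the blocks, and call the algorithm for the samples. -/
def split : Cmd :=
  .seq (.set .i0 (.r .base))
  (.seq (.set .i1 listEnd)
  (.seq (.set .j (.r .base))
  (.seq (copy .L .X)
  (.seq (.set .v (.r .base))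
  (.seq blockSort
  (.seq (.set .v (.r .base))
  (.seq (mark .F (.c 1))
  (.seq (.set .v (.r .base))
  (.seq (.set .o listEnd)
  (.seq collect
  (call 1 (.sub (.r .o) listEnd))))))))))))

/-- Sort the good groups, and call the algorithm for the elements of the bad groups, unless there
are too many of them. -/
def distribute : Cmd :=
  .seq (.set .M (.ld .SG (.r .sp)))
  (.seq (.set .v (.r .base))
  (.seq (mark .I (.r .v))
  (.seq (.set .v (.c 0))
  (.seq rank
  (.seq (.set .v (.c 0))
  (.seq (.set .z (.r .base))
  (.seq (.set .nb (.c 0))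
  (.seq strips
  (.ite (.r .N) (.mul (.c 4) (.r .nb))
    (.seq (.set .fail (.c 1)) (.set .sp (.c 0)))
    (.seq (.set .v (.r .base))
    (.seq (.set .o listEnd)
    (.seq collect
    (call 2 (.sub (.r .z) (.r .base)))))))))))))))

/-- Merge the elements of the good and of the bad groups. -/
def join : Cmd :=
  .seq (.set .M (.ld .SG (.r .sp)))
  (.seq (.set .i0 listEnd)
  (.seq (.set .i1 (.sub (.add listEnd (.r .N)) (.r .M)))
  (.seq (.set .j (.add (.r .base) (.r .M)))
  (.seq (copy .X .Z)
  (.seq (.set .p (.r .base))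
  (.seq (.set .pe (.add (.r .base) (.r .M)))
  (.seq (.set .r (.r .pe))
  (.seq (.set .re listEnd)
  (.seq (.set .o (.r .base))
  (.seq (merge .Z .X)
  (.set .sp (.sub (.r .sp) (.c 1)))))))))))))

/-- Work on the call on the top of the stack. -/
def step : Cmd :=
  .seq (.set .base (.ld .SB (.r .sp)))
  (.seq (.set .N (.ld .SN (.r .sp)))
  (.seq (.set .ph (.ld .SP (.r .sp)))
  (.ite (.r .ph) (.c 1)
    (.ite (.r .K) (.r .N) split leaf)
    (.ite (.r .ph) (.c 2) distribute join))))

/-- Work until the stack is empty. -/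
def run : Cmd := .wh (.c 0) (.r .sp) step

end Cmd

/-! ### Invariants of the recursion stack -/

/-- Admissible numbers of samples per strip. -/
structure Params (E : Env) (q κ : ℕ) : Prop where
  eight_le : 8 ≤ q
  sq_le : q * q ≤ 2 ^ κ
  le : q ≤ 4 * E.n + 64
  sq_le' : q * q ≤ 4 * (E.n + 1) ^ 2 + 64

/-- Everything that belongs to earlier calls is unchanged. -/
structure Keeps (f b : ℕ) (σ τ : HState) : Prop where
  q : τ.reg .q = σ.reg .q
  K : τ.reg .K = σ.reg .K
  n : τ.reg .n = σ.reg .n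
  fail : τ.reg .fail = σ.reg .fail
  L : ∀ i < b, τ.arr .L i = σ.arr .L i
  X : ∀ i < b, τ.arr .X i = σ.arr .X i
  Z : ∀ i < b, τ.arr .Z i = σ.arr .Z i
  SB : ∀ i < f, τ.arr .SB i = σ.arr .SB i
  SN : ∀ i < f, τ.arr .SN i = σ.arr .SN i
  SP : ∀ i < f, τ.arr .SP i = σ.arr .SP i
  SG : ∀ i < f, τ.arr .SG i = σ.arr .SG i

theorem Keeps.trans {f b f' b' : ℕ} {σ τ υ : HState} (h : Keeps f b σ τ) (h' : Keeps f' b' τ υ)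
    (hf : f ≤ f') (hb : b ≤ b') : Keeps f b σ υ where
  q := h'.q.trans h.q
  K := h'.K.trans h.K
  n := h'.n.trans h.n
  fail := h'.fail.trans h.fail
  L i hi := (h'.L i (by omega)).trans (h.L i hi)
  X i hi := (h'.X i (by omega)).trans (h.X i hi)
  Z i hi := (h'.Z i (by omega)).trans (h.Z i hi)
  SB i hi := (h'.SB i (by omega)).trans (h.SB i hi)
  SN i hi := (h'.SN i (by omega)).trans (h.SN i hi)
  SP i hi := (h'.SP i (by omega)).trans (h.SP i hi)
  SG i hi := (h'.SG i (by omega)).trans (h.SG i hi)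

/-- The number `f` of the current call, and its list. -/
structure Active (E : Env) (σ : HState) (f b N : ℕ) : Prop where
  sp : σ.reg .sp = f
  SB : σ.arr .SB f = b
  SN : σ.arr .SN f = N
  pos : 0 < f
  le : f ≤ b + 1
  fits : b + 2 * N ≤ 4 * E.n
  F : ∀ x, σ.arr .F x = 0

/-- The list of a call consists of increasing positions. -/
structure Input (E : Env) (L : ℕ → ℕ) (b N : ℕ) : Prop where
  incr : ∀ i j, b ≤ i → i < j → j < b + N → L i < L j
  lt : ∀ i, b ≤ i → i < b + N → L i < E.n

theorem Input.nodup {E : Env} {L : ℕ → ℕ} {b N : ℕ} (h : Input E L b N) : (seg L b N).Nodup :=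
  pairwise_seg.2 fun i j h₁ h₂ h₃ => (h.incr i j h₁ h₂ h₃).ne

/-- A sublist of a list of increasing positions. -/
theorem Input.of_sublist {E : Env} {L L' : ℕ → ℕ} {b N b' : ℕ} {l : List ℕ} (h : Input E L b N)
    (hl : l.Sublist (seg L b N)) (hL : seg L' b' l.length = l) :
    Input E L' b' l.length := by
  have h₁ : (seg L b N).Pairwise (· < ·) := pairwise_seg.2 h.incr
  have h₂ : l.Pairwise (· < ·) := h₁.sublist hl
  rw [← hL] at h₂
  refine ⟨pairwise_seg.1 (by simpa using h₂), fun i hi hi' => ?_⟩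
  have h₃ : L' i ∈ l := hL ▸ mem_seg.2 ⟨i, hi, by simpa using hi', rfl⟩
  obtain ⟨j, k₁, k₂, k₃⟩ := mem_seg.1 (hl.subset h₃)
  rw [← k₃]
  exact h.lt j k₁ k₂

/-! ### Correctness of the phases -/

theorem wp_leaf {E : Env} (hE : E.Valid) {f b N κ : ℕ} {σ : HState} {Q : HState → Prop}
    (hA : Active E σ f b N) (hI : Input E (σ.arr .L) b N) (hb : σ.reg .base = b)
    (hN : σ.reg .N = N) (hκ : N ≤ 2 ^ κ)
    (hQ : ∀ τ : HState, Keeps f b σ τ → τ.reg .sp = f - 1 → (∀ x, τ.arr .F x = 0) →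
      (seg (τ.arr .X) b N).Perm (seg (σ.arr .L) b N) → (seg (τ.arr .X) b N).Pairwise E.r →
      τ.time ≤ σ.time + κ * (20 * N + 10) + 4 * N + 20 → Q τ) :
    wp E Cmd.leaf Q σ := by
  have hB := hE.large'
  have hfit := hA.fits
  simp [Cmd.leaf, Cmd.listEnd, hb, hN]
  refine ⟨by omega, ?_⟩
  refine wp_copy hE (by simp) (m := N) ?_ ?_ ?_ ?_
  all_goals simp
  all_goals try omega
  intro τ h1 h2 h3 h4 h5 h6
  simp [h5, hb, hN]
  refine ⟨by omega, ?_⟩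
  refine wp_msort hE (by simp) (len := N) (j := κ) ?_ ?_ ?_ hκ ?_ ?_
  all_goals simp
  all_goals try omega
  · intro i hi hi'
    have : τ.arr .X i ∈ seg (σ.arr .L) b N := h1 ▸ mem_seg.2 ⟨i, hi, hi', rfl⟩
    obtain ⟨j, k₁, k₂, k₃⟩ := mem_seg.1 this
    rw [← k₃]
    exact hI.lt j k₁ k₂
  intro υ k1 k2 k3 k4 k5 k6
  refine ⟨by omega, hQ _ ?_ ?_ ?_ ?_ ?_ ?_⟩
  · constructor <;> simp [k5, k6, h5, h6]
    intro i hi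
    rw [k3 i (.inl hi), h2 i (.inl hi)]
  · simp [k5, h5, hA.sp]
  · simp [k6, h6, hA.F]
  · simp
    rw [← h1]
    exact k1
  · simpa using k2
  · simp
    omega

/-- What a call returns. -/
structure Returned (E : Env) (f b N t : ℕ) (σ τ : HState) : Prop where
  keeps : Keeps f b σ τ
  sp : τ.reg .sp = f - 1
  F : ∀ x, τ.arr .F x = 0
  perm : (seg (τ.arr .X) b N).Perm (seg (σ.arr .L) b N)
  sorted : (seg (τ.arr .X) b N).Pairwise E.r
  time : τ.time ≤ σ.time + t

theorem lt_ceil_iff {N q g : ℕ} (hq : 0 < q) : g < (N + q - 1) / q ↔ g * q < N := by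
  rw [Nat.lt_iff_add_one_le, Nat.le_div_iff_mul_le hq, add_mul, one_mul]
  omega

/-- The new call works in the arrays from `b + N` on. Its list has at most `N / 4` elements, so `b +
2 * N` bounds its space as well; and since `N` is positive, the depth of the stack stays bounded by
the base. -/
theorem wp_split {E : Env} (hE : E.Valid) {f b N q κ : ℕ} (hP : Params E q κ) {σ : HState}
    {Q : HState → Prop} (hA : Active E σ f b N) (hI : Input E (σ.arr .L) b N)
    (hb : σ.reg .base = b) (hN : σ.reg .N = N) (hq : σ.reg .q = q) (hK : σ.reg .K = q * q)
    (hlt : q * q < N)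
    (hQ : ∀ (τ : HState) (M : ℕ), Keeps f b σ τ → (∀ i < b + N, τ.arr .L i = σ.arr .L i) →
      τ.arr .SB f = b → τ.arr .SN f = N → τ.arr .SP f = 1 → τ.arr .SG f = M →
      Active E τ (f + 1) (b + N) M → Input E (τ.arr .L) (b + N) M → τ.arr .SP (f + 1) = 0 →
      Blocks E (σ.arr .L) (τ.arr .X) b N q → (∀ g, g < M ↔ g * q < N) →
      (seg (τ.arr .L) (b + N) M).Perm ((List.range M).map fun g => τ.arr .X (b + g * q)) →
      τ.time ≤ σ.time + (30 * κ + 10) * N + 14 * N + 30 → Q τ) :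
    wp E Cmd.split Q σ := by
  have hB := hE.large'
  have hfit := hA.fits
  have h8 := hP.eight_le
  have hqN : q ≤ q * q := Nat.le_mul_self q
  have hqq : 8 * q ≤ q * q := Nat.mul_le_mul_right q h8
  simp [Cmd.split, Cmd.listEnd, hb, hN]
  refine ⟨by omega, ?_⟩
  refine wp_copy hE (by simp) (m := N) ?_ ?_ ?_ ?_
  all_goals simp
  all_goals try omega
  intro τ h1 h2 h3 h4 h5 h6
  have hτX : ∀ i, b ≤ i → i < b + N → τ.arr .X i = σ.arr .L i := by
    intro i hi hi'
    have := congrArg (fun l => l[i - b]?) h1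
    rw [List.getElem?_eq_getElem (by simp; omega), List.getElem?_eq_getElem (by simp; omega),
      getElem_seg, getElem_seg, show b + (i - b) = i by omega] at this
    simpa using this
  simp [h5, hb]
  refine wp_blockSort hE (κ := κ) (len := N) ?_ ?_ ?_ ?_ ?_ ?_ ?_
  all_goals simp [h5, hb, hN, hK]
  all_goals try omega
  · exact hP.sq_le
  · exact hP.sq_le'
  · intro i hi hi'
    rw [hτX i hi hi']
    exact hI.lt i hi hi'
  intro υ k1 k2 k3 k4 k5 k6 k7
  have hbl : Blocks E (σ.arr .L) (υ.arr .X) b N q := by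
    refine ⟨by omega, hI.incr, hI.lt, ?_, fun k => ?_, k2⟩
    · rw [← h1]; exact k3
    · refine (k1 k).trans (List.Perm.of_eq (seg_congr fun i hi hi' => hτX i ?_ ?_)) <;> omega
  simp [k6, h5, hb]
  refine wp_mark hE (f := fun _ => 1) (len := N) (by simp) (by simp; omega) (by simp) ?_ ?_ ?_ ?_
    ?_ ?_
  all_goals simp [k6, h5, hb, hN, hq]
  all_goals try omega
  · intro i hi hi' j hj hj' he
    exact hbl.inj hi hi' hj hj' he
  intro φ l1 l2 l3 l4 l5
  simp [l4, k6, h5, hb, hN]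
  refine ⟨by omega, ?_⟩
  refine wp_collect hE (len := N) ?_ ?_ ?_ ?_ ?_
  all_goals simp [l4, k6, h5, hb, hN, l5, k7, h6]
  all_goals try omega
  · exact hI.nodup
  intro ψ l m1 m1' m2 m3 m4 m5 m6 m7 m8
  have hφF : ∀ x, 0 < φ.arr .F x ↔ ∃ g, g * q < N ∧ υ.arr .X (b + g * q) = x := by
    intro x
    constructor
    · intro h
      by_contra hcon
      push Not at hcon
      rw [l2 x fun g hg => hcon g hg, k7 _ (by simp) (by simp)] at h
      simp [h6, hA.F] at h
    · rintro ⟨g, hg, rfl⟩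
      rw [l1 g hg]
      omega
  have hnd : l.Nodup := hI.nodup.sublist m1
  have hperm : l.Perm ((List.range ((N + q - 1) / q)).map fun g => υ.arr .X (b + g * q)) := by
    refine (List.perm_ext_iff_of_nodup hnd ?_).2 fun x => ?_
    · refine List.Nodup.map_on ?_ List.nodup_range
      intro g hg g' hg' he
      rw [List.mem_range, lt_ceil_iff (by omega)] at hg hg'
      have := hbl.inj (by omega) (by omega) (by omega) (by omega) he
      exact Nat.eq_of_mul_eq_mul_right (show 0 < q by omega) (by omega)
    · rw [m1', List.mem_map]
      simp only [hφF, List.mem_range, lt_ceil_iff (show 0 < q by omega)]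
      constructor
      · exact fun h => h.2
      · rintro ⟨g, hg, rfl⟩
        refine ⟨hbl.perm.subset (mem_seg.2 ⟨b + g * q, by omega, by omega, rfl⟩), g, hg, rfl⟩
  have hlen : l.length = (N + q - 1) / q := by rw [hperm.length_eq]; simp
  -- Rounding up the number of samples costs less than `q ≤ q * q / 8 < N / 8`.
  have hM : 4 * l.length ≤ N := by
    rw [hlen]
    have : (N + q - 1) / q * q ≤ N + q - 1 := Nat.div_mul_le_self _ _
    have : (N + q - 1) / q * 8 ≤ (N + q - 1) / q * q := Nat.mul_le_mul_left _ h8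
    omega
  have hψL : ∀ i < b + N, ψ.arr .L i = σ.arr .L i := m4
  have hψr : ∀ x, x ≠ Reg.v → x ≠ .x → x ≠ .o → x ≠ .i0 → x ≠ .i1 → x ≠ .j → x ≠ .p → x ≠ .pe →
      x ≠ .r → x ≠ .re → x ≠ .u → x ≠ .w → x ≠ .lo → x ≠ .hi → ψ.reg x = σ.reg x := by
    intros
    simp [*]
  have hψX : ψ.arr .X = υ.arr .X := by simp [m8, l5]
  clear m7 l4 k6 h5
  have hle := hA.le
  simp [Cmd.call, Cmd.listEnd, hψr, hb, hN, hA.sp, m3]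
  refine ⟨by omega, by omega, by omega, by omega, by omega, ?_⟩
  have hIn : Input E (ψ.arr .L) (b + N) l.length := hI.of_sublist m1 m2
  refine hQ _ l.length ⟨?_, ?_, ?_, ?_, ?_, ?_, ?_, ?_, ?_, ?_, ?_⟩ ?_ ?_ ?_ ?_ ?_ ?_ ?_ ?_ ?_ ?_
    ?_ ?_
  all_goals try simp [hψr, hψX]
  · exact fun i hi => hψL i (by omega)
  · intro i hi
    rw [k4 i (.inl hi), h2 i (.inl hi)]
  · simp [m8, l5, k7, h6]
  · intro i hi
    rw [Function.update_of_ne (by omega)]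
    simp [m8, l5, k7, h6]
  · intro i hi
    rw [Function.update_of_ne (by omega)]
    simp [m8, l5, k7, h6]
  · intro i hi
    rw [Function.update_of_ne (by omega), Function.update_of_ne (by omega)]
    simp [m8, l5, k7, h6]
  · intro i hi
    rw [Function.update_of_ne (by omega)]
    simp [m8, l5, k7, h6]
  · exact hψL
  · simp [m8, l5, k7, h6, hA.SB]
  · simp [m8, l5, k7, h6, hA.SN]
  · refine ⟨?_, ?_, ?_, ?_, ?_, ?_, ?_⟩
    all_goals try simp
    all_goals try omega
    intro x
    rw [m5 x]
    split_ifs with hx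
    · rfl
    · by_contra hcon
      obtain ⟨g, hg, rfl⟩ := (hφF x).1 (Nat.pos_of_ne_zero hcon)
      exact hx (hbl.perm.subset (mem_seg.2 ⟨b + g * q, by omega, by omega, rfl⟩))
  · exact hIn
  · exact hbl
  · intro g
    rw [hlen, lt_ceil_iff (by omega)]
  · rw [m2]
    refine hperm.trans (List.Perm.of_eq ?_)
    rw [hlen]
  · omega

/-- `hQ` continues with the call for the bad elements, `hQ'` handles the abandoned run. In the
latter case the emptied stack stops the main loop, and flags remain set at some positions below
`E.n`; only the cells beyond are promised to be clean. -/
theorem wp_distribute {E : Env} (hE : E.Valid) {f b N M q κ : ℕ} (hP : Params E q κ) {σ : HState}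
    {Q : HState → Prop} (hA : Active E σ f b N) (hI : Input E (σ.arr .L) b N)
    (hb : σ.reg .base = b) (hN : σ.reg .N = N) (hq : σ.reg .q = q) (hK : σ.reg .K = q * q)
    (hM : σ.arr .SG f = M) (hlt : q * q < N)
    (hbl : Blocks E (σ.arr .L) (σ.arr .X) b N q) (hiff : ∀ g, g < M ↔ g * q < N)
    (hperm : (seg (σ.arr .X) (b + N) M).Perm ((List.range M).map fun g => σ.arr .X (b + g * q)))
    (hsort : (seg (σ.arr .X) (b + N) M).Pairwise E.r)
    (hQ : ∀ (τ : HState) (g m : ℕ), Keeps f b σ τ → (∀ i < b + N, τ.arr .L i = σ.arr .L i) →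
      τ.arr .SB f = b → τ.arr .SN f = N → τ.arr .SP f = 2 → τ.arr .SG f = g →
      Active E τ (f + 1) (b + N) m → Input E (τ.arr .L) (b + N) m → τ.arr .SP (f + 1) = 0 →
      g + m = N → 4 * m ≤ N → (seg (τ.arr .Z) b g).Pairwise E.r →
      (seg (τ.arr .Z) b g ++ seg (τ.arr .L) (b + N) m).Perm (seg (σ.arr .L) b N) →
      τ.time ≤ σ.time + (30 * κ + 30) * N + 13 * N + 40 → Q τ)
    (hQ' : ∀ τ : HState, τ.reg .sp = 0 → τ.reg .fail = 1 → τ.reg .q = σ.reg .q →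
      τ.reg .K = σ.reg .K → τ.reg .n = σ.reg .n → (∀ x, E.n ≤ x → τ.arr .F x = 0) →
      Obstruction E q → τ.time ≤ σ.time + (30 * κ + 30) * N + 13 * N + 40 → Q τ) :
    wp E Cmd.distribute Q σ := by
  have hB := hE.large'
  have hfit := hA.fits
  have hle := hA.le
  have h8 := hP.eight_le
  have hqN : q ≤ q * q := Nat.le_mul_self q
  have hMN : M ≤ N := by
    by_contra hcon
    have := (hiff N).1 (by omega)
    have := Nat.le_mul_of_pos_right N (show 0 < q by omega)
    omega
  simp [Cmd.distribute, hb, hA.sp, hM]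
  refine wp_mark hE (f := fun v => v) (len := N) (by simp) (by simp) (by simp) ?_ ?_ ?_ ?_ ?_ ?_
  all_goals simp [hb, hN, hq]
  all_goals try omega
  · intro i hi hi' j hj hj' he
    exact hbl.inj hi hi' hj hj' he
  intro τ h1 _ h2 h3 h4
  refine ⟨by omega, ?_⟩
  have hnd : (seg (σ.arr .X) (b + N) M).Nodup := by
    rw [hperm.nodup_iff]
    refine List.Nodup.map_on ?_ List.nodup_range
    intro g hg g' hg' he
    rw [List.mem_range, hiff] at hg hg'
    have := hbl.inj (by omega) (by omega) (by omega) (by omega) he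
    exact Nat.eq_of_mul_eq_mul_right (show 0 < q by omega) (by omega)
  refine wp_rank hE (len := M) ?_ ?_ ?_ ?_
  all_goals simp [h3, h4, hb, hN]
  · omega
  · intro i hi j hj he
    rcases lt_trichotomy i j with h | h | h
    · exact absurd he (pairwise_seg.1 hnd _ _ (by omega) (by omega) (by omega))
    · exact h
    · exact absurd he.symm (pairwise_seg.1 hnd _ _ (by omega) (by omega) (by omega))
  intro υ k1 k2 k3 k4
  refine ⟨by omega, ?_⟩
  obtain ⟨G, hG⟩ : ∃ G : GroupData, G = ⟨υ.arr .X, υ.arr .I, υ.arr .S, b, N, q, q * q⟩ := ⟨_, rfl⟩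
  have hX : υ.arr .X = σ.arr .X := by simp [k4, h4]
  have D : LevelData E (σ.arr .L) G M := by
    subst hG
    rw [hX]
    refine ⟨hbl, rfl, hiff, fun g hg => ?_, hperm, hsort, fun i hi => ?_⟩
    · simp only [k4 .I (by simp)]
      exact h1 g (by rw [← hiff]; exact hg)
    · rw [hq] at k1
      exact k1 i hi
  have hGb : G.base = b := by rw [hG]
  have hGN : G.N = N := by rw [hG]
  have hGq : G.q = q := by rw [hG]
  have hGX : G.X = σ.arr .X := by rw [hG, hX]
  have hcat := D.cat_perm
  rw [hGX, hGb, hGN] at hcat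
  have hlen := hcat.length_eq
  rw [List.length_append, length_seg] at hlen
  have hbd := D.bounded (by rw [hGb, hGN]; exact hfit) (by rw [hGq]; exact hP.le)
  refine wp_strips hE (G := G) (M := M) (κ := κ) hbd (by rw [hGq]; exact hP.sq_le)
    (D.separated hE) D.good_lt ?_ ?_ ?_ ?_ ?_ ?_ ?_
  · subst hG
    constructor <;> simp [k3, h3, hb, hN, hq, hK]
  all_goals try simp [k3, h3, hb]
  · omega
  · omega
  intro φ l1 l2 l3 l4 l5 l6 l7 l8 l9
  generalize hgl : cat G.good 0 M = good at *
  generalize hbdl : cat G.bad 0 M = bad at *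
  have l8' : ∀ x : Reg, x ≠ .v → x ≠ .ve → x ≠ .lo → x ≠ .hi → x ≠ .z → x ≠ .x → x ≠ .i0 →
      x ≠ .i1 → x ≠ .ok → x ≠ .j → x ≠ .nb → x ≠ .p → x ≠ .pe → x ≠ .r → x ≠ .re → x ≠ .o →
      x ≠ .u → x ≠ .w → x ≠ .M → φ.reg x = σ.reg x := by
    intros
    rw [l8]
    · simp [*]
    · simp [Cmd.strips, Cmd.addGroups, Cmd.addGroup, Cmd.goodTest, Cmd.copy, Cmd.flag, Cmd.msort,
        Cmd.msortLoop, Cmd.pass, Cmd.merge, Cmd.copy, Cmd.take, Cmd.modR, *]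
  have l9' : ∀ a : Arr, a ≠ .Z → a ≠ .Y → a ≠ .F → a ≠ .S → a ≠ .I → φ.arr a = σ.arr a := by
    intro a g1 g2 g3 g4 g5
    rw [l9 a g1 g2 g3, k4 a g4, h4 a g5]
  have hF : ∀ x, φ.arr .F x = if x ∈ bad then 1 else 0 := by
    intro x
    rw [l6, k4 _ (by simp), h4 _ (by simp), hA.F]
  have hZ : ∀ i < b, φ.arr .Z i = σ.arr .Z i := by
    intro i hi
    rw [l3 i hi, k4 _ (by simp), h4 _ (by simp)]
  have htime : φ.time ≤ σ.time + (30 * κ + 30) * N + 6 * N + 20 := by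
    rw [hlen] at l7
    omega
  clear l8 l9 k3 h3 h4 k4 k2 h2 l7
  have hall : (good ++ bad).Perm (seg (σ.arr .L) b N) := hcat.trans hbl.perm
  have h4m : 4 * bad.length < E.B := by omega
  simp [Cmd.listEnd, l8', hb, hN, l5, h4m]
  refine ⟨by omega, fun hab => ⟨by omega, by omega, ?_⟩, fun hab => ?_⟩
  -- More than a quarter of the elements are bad, and they number at most `q` per jump.
  · refine hQ' _ ?_ ?_ ?_ ?_ ?_ ?_ ⟨N, M, _, _, by omega, hlt, hiff,
      hGq ▸ D.sampleSystem hE, ?_⟩ ?_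
    all_goals try simp [l8']
    · intro x hx
      rw [hF, if_neg]
      intro hxb
      obtain ⟨i, h₁, h₂, rfl⟩ := mem_seg.1 (hall.subset (List.mem_append_right _ hxb))
      have := hI.lt i h₁ h₂
      omega
    · have := D.length_bad_le
      rw [hbdl, hGq] at this
      omega
    · omega
  refine ⟨by omega, ?_⟩
  have hLeq : φ.arr .L = σ.arr .L := l9' _ (by simp) (by simp) (by simp) (by simp) (by simp)
  refine wp_collect hE (len := N) ?_ ?_ ?_ ?_ ?_
  all_goals simp [l8', hb, hN, hLeq]
  all_goals try omega
  · exact hI.nodup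
  intro ψ l m1 m1' m2 m3 m4 m5 m6 m7 m8
  have hlb : l.Perm bad := by
    have : (good ++ bad).Nodup := hall.symm.nodup hI.nodup
    refine (List.perm_ext_iff_of_nodup (hI.nodup.sublist m1) (List.nodup_append.1 this).2.1).2
      fun x => ?_
    rw [m1', hF]
    constructor
    · rintro ⟨-, h⟩
      by_contra hcon
      simp [hcon] at h
    · intro h
      simp [h, hall.subset (List.mem_append_right _ h)]
  have hll := hlb.length_eq
  have hψr : ∀ x : Reg, x ≠ .v → x ≠ .ve → x ≠ .lo → x ≠ .hi → x ≠ .z → x ≠ .x → x ≠ .i0 →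
      x ≠ .i1 → x ≠ .ok → x ≠ .j → x ≠ .nb → x ≠ .p → x ≠ .pe → x ≠ .r → x ≠ .re → x ≠ .o →
      x ≠ .u → x ≠ .w → x ≠ .M → ψ.reg x = σ.reg x := by
    intros
    simp [*]
  have hψa : ∀ a : Arr, a ≠ .L → a ≠ .Z → a ≠ .Y → a ≠ .F → a ≠ .S → a ≠ .I →
      ψ.arr a = σ.arr a := by
    intros
    simp [*]
  have hψZ : ψ.arr .Z = φ.arr .Z := m8 _ (by simp) (by simp)
  have hψz : ψ.reg .z = b + good.length := by simp [m7, l4]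
  clear m7 l8' m8
  simp [Cmd.call, Cmd.listEnd, hψr, hb, hN, hA.sp, m3, hψz]
  refine ⟨by omega, by omega, by omega, by omega, ?_⟩
  have hIn : Input E (ψ.arr .L) (b + N) l.length := hI.of_sublist m1 m2
  refine hQ _ good.length l.length ⟨?_, ?_, ?_, ?_, ?_, ?_, ?_, ?_, ?_, ?_, ?_⟩ ?_ ?_ ?_ ?_ ?_ ?_
    ?_ ?_ ?_ ?_ ?_ ?_ ?_
  all_goals try simp [hψr, hψa, hψZ]
  · exact fun i hi => m4 i (by omega)
  · exact hZ
  · intro i hi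
    rw [Function.update_of_ne (by omega)]
  · intro i hi
    rw [Function.update_of_ne (by omega)]
  · intro i hi
    rw [Function.update_of_ne (by omega), Function.update_of_ne (by omega)]
  · intro i hi
    rw [Function.update_of_ne (by omega)]
  · exact m4
  · exact hA.SB
  · exact hA.SN
  · refine ⟨?_, ?_, ?_, ?_, ?_, ?_, ?_⟩
    all_goals try simp
    all_goals try omega
    intro x
    rw [m5 x, hF]
    split_ifs with hx hx'
    · rfl
    · exact absurd (hall.subset (List.mem_append_right _ hx')) hx
    · rfl
  · exact hIn
  · omega
  · omega
  · exact l2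
  · rw [m2]
    exact (l1.append hlb).trans hall
  · omega

/-- The sorted bad elements are first moved behind the good ones in `Z`, so that a merge from `Z` to
`X` delivers the result where a caller expects it. -/
theorem wp_join {E : Env} (hE : E.Valid) {f b N g : ℕ} {σ : HState} {Q : HState → Prop}
    (hA : Active E σ f b N) (hb : σ.reg .base = b) (hN : σ.reg .N = N) (hg : σ.arr .SG f = g)
    (hgN : g ≤ N) {l : List ℕ} (hl : ∀ x ∈ l, x < E.n)
    (hperm : (seg (σ.arr .Z) b g ++ seg (σ.arr .X) (b + N) (N - g)).Perm l)
    (hs : (seg (σ.arr .Z) b g).Pairwise E.r)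
    (hs' : (seg (σ.arr .X) (b + N) (N - g)).Pairwise E.r)
    (hQ : ∀ τ : HState, Keeps f b σ τ → τ.reg .sp = f - 1 → (∀ x, τ.arr .F x = 0) →
      (seg (τ.arr .X) b N).Perm l → (seg (τ.arr .X) b N).Pairwise E.r →
      τ.time ≤ σ.time + 11 * N + 20 → Q τ) :
    wp E Cmd.join Q σ := by
  have hB := hE.large'
  have hfit := hA.fits
  simp [Cmd.join, Cmd.listEnd, hb, hN, hg, hA.sp]
  refine ⟨by omega, by omega, by omega, ?_⟩
  refine wp_copy hE (by simp) (m := N - g) ?_ ?_ ?_ ?_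
  all_goals simp
  all_goals try omega
  intro τ h1 h2 h3 h4 h5 h6
  simp [h5, hb, hN]
  refine ⟨by omega, by omega, ?_⟩
  have e₁ : seg (τ.arr .Z) b g = seg (σ.arr .Z) b g := seg_congr fun i hi hi' => h2 i (by omega)
  have hall : ∀ i, b ≤ i → i < b + N → τ.arr .Z i < E.n := by
    intro i hi hi'
    refine hl _ (hperm.subset ?_)
    rw [← e₁, ← h1, ← seg_add, show g + (N - g) = N by omega]
    exact mem_seg.2 ⟨i, hi, hi', rfl⟩
  refine wp_merge hE (by simp) (m := N) ?_ ?_ ?_ ?_ ?_ ?_ ?_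
  all_goals simp
  all_goals try omega
  · exact fun i hi hi' => hall i hi (by omega)
  · exact fun i hi hi' => hall i (by omega) hi'
  intro υ k1 k2 k3 k4 k5
  rw [show b + N - (b + g) = N - g by omega, h1, e₁] at k1
  refine ⟨by omega, hQ _ ?_ ?_ ?_ ?_ ?_ ?_⟩
  · constructor <;> simp [k4, k5, h5, h6]
    · exact fun i hi => by rw [k2 i (by omega), h6 _ (by simp)]
    · exact fun i hi => h2 i (by omega)
  · simp [k4, h5, hA.sp]
  · simp [k5, h6, hA.F]
  · simp
    rw [k1]
    exact (List.merge_perm_append _).trans hperm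
  · simp
    rw [k1]
    exact hE.pairwise_merge hs hs'
  · simp
    omega

/-! ### The recursion -/

/-- The code for a phase. -/
def Cmd.phase (ph K N : ℕ) : Cmd :=
  if ph < 1 then if K < N then split else leaf else if ph < 2 then distribute else join

/-- The current call has been loaded to the registers. -/
structure Loaded (b N : ℕ) (σ τ : HState) : Prop where
  arr : τ.arr = σ.arr
  reg : ∀ x : Reg, x ≠ .base → x ≠ .N → x ≠ .ph → τ.reg x = σ.reg x
  base : τ.reg .base = b
  N : τ.reg .N = N
  time : τ.time ≤ σ.time + 6

theorem Loaded.active {E : Env} {f b N : ℕ} {σ τ : HState} (h : Loaded b N σ τ)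
    (hA : Active E σ f b N) : Active E τ f b N :=
  ⟨by rw [h.reg _ (by simp) (by simp) (by simp), hA.sp], by rw [h.arr, hA.SB],
    by rw [h.arr, hA.SN], hA.pos, hA.le, hA.fits, fun x => by rw [h.arr, hA.F]⟩

theorem Loaded.keeps {b N : ℕ} {σ τ : HState} (h : Loaded b N σ τ) (f b' : ℕ) :
    Keeps f b' σ τ := by
  constructor <;> first | exact h.reg _ (by simp) (by simp) (by simp) | simp [h.arr]

/-- One round of the main loop: load the top of the stack, perform its phase, and continue with the
loop. -/
theorem wp_run {E : Env} (hE : E.Valid) {f b N : ℕ} {σ : HState} {Q : HState → Prop}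
    (hA : Active E σ f b N)
    (h : ∀ τ, Loaded b N σ τ →
      wp E (Cmd.phase (σ.arr .SP f) (σ.reg .K) N) (wp E Cmd.run Q) τ) :
    wp E Cmd.run Q σ := by
  have hB := hE.large'
  have hpos := hA.pos
  rw [Cmd.run, wp_wh, ← Cmd.run]
  simp [hA.sp, Cmd.step, hA.SB, hA.SN]
  refine ⟨by omega, fun _ => ⟨by omega, ?_, ?_⟩, by omega⟩
  · intro h0
    unfold Cmd.phase at h
    simp [h0] at h
    constructor
    · intro hK
      simp only [hK, if_true] at h
      refine h _ ⟨?_, ?_, ?_, ?_, ?_⟩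
      all_goals simp
      intro x h₁ h₂ h₃
      simp [h₁, h₂, h₃]
    · intro hK
      rw [if_neg (by omega)] at h
      refine h _ ⟨?_, ?_, ?_, ?_, ?_⟩
      all_goals simp
      intro x h₁ h₂ h₃
      simp [h₁, h₂, h₃]
  · intro h0
    unfold Cmd.phase at h
    refine ⟨by omega, fun h1 => ?_, fun h1 => ?_⟩
    · rw [if_neg (by omega), if_pos (by omega)] at h
      refine h _ ⟨?_, ?_, ?_, ?_, ?_⟩
      all_goals simp
      intro x h₁ h₂ h₃
      simp [h₁, h₂, h₃]
    · rw [if_neg (by omega), if_neg (by omega)] at h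
      refine h _ ⟨?_, ?_, ?_, ?_, ?_⟩
      all_goals simp
      intro x h₁ h₂ h₃
      simp [h₁, h₂, h₃]

theorem Input.of_eq {E : Env} {L L' : ℕ → ℕ} {b N : ℕ} (h : Input E L b N)
    (hL : ∀ i < b + N, L' i = L i) : Input E L' b N where
  incr i j hi hij hj := by
    rw [hL i (by omega), hL j hj]
    exact h.incr i j hi hij hj
  lt i hi hi' := by
    rw [hL i hi']
    exact h.lt i hi hi'

/-- A bound for the running time of a call for `N` elements. -/
def callTime (κ N : ℕ) : ℕ := 200 * ((κ + 1) * (N + 1))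

theorem callTime_leaf (κ N : ℕ) : 6 + (κ * (20 * N + 10) + 4 * N + 20) ≤ callTime κ N := by
  unfold callTime
  nlinarith [Nat.zero_le (κ * N)]

/-- The sizes of the two recursive calls add up to little more than `3 * N / 8`. Even with `M + 1`
and `m + 1` in place of `M` and `m`, at least `100 * (κ + 1) * N` of the budget is left for the
local work. -/
theorem callTime_step {κ N M m : ℕ} (hN : 64 < N) (hM : 8 * M ≤ N + 8) (hm : 4 * m ≤ N) :
    6 + ((30 * κ + 10) * N + 14 * N + 30) + callTime κ M +
      (6 + ((30 * κ + 30) * N + 13 * N + 40)) + callTime κ m + (6 + (11 * N + 20)) ≤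
      callTime κ N := by
  unfold callTime
  have h : 16 * (M + 1 + (m + 1)) + 8 * N ≤ 16 * (N + 1) := by omega
  have h' := Nat.mul_le_mul_left (κ + 1) h
  nlinarith [Nat.zero_le (κ * N)]

/-- The recursion is simulated by one loop with an explicit stack, so a call is not a command of its
own. It is specified by continuations: if the loop reaches `Q` from every state in which the call
may return or the run is abandoned, it does so from the start of the call. -/
theorem wp_call {E : Env} (hE : E.Valid) {q κ : ℕ} (hP : Params E q κ) {Q : HState → Prop}
    (N : ℕ) : ∀ (f b : ℕ) (σ : HState), Active E σ f b N → Input E (σ.arr .L) b N →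
      σ.arr .SP f = 0 → σ.reg .q = q → σ.reg .K = q * q →
      (∀ τ, Returned E f b N (callTime κ N) σ τ → wp E Cmd.run Q τ) →
      (∀ τ : HState, τ.reg .sp = 0 → τ.reg .fail = 1 → τ.reg .q = q → τ.reg .K = q * q →
        τ.reg .n = σ.reg .n → (∀ x, E.n ≤ x → τ.arr .F x = 0) → Obstruction E q →
        τ.time ≤ σ.time + callTime κ N → wp E Cmd.run Q τ) →
      wp E Cmd.run Q σ := by
  induction N using Nat.strong_induction_on with
  | _ N ih =>
    intro f b σ hA hI hSP hq hK hret habort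
    have h8 := hP.eight_le
    have hqq : 8 * q ≤ q * q := Nat.mul_le_mul_right q h8
    refine wp_run hE hA fun τ hτ => ?_
    have hAτ := hτ.active hA
    have hIτ : Input E (τ.arr .L) b N := by rw [hτ.arr]; exact hI
    have hKτ := hτ.keeps f b
    have hτt := hτ.time
    rw [hSP, hK, Cmd.phase, if_pos (by omega)]
    split_ifs with hlt
    swap
    · refine wp_leaf hE hAτ hIτ hτ.base hτ.N (le_trans (by omega) hP.sq_le)
        fun υ h1 h2 h3 h4 h5 h6 => hret υ ⟨hKτ.trans h1 le_rfl le_rfl, h2, h3, ?_, h5, ?_⟩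
      · rwa [hτ.arr] at h4
      · have := callTime_leaf κ N
        omega
    · refine wp_split hE hP hAτ hIτ hτ.base hτ.N (hKτ.q.trans hq) (hKτ.K.trans hK) hlt
        fun υ M k1 k2 k3 k4 k5 k6 k7 k8 k9 k10 k11 k12 k13 => ?_
      have hM : 8 * M ≤ N + 8 := by
        rcases Nat.eq_zero_or_pos M with rfl | hpos
        · omega
        · have := (k11 (M - 1)).1 (by omega)
          have := Nat.mul_le_mul_left (M - 1) h8
          omega
      have hKυ := hKτ.trans k1 le_rfl le_rfl
      refine ih M (by omega) (f + 1) (b + N) υ k7 k8 k9 (hKυ.q.trans hq) (hKυ.K.trans hK) ?_ ?_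
      swap
      · intro φ l1 l2 l3 l4 l5 l6 l7 l8
        refine habort φ l1 l2 l3 l4 (l5.trans hKυ.n) l6 l7 ?_
        have := callTime_step (κ := κ) (m := 0) (show 64 < N by omega) hM (by omega)
        omega
      intro φ hφ
      have hKφ := hKυ.trans hφ.keeps (Nat.le_succ f) (Nat.le_add_right b N)
      have lSB := hφ.keeps.SB f (by omega)
      have lSN := hφ.keeps.SN f (by omega)
      have lSP := hφ.keeps.SP f (by omega)
      have lSG := hφ.keeps.SG f (by omega)
      have hLφ : ∀ i < b + N, φ.arr .L i = σ.arr .L i := fun i hi => by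
        rw [hφ.keeps.L i hi, k2 i hi, hτ.arr]
      have hAφ : Active E φ f b N :=
        ⟨hφ.sp, lSB.trans k3, lSN.trans k4, hA.pos, hA.le, hA.fits, hφ.F⟩
      refine wp_run hE hAφ fun ψ hψ => ?_
      rw [lSP, k5, Cmd.phase, if_neg (by omega), if_pos (by omega)]
      have hKψ := hKφ.trans (hψ.keeps f b) le_rfl le_rfl
      have hIψ : Input E (ψ.arr .L) b N := by
        rw [hψ.arr]
        exact hI.of_eq hLφ
      have hXφ : ∀ i < b + N, φ.arr .X i = υ.arr .X i := hφ.keeps.X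
      -- The call for the samples has touched `L` and `X` only from `b + N` on, so the sorted blocks
      -- are intact.
      have hblψ : Blocks E (ψ.arr .L) (ψ.arr .X) b N q := by
        rw [hψ.arr]
        have e : ∀ lo m, lo + m ≤ b + N → seg (φ.arr .X) lo m = seg (υ.arr .X) lo m :=
          fun lo m h => seg_congr fun i _ hi => hXφ i (by omega)
        have e' : ∀ lo m, lo + m ≤ b + N → seg (φ.arr .L) lo m = seg (τ.arr .L) lo m :=
          fun lo m h => seg_congr fun i _ hi => by rw [hLφ i (by omega), hτ.arr]
        have hI' := hI.of_eq hLφ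
        refine ⟨by omega, hI'.incr, hI'.lt, ?_, fun k => ?_, fun k => ?_⟩
        · rw [e _ _ le_rfl, e' _ _ le_rfl]
          exact k10.perm
        · by_cases hk : k * (q * q) ≤ N
          · rw [e _ _ (by omega), e' _ _ (by omega)]
            exact k10.block_perm k
          · rw [show N - k * (q * q) = 0 by omega]
            simp
        · by_cases hk : k * (q * q) ≤ N
          · rw [e _ _ (by omega)]
            exact k10.sorted k
          · rw [show N - k * (q * q) = 0 by omega]
            simp
      refine wp_distribute hE hP (M := M) (hψ.active hAφ) hIψ hψ.base hψ.N (hKψ.q.trans hq)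
        (hKψ.K.trans hK) (by rw [hψ.arr, lSG, k6]) hlt hblψ k11 ?_ (by rw [hψ.arr]; exact hφ.sorted)
        ?_ ?_
      · rw [hψ.arr]
        refine hφ.perm.trans (k12.trans (List.Perm.of_eq (List.map_congr_left fun g hg => ?_)))
        rw [List.mem_range, k11] at hg
        exact (hXφ _ (by omega)).symm
      swap
      · intro χ l1 l2 l3 l4 l5 l6 l7 l8
        refine habort χ l1 l2 (l3.trans (hKψ.q.trans hq)) (l4.trans (hKψ.K.trans hK))
          (l5.trans hKψ.n) l6 l7 ?_
        have := callTime_step (κ := κ) (m := 0) (show 64 < N by omega) hM (by omega)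
        have := hψ.time
        have := hφ.time
        omega
      intro χ g m l1 l2 l3 l4 l5 l6 l7 l8 l9 l10 l11 l12 l13 l14
      have hKχ := hKψ.trans l1 le_rfl le_rfl
      refine ih m (by omega) (f + 1) (b + N) χ l7 l8 l9 (hKχ.q.trans hq) (hKχ.K.trans hK) ?_ ?_
      swap
      · intro ω m1 m2 m3 m4 m5 m6 m7 m8
        refine habort ω m1 m2 m3 m4 (m5.trans hKχ.n) m6 m7 ?_
        have := callTime_step (κ := κ) (show 64 < N by omega) hM l11
        have := hψ.time
        have := hφ.time
        omega
      intro ω hω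
      have hKω := hKχ.trans hω.keeps (Nat.le_succ f) (Nat.le_add_right b N)
      have mSB := hω.keeps.SB f (by omega)
      have mSN := hω.keeps.SN f (by omega)
      have mSP := hω.keeps.SP f (by omega)
      have mSG := hω.keeps.SG f (by omega)
      have hAω : Active E ω f b N :=
        ⟨hω.sp, mSB.trans l3, mSN.trans l4, hA.pos, hA.le, hA.fits, hω.F⟩
      refine wp_run hE hAω fun σ' hσ' => ?_
      rw [mSP, l5, Cmd.phase, if_neg (by omega), if_neg (by omega)]
      have eZ : seg (ω.arr .Z) b g = seg (χ.arr .Z) b g :=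
        seg_congr fun i _ hi => hω.keeps.Z i (by omega)
      have eL : seg (ψ.arr .L) b N = seg (σ.arr .L) b N := by
        rw [hψ.arr]
        exact seg_congr fun i _ hi => hLφ i hi
      rw [eL] at l13
      refine wp_join hE (g := g) (hσ'.active hAω) hσ'.base hσ'.N (by rw [hσ'.arr, mSG, l6])
        (by omega) (l := seg (σ.arr .L) b N) ?_ ?_ ?_ ?_ ?_
      · intro x hx
        obtain ⟨i, h₁, h₂, rfl⟩ := mem_seg.1 hx
        exact hI.lt i h₁ h₂
      · rw [hσ'.arr, show N - g = m by omega, eZ]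
        exact (List.Perm.append_left _ hω.perm).trans l13
      · rw [hσ'.arr, eZ]
        exact l12
      · rw [hσ'.arr, show N - g = m by omega]
        exact hω.sorted
      · intro τ' n1 n2 n3 n4 n5 n6
        refine hret τ' ⟨(hKω.trans (hσ'.keeps f b) le_rfl le_rfl).trans n1 le_rfl le_rfl, n2, n3,
          n4, n5, ?_⟩
        have := callTime_step (κ := κ) (show 64 < N by omega) hM l11
        have := hψ.time
        have := hφ.time
        have := hω.time
        have := hσ'.time
        omega

/-! ### The main program -/

namespace Cmd

/-- Store the list of all positions, from index `v` on, and remove all flags. -/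
def initList : Cmd :=
  .wh (.r .v) (.r .n)
    (.seq (.st .L (.r .v) (.r .v))
    (.seq (.st .F (.r .v) (.c 0))
    (.set .v (.add (.r .v) (.c 1)))))

/-- Try to sort the input with the current numbers `q` and `K`. -/
def attempt : Cmd :=
  .seq (.set .v (.c 0))
  (.seq initList
  (.seq (.set .sp (.c 1))
  (.seq (.st .SB (.c 1) (.c 0))
  (.seq (.st .SN (.c 1) (.r .n))
  (.seq (.st .SP (.c 1) (.c 0))
  (.seq (.set .fail (.c 0))
  run))))))

/-- Try to sort the input with larger and larger numbers `q` and `K`. -/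
def attempts : Cmd :=
  .wh (.c 0) (.r .fail)
    (.seq attempt
      (.ite (.c 0) (.r .fail)
        (.seq (.set .q (.r .K)) (.set .K (.mul (.r .K) (.r .K))))
        .skip))

/-- The sorting program. -/
def main : Cmd :=
  .seq (.set .q (.c 8)) (.seq (.set .K (.c 64)) (.seq (.set .fail (.c 1)) attempts))

end Cmd

/-- An abandoned run may have left flags on input positions; the cells beyond them are clean by
hypothesis, so all flags are clear afterwards. -/
theorem wp_initList_core {E : Env} (hE : E.Valid) (len : ℕ) :
    ∀ σ : HState, σ.reg .n = E.n → E.n - σ.reg .v = len → σ.reg .v ≤ E.n →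
      (∀ x, E.n ≤ x ∨ x < σ.reg .v → σ.arr .F x = 0) → (∀ x < σ.reg .v, σ.arr .L x = x) →
      wp E Cmd.initList (fun τ => (∀ x, τ.arr .F x = 0) ∧ (∀ x < E.n, τ.arr .L x = x) ∧
        τ.time ≤ σ.time + 4 * len + 1) σ := by
  have hB := hE.large'
  induction len with
  | zero =>
    intro σ hn hlen hv hF hL
    rw [Cmd.initList, wp_wh]
    simp [hn]
    refine ⟨fun h => by omega, fun h => ⟨fun x => hF x (by omega), fun x hx => hL x (by omega)⟩⟩
  | succ len ih =>
    intro σ hn hlen hv hF hL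
    rw [Cmd.initList, wp_wh, ← Cmd.initList]
    simp [hn]
    refine ⟨fun h => ⟨by omega, by omega, (ih _ ?_ ?_ ?_ ?_ ?_).mono ?_⟩, fun h => by omega⟩
    all_goals simp
    · exact hn
    · omega
    · omega
    · intro x hx
      rw [Function.update_apply]
      split_ifs with h'
      · rfl
      · exact hF x (by omega)
    · intro x hx
      rw [Function.update_apply]
      split_ifs with h'
      · exact h'.symm
      · exact hL x (by omega)
    · exact fun τ h₁ h₂ h₃ => ⟨h₁, h₂, by omega⟩

/-- The output of the sorting program. -/
structure Sorted (E : Env) (τ : HState) : Prop where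
  perm : (seg (τ.arr .X) 0 E.n).Perm (List.range E.n)
  sorted : (seg (τ.arr .X) 0 E.n).Pairwise E.r

theorem wp_attempt {E : Env} (hE : E.Valid) {q κ : ℕ} (hP : Params E q κ) {σ : HState}
    {Q : HState → Prop} (hn : σ.reg .n = E.n) (hq : σ.reg .q = q) (hK : σ.reg .K = q * q)
    (hF : ∀ x, E.n ≤ x → σ.arr .F x = 0)
    (hret : ∀ τ, Sorted E τ → τ.reg .fail = 0 →
      τ.time ≤ σ.time + 400 * (κ + 1) * (E.n + 1) → Q τ)
    (habort : ∀ τ : HState, τ.reg .fail = 1 → τ.reg .n = E.n → τ.reg .q = q →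
      τ.reg .K = q * q → (∀ x, E.n ≤ x → τ.arr .F x = 0) →
      Obstruction E q → τ.time ≤ σ.time + 400 * (κ + 1) * (E.n + 1) → Q τ) :
    wp E Cmd.attempt Q σ := by
  have hB := hE.large'
  have htime : callTime κ E.n + 4 * E.n + 20 ≤ 400 * (κ + 1) * (E.n + 1) := by
    unfold callTime
    nlinarith [Nat.zero_le (κ * E.n)]
  simp [Cmd.attempt]
  refine ⟨by omega, ?_⟩
  refine (wp_initList_core hE E.n _ ?_ ?_ ?_ ?_ ?_).frame ?_
  all_goals simp
  · exact hn
  · exact hF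
  intro τ h1 h2 h3 hfr
  have hr : ∀ x, x ≠ Reg.v → τ.reg x = σ.reg x := by
    intro x hx
    rw [hfr.reg x (by simp [Cmd.initList, Cmd.modR, hx])]
    simp [hx]
  refine ⟨by omega, by omega, by omega, by omega, ?_⟩
  refine wp_call hE hP E.n 1 0 _ ⟨?_, ?_, ?_, ?_, ?_, ?_, ?_⟩ ⟨?_, ?_⟩ ?_ ?_ ?_ ?_ ?_
  all_goals try simp [hr, hn, hq, hK]
  · omega
  · exact h1
  · intro i j h₁ h₂
    rw [h2 i (by omega), h2 j h₂]
    exact h₁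
  · intro i hi
    rwa [h2 i hi]
  · intro υ hυ
    have k1 := hυ.perm
    have k2 := hυ.time
    have k3 := hυ.keeps.fail
    have k4 := hυ.sp
    simp at k1 k2 k3 k4
    rw [Cmd.run, wp_wh]
    simp [k4]
    refine ⟨by omega, hret _ ⟨?_, hυ.sorted⟩ k3 ?_⟩
    · refine k1.trans (List.Perm.of_eq ?_)
      refine seg_eq_of_forall (by simp) fun i hi => ?_
      simp at hi ⊢
      exact h2 i (by omega)
    · simp
      omega
  · intro υ k1 k2 k3 k4 k5 k6 k7 k8
    rw [Cmd.run, wp_wh]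
    simp [k1]
    refine ⟨by omega, habort _ k2 k5 k3 k4 k6 k7 ?_⟩
    simp
    omega

/-- All attempts before the one with `q * q = 2 ^ κ` may fail. -/
def Reached (E : Env) (κ : ℕ) : Prop := κ = 6 ∨ ∃ q, Obstruction E q ∧ q ^ 4 = 2 ^ κ

/-- The state after a successful run of the sorting program that was started at time `t`. -/
structure Done (E : Env) (t : ℕ) (τ : HState) : Prop where
  sorted : Sorted E τ
  time : ∃ κ, Reached E κ ∧ τ.time ≤ t + 2000 * κ * (E.n + 1)

/-- Squaring `q` doubles `κ`. If everything before the current round took at most `1000 * κ * (E.n +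
1)` steps and the round takes no more than that again, the bound is restored for `2 * κ`. Rounds end
because `q` increases but stays bounded. -/
theorem wp_attempts {E : Env} (hE : E.Valid) {t : ℕ} (d : ℕ) :
    ∀ (q κ : ℕ) (σ : HState), 4 * E.n + 64 - q = d → Params E q κ → q * q = 2 ^ κ → 6 ≤ κ →
      Reached E κ →
      σ.reg .n = E.n → σ.reg .q = q → σ.reg .K = q * q → σ.reg .fail = 1 →
      (∀ x, E.n ≤ x → σ.arr .F x = 0) →
      σ.time ≤ t + 1000 * κ * (E.n + 1) →
      wp E Cmd.attempts (Done E t) σ := by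
  have hB := hE.large'
  have hBB := hE.large
  induction d using Nat.strong_induction_on with
  | _ d ih =>
    intro q κ σ hd hP hqκ hκ hO hn hq hK hf hF ht
    have htime : 400 * (κ + 1) * (E.n + 1) + 10 ≤ 1000 * κ * (E.n + 1) := by
      have h : 400 * (κ + 1) + 10 ≤ 1000 * κ := by omega
      nlinarith
    have e₁ : 2000 * κ * (E.n + 1) = 1000 * κ * (E.n + 1) + 1000 * κ * (E.n + 1) := by ring
    rw [Cmd.attempts, wp_wh, ← Cmd.attempts]
    simp [hf]
    refine ⟨by omega, wp_attempt hE hP ?_ ?_ ?_ ?_ ?_ ?_⟩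
    all_goals simp [hn, hq, hK]
    · exact hF
    · intro τ h1 h2 h3
      simp [h2]
      refine ⟨by omega, ?_⟩
      rw [Cmd.attempts, wp_wh]
      simp [h2]
      refine ⟨by omega, ⟨h1.perm, h1.sorted⟩, κ, hO, by simp; omega⟩
    · intro τ h1 h2 h3 h4 h5 h6 h7
      obtain ⟨N, M, p, st, g1, g2, g3⟩ := h6
      have h8 := hP.eight_le
      have hqq : 8 * q ≤ q * q := Nat.mul_le_mul_right q h8
      -- An obstruction needs a list longer than `q * q`, and lists have at most `2 * E.n` elements.
      -- This keeps the next `q` below the bound of the measure `d` and the next `K` within a word.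
      have hsq : q * q * (q * q) ≤ 4 * (E.n + 1) ^ 2 := by
        have : q * q ≤ 2 * (E.n + 1) := by omega
        calc q * q * (q * q) ≤ (2 * (E.n + 1)) * (2 * (E.n + 1)) := Nat.mul_le_mul this this
          _ = 4 * (E.n + 1) ^ 2 := by ring
      simp [h1, h4]
      refine ⟨by omega, by omega, ?_⟩
      have e₂ : 2 ^ (2 * κ) = q * q * (q * q) := by
        rw [hqκ, ← pow_add, two_mul]
      refine ih (4 * E.n + 64 - q * q) (by omega) (q * q) (2 * κ) _ rfl ?_ e₂.symm
        (by omega) (.inr ⟨q, ⟨N, M, p, st, g1, g2, g3⟩, by rw [e₂]; ring⟩) ?_ ?_ ?_ ?_ ?_ ?_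
      · exact ⟨by omega, e₂.ge, by omega, by omega⟩
      all_goals simp [h1, h2]
      · exact h5
      · have : 1000 * (2 * κ) * (E.n + 1) = 2000 * κ * (E.n + 1) := by ring
        omega

theorem wp_main {E : Env} (hE : E.Valid) {σ : HState} (hn : σ.reg .n = E.n)
    (hF : ∀ x, E.n ≤ x → σ.arr .F x = 0) :
    wp E Cmd.main (Done E (σ.time + 3)) σ := by
  have hB := hE.large'
  simp [Cmd.main]
  refine ⟨by omega, by omega, by omega, wp_attempts hE _ 8 6 _ rfl ⟨by norm_num, by norm_num,
    by omega, by nlinarith⟩ (by norm_num) le_rfl (.inl rfl) ?_ ?_ ?_ ?_ ?_ ?_⟩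
  all_goals simp
  · exact hn
  · exact hF

/-! ### Sets of matrix entries that avoid a permutation -/

/-- The finite set of matrix entries contains the permutation. -/
def Hits {k : ℕ} (π : Equiv.Perm (Fin k)) (A : Finset (ℕ × ℕ)) : Prop :=
  ∃ f g : Fin k → ℕ, StrictMono f ∧ StrictMono g ∧ ∀ i, (f i, g (π i)) ∈ A

section ExNum

variable {k : ℕ} {π : Equiv.Perm (Fin k)}

theorem card_le_exNum {n : ℕ} {A : Finset (ℕ × ℕ)} (hA : ∀ x ∈ A, x.1 < n ∧ x.2 < n)
    (h : ¬ Hits π A) : A.card ≤ exNum π n := by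
  classical
  set M : Matrix (Fin n) (Fin n) Bool := fun i j => decide (((i : ℕ), (j : ℕ)) ∈ A) with hM
  have h₁ : ¬ MatContains M (patternMatrix π) := by
    rintro ⟨f, g, hfg⟩
    refine h ⟨fun i => f i, fun j => g j, fun i j hij => f.strictMono hij,
      fun i j hij => g.strictMono hij, fun i => ?_⟩
    simpa [hM] using hfg i (π i) (by simp [patternMatrix])
  have h₂ : A.card ≤ numOnes M := by
    refine Finset.card_le_card_of_surjOn (fun p => ((p.1 : ℕ), (p.2 : ℕ))) ?_
    intro x hx
    obtain ⟨h₁, h₂⟩ := hA x hx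
    exact ⟨(⟨x.1, h₁⟩, ⟨x.2, h₂⟩), by simpa [hM] using hx, rfl⟩
  exact h₂.trans (Finset.le_sup (f := numOnes) (by simpa using h₁))

/-- For `k > 0` the empty set hits nothing, so `k = 0`; the empty pattern is contained in every
matrix and the supremum is over the empty set. -/
theorem exNum_eq_zero (h : ∀ A, Hits π A) (n : ℕ) : exNum π n = 0 := by
  classical
  by_contra hne
  unfold exNum at hne
  obtain ⟨M, hM, -⟩ := (Finset.lt_sup_iff (a := 0)).1 (Nat.pos_of_ne_zero hne)
  have hk : k = 0 := by
    by_contra hk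
    obtain ⟨f, g, -, -, hfg⟩ := h ∅
    exact absurd (hfg ⟨0, Nat.pos_of_ne_zero hk⟩) (by simp)
  subst hk
  refine (Finset.mem_filter.1 hM).2 ⟨⟨⟨finZeroElim, fun a => a.elim0⟩, fun {a} => a.elim0⟩,
    ⟨⟨finZeroElim, fun a => a.elim0⟩, fun {a} => a.elim0⟩, fun i => i.elim0⟩

/-- The hypothesis makes the zero matrix avoid `π`, so the supremum is attained. -/
theorem exists_card_eq_exNum (h : ¬ Hits π ∅) (n : ℕ) :
    ∃ A : Finset (ℕ × ℕ), (∀ x ∈ A, x.1 < n ∧ x.2 < n) ∧ ¬ Hits π A ∧ A.card = exNum π n := by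
  classical
  have hne : (Finset.univ.filter fun M : Matrix (Fin n) (Fin n) Bool =>
      ¬ MatContains M (patternMatrix π)).Nonempty := by
    refine ⟨Matrix.of fun _ _ => false, Finset.mem_filter.2 ⟨Finset.mem_univ _, ?_⟩⟩
    rintro ⟨f, g, hfg⟩
    refine h ⟨fun i => f i, fun j => g j, fun i j hij => f.strictMono hij,
      fun i j hij => g.strictMono hij, fun i => ?_⟩
    exact absurd (hfg i (π i) (by simp [patternMatrix])) (by simp)
  obtain ⟨M, hM, he⟩ := Finset.exists_mem_eq_sup _ hne numOnes
  refine ⟨(Finset.univ.filter fun p : Fin n × Fin n => M p.1 p.2 = true).map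
    ⟨fun p => ((p.1 : ℕ), (p.2 : ℕ)), ?_⟩, ?_, ?_, ?_⟩
  · rintro ⟨a, b⟩ ⟨c, d⟩ h
    simp only [Prod.mk.injEq] at h
    exact Prod.ext (Fin.ext h.1) (Fin.ext h.2)
  · intro x hx
    obtain ⟨p, -, rfl⟩ := Finset.mem_map.1 hx
    exact ⟨p.1.2, p.2.2⟩
  · rintro ⟨f, g, hf, hg, hfg⟩
    refine (Finset.mem_filter.1 hM).2 ?_
    have h₁ : ∀ i, f i < n ∧ g (π i) < n := by
      intro i
      obtain ⟨p, -, hp⟩ := Finset.mem_map.1 (hfg i)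
      replace hp := Prod.mk.inj hp
      rw [← hp.1, ← hp.2]
      exact ⟨p.1.2, p.2.2⟩
    have h₂ : ∀ j, g j < n := fun j => by simpa using (h₁ (π.symm j)).2
    refine ⟨OrderEmbedding.ofStrictMono (fun i => ⟨f i, (h₁ i).1⟩)
      fun i j hij => show f i < f j from hf hij, OrderEmbedding.ofStrictMono (fun i => ⟨g i, h₂ i⟩)
      fun i j hij => show g i < g j from hg hij, fun i j hij => ?_⟩
    obtain ⟨p, hp, hpe⟩ := Finset.mem_map.1 (hfg i)
    replace hpe := Prod.mk.inj hpe
    have hj : j = π i := by simpa [patternMatrix] using hij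
    subst hj
    have hp' := (Finset.mem_filter.1 hp).2
    rw [show p.1 = ⟨f i, (h₁ i).1⟩ from Fin.ext hpe.1,
      show p.2 = ⟨g (π i), h₂ _⟩ from Fin.ext hpe.2] at hp'
    exact hp'
  · rw [Finset.card_map]
    exact he.symm

theorem not_hits_empty (hk : 0 < k) : ¬ Hits π ∅ := by
  rintro ⟨f, g, -, -, h⟩
  exact absurd (h ⟨0, hk⟩) (by simp)

theorem hits_of_eq_zero (hk : k = 0) (A : Finset (ℕ × ℕ)) : Hits π A := by
  subst hk
  exact ⟨finZeroElim, finZeroElim, fun a => a.elim0, fun a => a.elim0, fun i => i.elim0⟩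

/-! ### Superadditivity of the extremal function -/

/-- Two sets of entries whose rows and columns are separated. -/
theorem not_hits_union (hk : 0 < k) {A B : Finset (ℕ × ℕ)} (hA : ¬ Hits π A) (hB : ¬ Hits π B)
    {m : ℕ} (hAm : ∀ x ∈ A, x.1 < m) (hBm : ∀ x ∈ B, m ≤ x.1)
    (h : (∃ c, (∀ x ∈ A, x.2 < c) ∧ ∀ x ∈ B, c ≤ x.2) ∧ π ⟨k - 1, by omega⟩ ≤ π ⟨0, hk⟩ ∨
      (∃ c, (∀ x ∈ A, c ≤ x.2) ∧ ∀ x ∈ B, x.2 < c) ∧ π ⟨0, hk⟩ ≤ π ⟨k - 1, by omega⟩) :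
    ¬ Hits π (A ∪ B) := by
  classical
  rintro ⟨f, g, hf, hg, hfg⟩
  -- An occurrence with its last row in the rows of `A` lies in `A`, one with its first row in those
  -- of `B` lies in `B`. Otherwise it starts in `A` and ends in `B`, and the columns of these two
  -- entries are in the wrong order.
  by_cases h₁ : f ⟨k - 1, by omega⟩ < m
  · refine hA ⟨f, g, hf, hg, fun i => ?_⟩
    have h₂ : f i ≤ f ⟨k - 1, by omega⟩ := hf.monotone (by
      rw [Fin.le_def]
      have := i.2
      simp only
      omega)
    rcases Finset.mem_union.1 (hfg i) with h | h
    · exact h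
    · have := hBm _ h
      simp only at this
      omega
  by_cases h₀ : f ⟨0, hk⟩ < m
  swap
  · refine hB ⟨f, g, hf, hg, fun i => ?_⟩
    have h₂ : f ⟨0, hk⟩ ≤ f i := hf.monotone (by simp [Fin.le_def])
    rcases Finset.mem_union.1 (hfg i) with h | h
    · have := hAm _ h
      simp only at this
      omega
    · exact h
  have k₁ : (f ⟨0, hk⟩, g (π ⟨0, hk⟩)) ∈ A := by
    rcases Finset.mem_union.1 (hfg ⟨0, hk⟩) with h | h
    · exact h
    · have := hBm _ h
      simp only at this
      omega
  have k₂ : (f ⟨k - 1, by omega⟩, g (π ⟨k - 1, by omega⟩)) ∈ B := by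
    rcases Finset.mem_union.1 (hfg ⟨k - 1, by omega⟩) with h | h
    · have := hAm _ h
      simp only at this
      omega
    · exact h
  rcases h with ⟨⟨c, h₂, h₃⟩, h₄⟩ | ⟨⟨c, h₂, h₃⟩, h₄⟩
  · have := h₂ _ k₁
    have := h₃ _ k₂
    have := hg.monotone h₄
    simp only at *
    omega
  · have := h₂ _ k₁
    have := h₃ _ k₂
    have := hg.monotone h₄
    simp only at *
    omega

theorem not_hits_image {A : Finset (ℕ × ℕ)} (hA : ¬ Hits π A) (a b : ℕ) :
    ¬ Hits π (A.image fun x => (x.1 + a, x.2 + b)) := by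
  classical
  rintro ⟨f, g, hf, hg, hfg⟩
  have key : ∀ i, a ≤ f i ∧ b ≤ g (π i) ∧ (f i - a, g (π i) - b) ∈ A := by
    intro i
    obtain ⟨x, hx, he⟩ := Finset.mem_image.1 (hfg i)
    simp only [Prod.mk.injEq] at he
    refine ⟨by omega, by omega, ?_⟩
    rw [← he.1, ← he.2]
    simpa using hx
  refine hA ⟨fun i => f i - a, fun j => g j - b, fun i j hij => ?_, fun i j hij => ?_,
    fun i => (key i).2.2⟩
  · have := hf hij
    have := (key i).1
    simp only
    omega
  · have := hg hij
    have := (key (π.symm i)).2.1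
    simp only [Equiv.apply_symm_apply] at this ⊢
    omega

theorem card_image_shift (A : Finset (ℕ × ℕ)) (a b : ℕ) :
    (A.image fun x => (x.1 + a, x.2 + b)).card = A.card := by
  classical
  refine Finset.card_image_of_injective _ fun x y h => ?_
  simp only [Prod.mk.injEq] at h
  exact Prod.ext (by omega) (by omega)

/-- Two extremal matrices are put as diagonal blocks if the last value of `π` is below the first,
and as antidiagonal blocks if it is above; in this way no occurrence of `π` meets both. -/
theorem exNum_superadditive (m n : ℕ) : exNum π m + exNum π n ≤ exNum π (m + n) := by
  classical
  rcases Nat.eq_zero_or_pos k with hk | hk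
  · simp [exNum_eq_zero (π := π) (hits_of_eq_zero hk)]
  obtain ⟨A, hA, hA', hAc⟩ := exists_card_eq_exNum (not_hits_empty (π := π) hk) m
  obtain ⟨B, hB, hB', hBc⟩ := exists_card_eq_exNum (not_hits_empty (π := π) hk) n
  have main : ∀ a b : ℕ, a ≤ n → b ≤ m →
      ¬ Hits π (A.image (fun x => (x.1 + 0, x.2 + a)) ∪ B.image (fun x => (x.1 + m, x.2 + b))) →
      exNum π m + exNum π n ≤ exNum π (m + n) := by
    intro a b ha hb h
    rw [← hAc, ← hBc, ← card_image_shift A 0 a, ← card_image_shift B m b,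
      ← Finset.card_union_of_disjoint]
    · refine card_le_exNum (fun x hx => ?_) h
      rcases Finset.mem_union.1 hx with hx | hx
      · obtain ⟨y, hy, rfl⟩ := Finset.mem_image.1 hx
        have := hA y hy
        simp only
        omega
      · obtain ⟨y, hy, rfl⟩ := Finset.mem_image.1 hx
        have := hB y hy
        simp only
        omega
    · rw [Finset.disjoint_left]
      intro x hx hx'
      obtain ⟨y, hy, rfl⟩ := Finset.mem_image.1 hx
      obtain ⟨z, hz, he⟩ := Finset.mem_image.1 hx'
      have := hA y hy
      simp only [Prod.mk.injEq] at he
      omega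
  have hrow : ∀ a, ∀ x ∈ A.image (fun x => (x.1 + 0, x.2 + a)), x.1 < m := by
    intro a x hx
    obtain ⟨y, hy, rfl⟩ := Finset.mem_image.1 hx
    have := hA y hy
    simp only
    omega
  have hrow' : ∀ b, ∀ x ∈ B.image (fun x => (x.1 + m, x.2 + b)), m ≤ x.1 := by
    intro b x hx
    obtain ⟨y, hy, rfl⟩ := Finset.mem_image.1 hx
    simp
  rcases le_total (π ⟨k - 1, by omega⟩) (π ⟨0, hk⟩) with h | h
  · refine main 0 m (by omega) le_rfl (not_hits_union hk (not_hits_image hA' _ _)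
      (not_hits_image hB' _ _) (hrow _) (hrow' _) (.inl ⟨⟨m, ?_, ?_⟩, h⟩))
    · intro x hx
      obtain ⟨y, hy, rfl⟩ := Finset.mem_image.1 hx
      exact (hA y hy).2
    · intro x hx
      obtain ⟨y, hy, rfl⟩ := Finset.mem_image.1 hx
      simp
  · refine main n 0 le_rfl (by omega) (not_hits_union hk (not_hits_image hA' _ _)
      (not_hits_image hB' _ _) (hrow _) (hrow' _) (.inr ⟨⟨n, ?_, ?_⟩, h⟩))
    · intro x hx
      obtain ⟨y, hy, rfl⟩ := Finset.mem_image.1 hx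
      simp
    · intro x hx
      obtain ⟨y, hy, rfl⟩ := Finset.mem_image.1 hx
      exact (hB y hy).2

end ExNum

/-! ### The theorem of Marcus and Tardos -/

/-- Transposition reduces blocks with many nonempty rows to blocks with many nonempty columns. -/
theorem hits_swap {k : ℕ} {π : Equiv.Perm (Fin k)} {A : Finset (ℕ × ℕ)}
    (h : Hits π⁻¹ (A.image Prod.swap)) : Hits π A := by
  obtain ⟨f, g, hf, hg, hfg⟩ := h
  refine ⟨g, f, hg, hf, fun i => ?_⟩
  have := hfg (π i)
  simpa using this

/-- The block of a matrix entry. -/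
def blockOf (s : ℕ) (x : ℕ × ℕ) : ℕ × ℕ := (x.1 / s, x.2 / s)

/-- The entries in a block. -/
def inBlock (s : ℕ) (A : Finset (ℕ × ℕ)) (p : ℕ × ℕ) : Finset (ℕ × ℕ) :=
  A.filter fun x => blockOf s x = p

theorem mem_inBlock {s : ℕ} {A : Finset (ℕ × ℕ)} {p x : ℕ × ℕ} :
    x ∈ inBlock s A p ↔ x ∈ A ∧ blockOf s x = p := Finset.mem_filter

section MarcusTardos

variable {k : ℕ} {π : Equiv.Perm (Fin k)} {A : Finset (ℕ × ℕ)} {s : ℕ}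

theorem lt_of_div_lt {a b s : ℕ} (h : a / s < b / s) : a < b := by
  by_contra hcon
  exact absurd (Nat.div_le_div_right (c := s) (not_lt.1 hcon)) (not_le.2 h)

/-- An occurrence among the blocks uses each block row and block column once, so any choice of one
entry per block is an occurrence in `A`. -/
theorem not_hits_blocks (h : ¬ Hits π A) : ¬ Hits π (A.image (blockOf s)) := by
  rintro ⟨f, g, hf, hg, hfg⟩
  have : ∀ i, ∃ x ∈ A, x.1 / s = f i ∧ x.2 / s = g (π i) := by
    intro i
    obtain ⟨x, hx, he⟩ := Finset.mem_image.1 (hfg i)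
    simp only [blockOf, Prod.mk.injEq] at he
    exact ⟨x, hx, he.1, he.2⟩
  choose x hx hx₁ hx₂ using this
  refine h ⟨fun i => (x i).1, fun j => (x (π.symm j)).2, fun i j hij => ?_, fun i j hij => ?_,
    fun i => by simpa using hx i⟩
  · refine lt_of_div_lt (s := s) ?_
    rw [hx₁, hx₁]
    exact hf hij
  · refine lt_of_div_lt (s := s) ?_
    rw [hx₂, hx₂]
    simpa using hg hij

/-- The blocks with entries in at least `k` columns. -/
def wideBlocks (k s : ℕ) (A : Finset (ℕ × ℕ)) : Finset (ℕ × ℕ) :=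
  (A.image (blockOf s)).filter fun p => k ≤ ((inBlock s A p).image Prod.snd).card

/-- Pigeonhole: with more blocks in one block column, more than `k` of them would have entries in
the same `k` columns `U`. Taking from the `i`-th of these blocks an entry in the `π i`-th column of
`U` gives an occurrence of `π`. -/
theorem card_wideBlocks_column (hs : 0 < s) (h : ¬ Hits π A) (b : ℕ) :
    ((wideBlocks k s A).filter fun p => p.2 = b).card ≤ k * s.choose k := by
  classical
  by_contra hcon
  have hsub : ∀ p ∈ wideBlocks k s A, ∃ T ⊆ (inBlock s A p).image Prod.snd, T.card = k :=
    fun p hp => Finset.exists_subset_card_eq (Finset.mem_filter.1 hp).2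
  choose! T hT hTc using hsub
  have hmaps : ∀ p ∈ (wideBlocks k s A).filter (fun p => p.2 = b),
      T p ∈ (Finset.Ico (b * s) (b * s + s)).powersetCard k := by
    intro p hp
    rw [Finset.mem_filter] at hp
    rw [Finset.mem_powersetCard]
    refine ⟨fun c hc => ?_, hTc p hp.1⟩
    obtain ⟨x, hx, rfl⟩ := Finset.mem_image.1 (hT p hp.1 hc)
    have := (Finset.mem_filter.1 hx).2
    have he : x.2 / s = b := by rw [← hp.2, ← this]; rfl
    rw [Finset.mem_Ico, ← he]
    exact ⟨Nat.div_mul_le_self _ _, Nat.lt_div_mul_add hs⟩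
  have hcard : ((Finset.Ico (b * s) (b * s + s)).powersetCard k).card * k <
      ((wideBlocks k s A).filter fun p => p.2 = b).card := by
    rw [Finset.card_powersetCard, Nat.card_Ico, Nat.add_sub_cancel_left, mul_comm]
    omega
  obtain ⟨U, hU, hUc⟩ := Finset.exists_lt_card_fiber_of_mul_lt_card_of_maps_to hmaps hcard
  rw [Finset.mem_powersetCard] at hU
  set R := (((wideBlocks k s A).filter fun p => p.2 = b).filter fun p => T p = U).image Prod.fst
    with hR
  have hRc : k ≤ R.card := by
    rw [hR, Finset.card_image_of_injOn]
    · exact hUc.le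
    · intro p hp p' hp' he
      simp only [Finset.coe_filter, Finset.mem_filter, Set.mem_ofPred_eq] at hp hp'
      exact Prod.ext he (hp.1.2.trans hp'.1.2.symm)
  have key : ∀ i : Fin k, ∃ x ∈ A, x.1 / s = R.orderEmbOfCardLe hRc i ∧
      x.2 = U.orderEmbOfFin hU.2 (π i) := by
    intro i
    obtain ⟨p, hp, hpe⟩ := Finset.mem_image.1 (R.orderEmbOfCardLe_mem hRc i)
    simp only [Finset.mem_filter] at hp
    have hmem : U.orderEmbOfFin hU.2 (π i) ∈ T p := by
      rw [hp.2]
      exact U.orderEmbOfFin_mem hU.2 (π i)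
    obtain ⟨x, hx, he⟩ := Finset.mem_image.1 (hT p hp.1.1 hmem)
    obtain ⟨hxA, hxp⟩ := Finset.mem_filter.1 hx
    refine ⟨x, hxA, ?_, ?_⟩
    · rw [← hpe, ← hxp]; rfl
    · simpa [hp.2] using he
  choose x hxA hx₁ hx₂ using key
  refine h ⟨fun i => (x i).1, U.orderEmbOfFin hU.2, fun i j hij => ?_,
    (U.orderEmbOfFin hU.2).strictMono, fun i => ?_⟩
  · refine lt_of_div_lt (s := s) ?_
    rw [hx₁, hx₁]
    exact (R.orderEmbOfCardLe hRc).strictMono hij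
  · rw [← hx₂]
    exact hxA i

theorem card_wideBlocks (hs : 0 < s) (h : ¬ Hits π A) {W : ℕ}
    (hW : ∀ x ∈ A, x.2 / s < W) : (wideBlocks k s A).card ≤ W * (k * s.choose k) := by
  classical
  have hmaps : ∀ p ∈ wideBlocks k s A, p.2 ∈ Finset.range W := by
    intro p hp
    obtain ⟨x, hx, rfl⟩ := Finset.mem_image.1 (Finset.mem_filter.1 hp).1
    exact Finset.mem_range.2 (hW x hx)
  rw [Finset.card_eq_sum_card_fiberwise hmaps]
  refine (Finset.sum_le_card_nsmul _ _ _ fun b _ => card_wideBlocks_column hs h b).trans ?_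
  simp

theorem card_inBlock_le (hs : 0 < s) (p : ℕ × ℕ) : (inBlock s A p).card ≤ s * s := by
  have : inBlock s A p ⊆
      Finset.Ico (p.1 * s) (p.1 * s + s) ×ˢ Finset.Ico (p.2 * s) (p.2 * s + s) := by
    intro x hx
    obtain ⟨-, rfl⟩ := Finset.mem_filter.1 hx
    simp only [Finset.mem_product, Finset.mem_Ico, blockOf]
    exact ⟨⟨Nat.div_mul_le_self _ _, Nat.lt_div_mul_add hs⟩, Nat.div_mul_le_self _ _,
      Nat.lt_div_mul_add hs⟩
  simpa using Finset.card_le_card this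

theorem inBlock_swap (p : ℕ × ℕ) :
    inBlock s (A.image Prod.swap) p.swap = (inBlock s A p).image Prod.swap := by
  ext ⟨a, b⟩
  simp only [mem_inBlock, Finset.mem_image, Prod.exists, Prod.swap_prod_mk, Prod.mk.injEq]
  constructor
  · rintro ⟨⟨c, d, h, rfl, rfl⟩, h'⟩
    refine ⟨c, d, ⟨h, ?_⟩, rfl, rfl⟩
    rw [← Prod.swap_inj, ← h']
    rfl
  · rintro ⟨c, d, ⟨h, rfl⟩, rfl, rfl⟩
    exact ⟨⟨c, d, h, rfl, rfl⟩, rfl⟩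

/-- A block that is neither wide nor wide after transposition meets at most `k - 1` rows and `k - 1`
columns; any other block has at most `s * s` entries, and there are few of these. -/
theorem card_le_of_not_hits (hs : 0 < s) (hk : 0 < k) (h : ¬ Hits π A) {W : ℕ}
    (hW : ∀ x ∈ A, x.1 / s < W ∧ x.2 / s < W) :
    A.card ≤ (k - 1) * (k - 1) * (A.image (blockOf s)).card +
      s * s * (2 * (W * (k * s.choose k))) := by
  classical
  set A' := A.image Prod.swap with hA'
  have h₁ := card_wideBlocks hs h fun x hx => (hW x hx).2
  have h₂ : (wideBlocks k s A').card ≤ W * (k * s.choose k) := by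
    refine card_wideBlocks (π := π⁻¹) hs (fun h' => h (hits_swap h')) fun x hx => ?_
    obtain ⟨y, hy, rfl⟩ := Finset.mem_image.1 hx
    exact (hW y hy).1
  have h₃ : ∀ p ∈ A.image (blockOf s), (inBlock s A p).card ≤ (k - 1) * (k - 1) +
      ((if p ∈ wideBlocks k s A then s * s else 0) +
        if p.swap ∈ wideBlocks k s A' then s * s else 0) := by
    intro p hp
    have hss := card_inBlock_le (A := A) hs p
    by_cases hw : p ∈ wideBlocks k s A
    · rw [if_pos hw]
      omega
    by_cases hw' : p.swap ∈ wideBlocks k s A'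
    · rw [if_pos hw']
      omega
    have c₁ : ((inBlock s A p).image Prod.snd).card ≤ k - 1 := by
      by_contra hcon
      exact hw (Finset.mem_filter.2 ⟨hp, by omega⟩)
    have c₂ : ((inBlock s A p).image Prod.fst).card ≤ k - 1 := by
      by_contra hcon
      refine hw' (Finset.mem_filter.2 ⟨?_, ?_⟩)
      · obtain ⟨x, hx, rfl⟩ := Finset.mem_image.1 hp
        exact Finset.mem_image.2 ⟨x.swap, Finset.mem_image_of_mem _ hx, rfl⟩
      · rw [hA', inBlock_swap, Finset.image_image]
        have : (Prod.snd ∘ Prod.swap : ℕ × ℕ → ℕ) = Prod.fst := rfl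
        rw [this]
        omega
    have c₃ : inBlock s A p ⊆
        ((inBlock s A p).image Prod.fst) ×ˢ ((inBlock s A p).image Prod.snd) :=
      Finset.subset_product
    have c₄ := Finset.card_le_card c₃
    rw [Finset.card_product] at c₄
    exact (c₄.trans (Nat.mul_le_mul c₂ c₁)).trans (Nat.le_add_right _ _)
  rw [Finset.card_eq_sum_card_image (blockOf s) A]
  refine (Finset.sum_le_sum h₃).trans ?_
  rw [Finset.sum_add_distrib, Finset.sum_add_distrib, Finset.sum_const, smul_eq_mul, mul_comm]
  refine Nat.add_le_add_left ?_ _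
  have h₄ : ∑ p ∈ A.image (blockOf s), (if p ∈ wideBlocks k s A then s * s else 0) ≤
      (wideBlocks k s A).card * (s * s) := by
    rw [← Finset.sum_filter, Finset.sum_const, smul_eq_mul]
    refine Nat.mul_le_mul_right _ (Finset.card_le_card fun p hp => (Finset.mem_filter.1 hp).2)
  have h₅ : ∑ p ∈ A.image (blockOf s), (if p.swap ∈ wideBlocks k s A' then s * s else 0) ≤
      (wideBlocks k s A').card * (s * s) := by
    rw [← Finset.sum_filter, Finset.sum_const, smul_eq_mul]
    refine Nat.mul_le_mul_right _ (Finset.card_le_card_of_injOn Prod.swap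
      (fun p hp => (Finset.mem_filter.1 hp).2) Prod.swap_injective.injOn)
  have h₆ := Nat.mul_le_mul_right (s * s) h₁
  have h₇ := Nat.mul_le_mul_right (s * s) h₂
  calc _ ≤ _ := Nat.add_le_add (h₄.trans h₆) (h₅.trans h₇)
    _ = _ := by ring

/-- Contracting blocks of side `k * k` shrinks the matrix by the factor `k ^ 2`, whereas the number
of entries shrinks, up to a linear term, at most by `(k - 1) ^ 2`. The gap makes the recursion
linear. -/
theorem marcus_tardos (hk : 2 ≤ k) (π : Equiv.Perm (Fin k)) :
    ∃ C : ℕ, ∀ (n : ℕ) (A : Finset (ℕ × ℕ)), (∀ x ∈ A, x.1 < n ∧ x.2 < n) → ¬ Hits π A →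
      A.card ≤ C * n := by
  set s := k * k with hs
  set D := s * s * (2 * (k * s.choose k)) with hD
  have hs4 : 4 ≤ s := Nat.mul_le_mul hk hk
  have hks : (k - 1) * (k - 1) + 3 ≤ s := by
    obtain ⟨j, rfl⟩ : ∃ j, k = j + 2 := ⟨k - 2, by omega⟩
    rw [hs, show j + 2 - 1 = j + 1 by omega]
    nlinarith
  refine ⟨s * s + D, fun n => ?_⟩
  induction n using Nat.strong_induction_on with
  | _ n ih =>
    intro A hA hπ
    by_cases hn : n ≤ s * s
    · have : A ⊆ Finset.range n ×ˢ Finset.range n := fun x hx => by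
        simpa using hA x hx
      have h₁ := Finset.card_le_card this
      rw [Finset.card_product, Finset.card_range] at h₁
      calc A.card ≤ n * n := h₁
        _ ≤ (s * s + D) * n := Nat.mul_le_mul_right _ (by omega)
    set W := n / s + 1 with hW
    have hsW : s * W ≤ n + s := by
      rw [hW, mul_add, mul_one]
      have := Nat.mul_div_le n s
      omega
    have hss : 4 * s ≤ s * s := Nat.mul_le_mul_right s hs4
    have hWn : W < n := by
      have : 4 * W ≤ s * W := Nat.mul_le_mul_right _ hs4
      omega
    have hdiv : ∀ x < n, x / s < W := fun x hx =>
      Nat.lt_succ_of_le (Nat.div_le_div_right hx.le)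
    have h₁ := card_le_of_not_hits (s := s) (by omega) (by omega) hπ (W := W) fun x hx =>
      ⟨hdiv _ (hA x hx).1, hdiv _ (hA x hx).2⟩
    have h₂ := ih W hWn (A.image (blockOf s)) (fun p hp => by
      obtain ⟨x, hx, rfl⟩ := Finset.mem_image.1 hp
      exact ⟨hdiv _ (hA x hx).1, hdiv _ (hA x hx).2⟩) (not_hits_blocks hπ)
    set C := s * s + D with hC
    obtain ⟨e, he⟩ : ∃ e, s = e + 3 := ⟨s - 3, by omega⟩
    have h₃ : A.card ≤ e * (C * W) + C * W := by
      calc A.card ≤ (k - 1) * (k - 1) * (C * W) + s * s * (2 * (W * (k * s.choose k))) :=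
            h₁.trans (Nat.add_le_add_right (Nat.mul_le_mul_left _ h₂) _)
        _ = (k - 1) * (k - 1) * (C * W) + D * W := by rw [hD]; ring
        _ ≤ e * (C * W) + C * W :=
            Nat.add_le_add (Nat.mul_le_mul_right _ (by omega)) (Nat.mul_le_mul_right _ (by omega))
    -- Here `e + 1 = s - 2`. The missing `2 * W` pays for the rounding in `W ≤ n / s + 1`, as `n`
    -- exceeds `s * s`.
    have h₄ : (e + 1) * W ≤ n := by
      have h₅ : s * ((e + 1) * W) ≤ s * n := by
        calc s * ((e + 1) * W) = (e + 1) * (s * W) := by ring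
          _ ≤ (e + 1) * (n + s) := Nat.mul_le_mul_left _ hsW
          _ ≤ s * n := by
            have : s * s = e * s + 3 * s := by rw [he]; ring
            have : s * n = e * n + 3 * n := by rw [he]; ring
            have : (e + 1) * (n + s) = e * n + e * s + n + s := by ring
            omega
      exact Nat.le_of_mul_le_mul_left h₅ (by omega)
    calc A.card ≤ C * ((e + 1) * W) := h₃.trans (le_of_eq (by ring))
      _ ≤ C * n := Nat.mul_le_mul_left _ h₄

end MarcusTardos

/-! ### The Füredi–Hajnal limit -/

section Limit

variable {k : ℕ} (π : Equiv.Perm (Fin k))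

theorem exNum_eq_zero_of_lt_two (hk : k < 2) (n : ℕ) : exNum π n = 0 := by
  rcases Nat.eq_zero_or_pos k with h0 | h0
  · exact exNum_eq_zero (hits_of_eq_zero h0) n
  obtain ⟨A, -, hA, hc⟩ := exists_card_eq_exNum (not_hits_empty (π := π) h0) n
  rw [← hc, Finset.card_eq_zero, Finset.eq_empty_iff_forall_notMem]
  intro x hx
  have : Subsingleton (Fin k) := by
    rw [← Fintype.card_le_one_iff_subsingleton, Fintype.card_fin]
    omega
  exact hA ⟨fun _ => x.1, fun _ => x.2, Subsingleton.strictMono _, Subsingleton.strictMono _,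
    fun _ => hx⟩

theorem exists_exNum_le : ∃ C : ℕ, ∀ n, exNum π n ≤ C * n := by
  by_cases hk : k < 2
  · exact ⟨0, fun n => by rw [exNum_eq_zero_of_lt_two π hk]; omega⟩
  obtain ⟨C, hC⟩ := marcus_tardos (by omega) π
  refine ⟨C, fun n => ?_⟩
  obtain ⟨A, h₁, h₂, h₃⟩ := exists_card_eq_exNum (not_hits_empty (π := π) (by omega)) n
  rw [← h₃]
  exact hC n A h₁ h₂

/-- The sign turns superadditivity into the form required by Fekete's lemma. -/
theorem subadditive_neg_exNum : Subadditive fun n => -(exNum π n : ℝ) := by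
  intro m n
  have := exNum_superadditive (π := π) m n
  have : (exNum π m : ℝ) + exNum π n ≤ exNum π (m + n) := by exact_mod_cast this
  simp only
  linarith

theorem bddBelow_neg_exNum : BddBelow (Set.range fun n : ℕ => -(exNum π n : ℝ) / n) := by
  obtain ⟨C, hC⟩ := exists_exNum_le π
  refine ⟨-C, ?_⟩
  rintro _ ⟨n, rfl⟩
  simp only
  rcases Nat.eq_zero_or_pos n with rfl | hn
  · simp
  · rw [le_div_iff₀ (by exact_mod_cast hn)]
    have : (exNum π n : ℝ) ≤ C * n := by exact_mod_cast hC n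
    linarith

theorem tendsto_exNum_div :
    Tendsto (fun n : ℕ => (exNum π n : ℝ) / n) atTop (𝓝 (-(subadditive_neg_exNum π).lim)) := by
  have := ((subadditive_neg_exNum π).tendsto_lim (bddBelow_neg_exNum π)).neg
  refine this.congr fun n => ?_
  rw [neg_div, neg_neg]

theorem fhLimit_eq : fhLimit π = -(subadditive_neg_exNum π).lim :=
  (tendsto_exNum_div π).limUnder_eq

/-- In Fekete's lemma the limit is the supremum of the quotients, so the bound holds without an
error term. -/
theorem exNum_le_fhLimit_mul (n : ℕ) : (exNum π n : ℝ) ≤ fhLimit π * n := by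
  rcases Nat.eq_zero_or_pos n with rfl | hn
  · obtain ⟨C, hC⟩ := exists_exNum_le π
    simpa using hC 0
  · have := (subadditive_neg_exNum π).lim_le_div (bddBelow_neg_exNum π) hn.ne'
    rw [le_div_iff₀ (by exact_mod_cast hn)] at this
    rw [fhLimit_eq]
    linarith

/-- A single entry avoids every pattern with two rows, so the quotient for `n = 1` is already at
least `1`. -/
theorem one_le_fhLimit (hk : 2 ≤ k) : 1 ≤ fhLimit π := by
  have h₁ : 1 ≤ exNum π 1 := by
    have := card_le_exNum (π := π) (n := 1) (A := {(0, 0)}) (by simp) (by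
      rintro ⟨f, g, hf, -, hfg⟩
      have h : (⟨0, by omega⟩ : Fin k) < ⟨1, by omega⟩ := by simp [Fin.lt_def]
      have h₂ := hf h
      have h₃ : ∀ i, f i = 0 := fun i => (Prod.mk.inj (Finset.mem_singleton.1 (hfg i))).1
      rw [h₃, h₃] at h₂
      omega)
    simpa using this
  have h₂ := exNum_le_fhLimit_mul π 1
  have h₃ : (1 : ℝ) ≤ exNum π 1 := by exact_mod_cast h₁
  simp at h₂
  linarith

end Limit

/-! ### Few jumps in a sequence that avoids a permutation -/

/-- Samples with numbers `g < M`, positions `p g`, values `v g`, and strips `st g`, in blocks of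
`q` samples. -/
structure ValuedSamples {α : Type*} [LinearOrder α] (q M : ℕ) (p st : ℕ → ℕ) (v : ℕ → α) :
    Prop where
  block : ∀ g g', g' < M → g / q < g' / q → p g < p g'
  within : ∀ g g', g < g' → g' < M → g / q = g' / q → v g < v g' ∨ v g = v g' ∧ p g ≤ p g'
  mono : ∀ g < M, ∀ g' < M, (v g < v g' ∨ v g = v g' ∧ p g ≤ p g') → st g ≤ st g'

theorem next_div {q g g' : ℕ} (hgg : g < g') (hb : g / q = g' / q) :
    (g + 1) / q = g / q ∧ (g + 1) / q = g' / q := by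
  have h₁ := Nat.div_le_div_right (c := q) (show g ≤ g + 1 by omega)
  have h₂ := Nat.div_le_div_right (c := q) (show g + 1 ≤ g' by omega)
  omega

namespace ValuedSamples

variable {α : Type*} [LinearOrder α] {q M : ℕ} {p st : ℕ → ℕ} {v : ℕ → α}
  (h : ValuedSamples q M p st v)

include h

theorem strip_le {g g' : ℕ} (hgg : g ≤ g') (hg' : g' < M) (hb : g / q = g' / q) :
    st g ≤ st g' := by
  rcases hgg.eq_or_lt with rfl | hlt
  · exact le_rfl
  · exact h.mono g (by omega) g' hg' (h.within g g' hlt hg' hb)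

theorem value_le {g g' : ℕ} (hgg : g ≤ g') (hg' : g' < M) (hb : g / q = g' / q) :
    v g ≤ v g' := by
  rcases hgg.eq_or_lt with rfl | hlt
  · exact le_rfl
  · rcases h.within g g' hlt hg' hb with h | h
    · exact h.le
    · exact h.1.le

/-- Samples that are spread over blocks and over strips (or other numbers `t g`) consistently with
their values. -/
theorem card_le_exNum {k W : ℕ} {π : Equiv.Perm (Fin k)}
    (hπ : ∀ x : Fin k → ℕ, (∀ i, x i < M) → (StrictMono fun i => p (x i)) →
      ¬ ∀ i j, v (x i) < v (x j) ↔ π i < π j)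
    {J : Finset ℕ} {t : ℕ → ℕ} (hJ : ∀ g ∈ J, g < M) (hW : ∀ g ∈ J, g / q < W ∧ t g < W)
    (ht : ∀ g ∈ J, ∀ g' ∈ J, t g < t g' → v g < v g')
    (hinj : ∀ g ∈ J, ∀ g' ∈ J, g < g' → g / q = g' / q → t g ≠ t g') :
    J.card ≤ exNum π W := by
  classical
  have hc : (J.image fun g => (g / q, t g)).card = J.card := by
    refine Finset.card_image_of_injOn fun g hg g' hg' he => ?_
    simp only [Prod.mk.injEq] at he
    rcases lt_trichotomy g g' with hlt | heq | hlt
    · exact absurd he.2 (hinj g hg g' hg' hlt he.1)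
    · exact heq
    · exact absurd he.2.symm (hinj g' hg' g hg hlt he.1.symm)
  rw [← hc]
  refine _root_.card_le_exNum (fun x hx => ?_) ?_
  · obtain ⟨g, hg, rfl⟩ := Finset.mem_image.1 hx
    exact hW g hg
  · rintro ⟨f, f', hf, hf', hff⟩
    have : ∀ i, ∃ g ∈ J, g / q = f i ∧ t g = f' (π i) := by
      intro i
      obtain ⟨g, hg, he⟩ := Finset.mem_image.1 (hff i)
      exact ⟨g, hg, Prod.mk.inj he⟩
    choose x hx hx₁ hx₂ using this
    have key : ∀ i j, π i < π j → v (x i) < v (x j) := by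
      intro i j hij
      refine ht _ (hx i) _ (hx j) ?_
      rw [hx₂, hx₂]
      exact hf' hij
    refine hπ x (fun i => hJ _ (hx i)) (fun i j hij => ?_) fun i j => ⟨fun hv => ?_, key i j⟩
    · refine h.block _ _ (hJ _ (hx j)) ?_
      rw [hx₁, hx₁]
      exact hf hij
    · rcases lt_trichotomy (π i) (π j) with hlt | heq | hlt
      · exact hlt
      · rw [π.injective heq] at hv
        exact absurd hv (lt_irrefl _)
      · exact absurd hv (key j i hlt).asymm

/-- If all values were distinct, the jumps inside blocks, placed by block and strip, would form a
`π`-avoiding matrix. With ties, samples in different strips can have equal values, so for each value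
the lowest strip `st (lo g)` and the highest strip `st (hi g)` in which it occurs serve as columns:
these increase weakly with the value and depend on the value only, so different columns mean
strictly ordered values. -/
theorem card_jumps_le {k W : ℕ} {π : Equiv.Perm (Fin k)}
    (hπ : ∀ x : Fin k → ℕ, (∀ i, x i < M) → (StrictMono fun i => p (x i)) →
      ¬ ∀ i j, v (x i) < v (x j) ↔ π i < π j)
    (hW : ∀ g < M, g / q < W ∧ st g < W) :
    (jumps q M st).card ≤ 2 * W + 2 * exNum π W := by
  classical
  have hlo : ∀ g, ∃ a, g < M → a < M ∧ v a = v g ∧ ∀ c < M, v c = v g → st a ≤ st c := by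
    intro g
    by_cases hg : g < M
    · obtain ⟨a, ha, hmin⟩ := Finset.exists_min_image
        ((Finset.range M).filter fun c => v c = v g) st ⟨g, by simpa using hg⟩
      simp only [Finset.mem_filter, Finset.mem_range] at ha hmin
      exact ⟨a, fun _ => ⟨ha.1, ha.2, fun c hc hv => hmin c ⟨hc, hv⟩⟩⟩
    · exact ⟨0, fun h => absurd h hg⟩
  have hhi : ∀ g, ∃ a, g < M → a < M ∧ v a = v g ∧ ∀ c < M, v c = v g → st c ≤ st a := by
    intro g
    by_cases hg : g < M
    · obtain ⟨a, ha, hmax⟩ := Finset.exists_max_image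
        ((Finset.range M).filter fun c => v c = v g) st ⟨g, by simpa using hg⟩
      simp only [Finset.mem_filter, Finset.mem_range] at ha hmax
      exact ⟨a, fun _ => ⟨ha.1, ha.2, fun c hc hv => hmax c ⟨hc, hv⟩⟩⟩
    · exact ⟨0, fun h => absurd h hg⟩
  choose lo hlo using hlo
  choose hi hhi using hhi
  have strict : ∀ g < M, ∀ g' < M, v g < v g' → st g ≤ st g' := fun g hg g' hg' hv =>
    h.mono g hg g' hg' (.inl hv)
  set In : ℕ → Prop := fun g => g + 1 < M ∧ (g + 1) / q = g / q with hIn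
  set J₁ := (Finset.range M).filter fun g => ¬ In g with hJ₁
  set J₂ := (Finset.range M).filter fun g => In g ∧ st g < st (g + 1) ∧ v g = v (g + 1) with hJ₂
  set J₃ := (Finset.range M).filter fun g => In g ∧ st g < st (g + 1) ∧ v g < v (g + 1) ∧
    st (lo g) = st g with hJ₃
  set J₄ := (Finset.range M).filter fun g => In g ∧ st g < st (g + 1) ∧ v g < v (g + 1) ∧
    st (lo g) < st g with hJ₄
  have hcover : jumps q M st ⊆ (J₁ ∪ J₂) ∪ (J₃ ∪ J₄) := by
    intro g hg
    obtain ⟨hgM, hj⟩ := Finset.mem_filter.1 hg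
    have hgM' := Finset.mem_range.1 hgM
    simp only [Finset.mem_union, hJ₁, hJ₂, hJ₃, hJ₄, Finset.mem_filter, hgM, true_and]
    by_cases hin : In g
    swap
    · exact .inl (.inl hin)
    have hst : st g < st (g + 1) :=
      lt_of_le_of_ne (h.strip_le (Nat.le_succ g) hin.1 hin.2.symm)
        fun he => hj ⟨hin.1, hin.2, he.symm⟩
    rcases (h.value_le (Nat.le_succ g) hin.1 hin.2.symm).eq_or_lt with hv | hv
    · exact .inl (.inr ⟨hin, hst, hv⟩)
    rcases ((hlo g hgM').2.2 g hgM' rfl).eq_or_lt with hl | hl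
    · exact .inr (.inl ⟨hin, hst, hv, hl⟩)
    · exact .inr (.inr ⟨hin, hst, hv, hl⟩)
  have c₁ : J₁.card ≤ W := by
    rw [← Finset.card_range W]
    refine Finset.card_le_card_of_injOn (fun g => g / q) (fun g hg => ?_) fun g hg g' hg' he => ?_
    · have := Finset.mem_range.1 (Finset.mem_filter.1 hg).1
      simpa using (hW g this).1
    · obtain ⟨hg₁, hg₂⟩ := Finset.mem_filter.1 hg
      obtain ⟨hg₁', hg₂'⟩ := Finset.mem_filter.1 hg'
      rw [Finset.mem_range] at hg₁ hg₁'
      simp only at he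
      rcases lt_trichotomy g g' with hlt | heq | hlt
      · exact absurd ⟨by omega, (next_div hlt he).1⟩ hg₂
      · exact heq
      · exact absurd ⟨by omega, (next_div hlt he.symm).1⟩ hg₂'
  have c₂ : J₂.card ≤ W := by
    -- At most one jump between equal values starts in a strip. Two of them cannot be in one block,
    -- since the first leaves the strip. In different blocks they would have the same value; as ties
    -- are broken by position, `g + 1` precedes `g'`, so the strip of `g'` cannot lie below that of
    -- `g + 1`.
    have key : ∀ g ∈ J₂, ∀ g' ∈ J₂, g < g' → st g ≠ st g' := by
      intro g hg g' hg' hlt he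
      obtain ⟨hg₁, hg₂, hg₃, hg₄⟩ := Finset.mem_filter.1 hg
      obtain ⟨hg₁', hg₂', hg₃', hg₄'⟩ := Finset.mem_filter.1 hg'
      rw [Finset.mem_range] at hg₁ hg₁'
      rcases (Nat.div_le_div_right (c := q) hlt.le).eq_or_lt with hb | hb
      · have := h.strip_le (show g + 1 ≤ g' by omega) hg₁' (next_div hlt hb).2
        omega
      · have hp : p (g + 1) < p g' := h.block _ _ hg₁' (by rw [hg₂.2]; exact hb)
        have hv : v g' ≤ v (g + 1) := by
          by_contra hcon
          have := strict _ hg₂.1 _ hg₁' (not_le.1 hcon)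
          omega
        have hv' : v g ≤ v (g' + 1) := by
          by_contra hcon
          have := strict _ hg₂'.1 _ hg₁ (not_le.1 hcon)
          omega
        rw [← hg₄] at hv
        rw [← hg₄'] at hv'
        have hvv := le_antisymm hv' hv
        have := h.mono _ hg₂.1 _ hg₁' (.inr ⟨by rw [← hg₄, hvv], hp.le⟩)
        omega
    rw [← Finset.card_range W]
    refine Finset.card_le_card_of_injOn st (fun g hg => ?_) fun g hg g' hg' he => ?_
    · have := Finset.mem_range.1 (Finset.mem_filter.1 hg).1
      simpa using (hW g this).2
    · rcases lt_trichotomy g g' with hlt | heq | hlt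
      · exact absurd he (key g hg g' hg' hlt)
      · exact heq
      · exact absurd he.symm (key g' hg' g hg hlt)
  -- Here the column is the actual strip of the sample, and a jump leaves its strip, so columns in a
  -- block are distinct.
  have c₃ : J₃.card ≤ exNum π W := by
    have hJ : ∀ g ∈ J₃, g < M := fun g hg => Finset.mem_range.1 (Finset.mem_filter.1 hg).1
    refine h.card_le_exNum hπ (t := fun g => st (lo g)) hJ
      (fun g hg => ⟨(hW g (hJ g hg)).1, (hW _ (hlo g (hJ g hg)).1).2⟩) ?_ ?_
    · intro g hg g' hg' hlt
      obtain ⟨k₁, k₂, k₃⟩ := hlo g (hJ g hg)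
      obtain ⟨k₁', k₂', k₃'⟩ := hlo g' (hJ g' hg')
      by_contra hcon
      rcases (not_lt.1 hcon).eq_or_lt with hv | hv
      · have := k₃' (lo g) k₁ (by rw [k₂, hv])
        omega
      · have := strict _ k₁' _ k₁ (by rwa [k₂, k₂'])
        omega
    · intro g hg g' hg' hlt hb he
      obtain ⟨-, hg₂, hg₃, hg₄, hg₅⟩ := Finset.mem_filter.1 hg
      obtain ⟨-, hg₂', hg₃', hg₄', hg₅'⟩ := Finset.mem_filter.1 hg'
      have := h.strip_le (show g + 1 ≤ g' by omega) (hJ g' hg') (next_div hlt hb).2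
      omega
  -- For two such samples `g < g'` of a block the value increases strictly, and the value of `g'`
  -- begins in a strip below that of `g'`: `st (hi g) ≤ st (lo g') < st g' ≤ st (hi g')`.
  have c₄ : J₄.card ≤ exNum π W := by
    have hJ : ∀ g ∈ J₄, g < M := fun g hg => Finset.mem_range.1 (Finset.mem_filter.1 hg).1
    refine h.card_le_exNum hπ (t := fun g => st (hi g)) hJ
      (fun g hg => ⟨(hW g (hJ g hg)).1, (hW _ (hhi g (hJ g hg)).1).2⟩) ?_ ?_
    · intro g hg g' hg' hlt
      obtain ⟨k₁, k₂, k₃⟩ := hhi g (hJ g hg)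
      obtain ⟨k₁', k₂', k₃'⟩ := hhi g' (hJ g' hg')
      by_contra hcon
      rcases (not_lt.1 hcon).eq_or_lt with hv | hv
      · have := k₃ (hi g') k₁' (by rw [k₂', hv])
        omega
      · have := strict _ k₁' _ k₁ (by rwa [k₂, k₂'])
        omega
    · intro g hg g' hg' hlt hb he
      obtain ⟨-, hg₂, hg₃, hg₄, hg₅⟩ := Finset.mem_filter.1 hg
      obtain ⟨-, hg₂', hg₃', hg₄', hg₅'⟩ := Finset.mem_filter.1 hg'
      have hv : v g < v g' := hg₄.trans_le
        (h.value_le (show g + 1 ≤ g' by omega) (hJ g' hg') (next_div hlt hb).2)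
      obtain ⟨k₁, k₂, -⟩ := hhi g (hJ g hg)
      obtain ⟨k₁', k₂', -⟩ := hlo g' (hJ g' hg')
      have := strict _ k₁ _ k₁' (by rwa [k₂, k₂'])
      have := (hhi g' (hJ g' hg')).2.2 g' (hJ g' hg') rfl
      omega
  have := Finset.card_le_card hcover
  have := Finset.card_union_le (J₁ ∪ J₂) (J₃ ∪ J₄)
  have := Finset.card_union_le J₁ J₂
  have := Finset.card_union_le J₃ J₄
  omega

end ValuedSamples

/-! ### Abandoned runs and the Füredi–Hajnal limit -/

section Input

variable {α : Type*} [LinearOrder α] {n : ℕ}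

/-- Patterns of length at most one occur in every nonempty sequence; this excludes the degenerate
limits, for which the logarithm would be useless. -/
theorem two_le_of_seqAvoids {s : Fin n → α} {k : ℕ} {π : Equiv.Perm (Fin k)}
    (h : SeqAvoids s π) (hn : 0 < n) : 2 ≤ k := by
  by_contra hk
  have : Subsingleton (Fin k) := by
    rw [← Fintype.card_le_one_iff_subsingleton, Fintype.card_fin]
    omega
  refine h ⟨OrderEmbedding.ofStrictMono (fun _ => ⟨0, hn⟩) (Subsingleton.strictMono _),
    fun i j => ?_⟩
  rw [Subsingleton.elim i j]
  simp

/-- There are more than `N / (4 * q)` jumps, but at most `4 * c * W` with `c ≥ 1` the limit, and `W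
* q * q < 2 * N`. Hence `N * q < 32 * c * N`. -/
theorem lt_of_obstruction {b q : ℕ} {s : Fin n → α} {k : ℕ} {π : Equiv.Perm (Fin k)}
    (h : SeqAvoids s π) (hn : 0 < n) (hO : Obstruction (inputEnv b s) q) :
    (q : ℝ) < 32 * fhLimit π := by
  have hk := two_le_of_seqAvoids h hn
  have hc := one_le_fhLimit π hk
  rcases Nat.eq_zero_or_pos q with rfl | hq
  · simp only [Nat.cast_zero]
    linarith
  obtain ⟨N, M, p, st, -, hN, hiff, hS, hlt⟩ := hO
  have hpn : ∀ g < M, p g < n := hS.lt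
  -- The default value is irrelevant, since only `g < M` matter.
  set v : ℕ → α := fun g => if h : p g < n then s ⟨p g, h⟩ else s ⟨0, hn⟩ with hv
  have hvg : ∀ g (hg : g < M), v g = s ⟨p g, hpn g hg⟩ := fun g hg => by simp [hv, hpn g hg]
  have hle : ∀ g (_ : g < M) g' (_ : g' < M), (inputEnv b s).r (p g) (p g') ↔
      v g < v g' ∨ v g = v g' ∧ p g ≤ p g' := by
    intro g hg g' hg'
    rw [hvg g hg, hvg g' hg']
    simp [inputEnv, posLE, hpn g hg, hpn g' hg']
  have hV : ValuedSamples q M p st v :=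
    ⟨hS.block, fun g g' hgg hg' hb => (hle g (by omega) g' hg').1 (hS.within g g' hgg hg' hb),
      fun g hg g' hg' hr => hS.mono g hg g' hg' ((hle g hg g' hg').2 hr)⟩
  set W := (M + q - 1) / q with hW
  have hcard := hV.card_jumps_le (W := W) (π := π) (fun x hx hmono hord => by
    refine h ⟨OrderEmbedding.ofStrictMono (fun i => ⟨p (x i), hpn _ (hx i)⟩)
      fun i j hij => hmono hij, fun i j => ?_⟩
    rw [← hord i j, hvg _ (hx i), hvg _ (hx j)]
    rfl) (fun g hg => ⟨by
      rw [hW, lt_ceil_iff hq]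
      exact (Nat.div_mul_le_self g q).trans_lt hg, by
      rw [hW, lt_ceil_iff hq]
      exact hS.strip_lt g hg⟩)
  have hM : M * q < N + q := by
    rcases Nat.eq_zero_or_pos M with h0 | h0
    · rw [h0]
      omega
    · have := (hiff (M - 1)).1 (by omega)
      have e : M * q = (M - 1) * q + q := by
        conv_lhs => rw [show M = M - 1 + 1 by omega, add_mul, one_mul]
      omega
  have hWq : W * q ≤ M + q - 1 := Nat.div_mul_le_self _ _
  -- The two roundings up add less than `q * q`, and `q * q < N`.
  have hWqq : W * q * q < 2 * N := by
    have h₁ : W * q * q ≤ (M + q - 1) * q := Nat.mul_le_mul_right q hWq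
    have h₂ : (M + q - 1) * q + q = M * q + q * q := by
      obtain ⟨e, rfl⟩ : ∃ e, q = e + 1 := ⟨q - 1, by omega⟩
      rw [show M + (e + 1) - 1 = M + e by omega]
      ring
    omega
  have hex := exNum_le_fhLimit_mul π W
  have hlt' : (N : ℝ) < 4 * (q * (2 * W + 2 * (fhLimit π * W))) := by
    calc (N : ℝ) < 4 * (q * (jumps q M st).card) := by exact_mod_cast hlt
      _ ≤ 4 * (q * (2 * W + 2 * exNum π W)) := by gcongr; exact_mod_cast hcard
      _ ≤ _ := by gcongr
  have hWR : (W : ℝ) * q * q < 2 * N := by exact_mod_cast hWqq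
  have hqR : (0 : ℝ) < q := by exact_mod_cast hq
  have hNR : (0 : ℝ) < N := by exact_mod_cast (Nat.zero_le _).trans_lt hN
  have h₁ : (N : ℝ) < 16 * (q * (fhLimit π * W)) := by
    have : (W : ℝ) ≤ fhLimit π * W := le_mul_of_one_le_left (Nat.cast_nonneg _) hc
    calc (N : ℝ) < 4 * (q * (2 * W + 2 * (fhLimit π * W))) := hlt'
      _ ≤ 4 * (q * (2 * (fhLimit π * W) + 2 * (fhLimit π * W))) := by gcongr
      _ = _ := by ring
  have h₂ : (N : ℝ) * q < N * (32 * fhLimit π) := by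
    calc (N : ℝ) * q < 16 * (q * (fhLimit π * W)) * q := by gcongr
      _ = 16 * fhLimit π * (W * q * q) := by ring
      _ ≤ 16 * fhLimit π * (2 * N) := by gcongr
      _ = _ := by ring
  exact lt_of_mul_lt_mul_left h₂ hNR.le

end Input

/-! ### Correctness and running time -/

section Final

variable {α : Type*} [LinearOrder α] {n : ℕ}

theorem inputEnv_valid {b : ℕ} (s : Fin n → α) (hb : 1000 * (n + 1) ^ 2 ≤ 2 ^ b) :
    (inputEnv b s).Valid where
  total i j := by
    simp only [inputEnv, posLE]
    by_cases hi : i < n <;> by_cases hj : j < n <;> simp [hi, hj]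
    · rcases lt_trichotomy (s ⟨i, hi⟩) (s ⟨j, hj⟩) with h | h | h
      · simp [h]
      · simp [h, le_total]
      · simp [h]
    · omega
  trans i j k := by
    simp only [inputEnv, posLE]
    by_cases hi : i < n <;> by_cases hj : j < n <;> by_cases hk : k < n <;> simp [hi, hj, hk]
    · rintro (h | ⟨h, hij⟩) (h' | ⟨h', hjk⟩)
      · exact .inl (h.trans h')
      · exact .inl (h' ▸ h)
      · exact .inl (h ▸ h')
      · exact .inr ⟨h.trans h', hij.trans hjk⟩
    all_goals omega
  antisymm i j := by
    simp only [inputEnv, posLE]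
    by_cases hi : i < n <;> by_cases hj : j < n <;> simp [hi, hj]
    · rintro (h | ⟨h, hij⟩) (h' | ⟨h', hji⟩)
      · exact absurd h h'.asymm
      · exact absurd h h'.symm.not_lt
      · exact absurd h' h.symm.not_lt
      · omega
    all_goals omega
  large := hb

/-- Ten of the twelve parts cover the factor `1000 ≤ 2 ^ 10`, one each covers a factor `n + 1`. The
square is needed because `K` may reach the order of `n ^ 2`. -/
theorem le_two_pow_word (n : ℕ) : 1000 * (n + 1) ^ 2 ≤ 2 ^ (12 * (Nat.log 2 n + 1)) := by
  have h₁ : n + 1 ≤ 2 ^ (Nat.log 2 n + 1) := Nat.lt_pow_succ_log_self (by norm_num) n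
  have h₂ : 1000 ≤ 2 ^ (10 * (Nat.log 2 n + 1)) :=
    le_trans (by norm_num) (Nat.pow_le_pow_right (show 0 < 2 by norm_num)
      (show 10 ≤ 10 * (Nat.log 2 n + 1) by omega))
  calc 1000 * (n + 1) ^ 2 ≤ 2 ^ (10 * (Nat.log 2 n + 1)) * (2 ^ (Nat.log 2 n + 1)) ^ 2 := by gcongr
    _ = 2 ^ (12 * (Nat.log 2 n + 1)) := by rw [← pow_mul, ← pow_add]; ring_nf

/-- The initial state for inputs of length `n`. -/
def startState (n : ℕ) : HState := ⟨fun x => if x = .n then n else 0, fun _ _ => 0, 0⟩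

theorem represents_startState {b : ℕ} (hn : n < 2 ^ b) :
    Represents b (initState n) (startState n) where
  reg x := by cases x <;> simp [initState, startState, Reg.code]
  arr a := rfl
  reg_lt x := by
    simp only [initState]
    split_ifs
    · exact hn
    · omega
  arr_lt a i := (Nat.zero_le n).trans_lt hn

theorem holdsSorted {b : ℕ} {s : Fin n → α} {ρ : RamState} {τ : HState}
    (hρ : Represents b ρ τ) (h : Sorted (inputEnv b s) τ) : HoldsSorted s ρ := by
  obtain ⟨hperm, hsorted⟩ := h
  have hX : ρ.arr 0 = τ.arr .X := hρ.arr .X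
  change (seg (τ.arr .X) 0 n).Perm (List.range n) at hperm
  change (seg (τ.arr .X) 0 n).Pairwise (posLE s) at hsorted
  have hlt : ∀ i < n, τ.arr .X i < n := fun i hi =>
    List.mem_range.1 (hperm.subset (mem_seg.2 ⟨i, Nat.zero_le i, by omega, rfl⟩))
  have hnd : ∀ i j, i < j → j < n → τ.arr .X i ≠ τ.arr .X j := fun i j hij hj =>
    pairwise_seg.1 (hperm.symm.nodup List.nodup_range) i j (Nat.zero_le i) hij (by omega)
  set f : Fin n → Fin n := fun i => ⟨τ.arr .X i, hlt i i.2⟩ with hf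
  have hinj : Function.Injective f := by
    intro i j hij
    have he : τ.arr .X i = τ.arr .X j := congrArg Fin.val hij
    rcases lt_trichotomy i j with h | h | h
    · exact absurd he (hnd i j h j.2)
    · exact h
    · exact absurd he.symm (hnd j i h i.2)
  refine ⟨Equiv.ofBijective f (Finite.injective_iff_bijective.1 hinj), fun i => ?_,
    fun i j hij => ?_⟩
  · rw [hX]
    rfl
  · rcases hij.eq_or_lt with rfl | hlt'
    · exact le_rfl
    · have := pairwise_seg.1 hsorted i j (Nat.zero_le _) hlt' (by omega)
      simp only [posLE, hlt i i.2, hlt j j.2, dite_true] at this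
      rcases this with h | h
      · exact h.le
      · exact h.1.le

/-- The sorting program is correct, and its running time is governed by the last attempt. -/
theorem exists_run_main (s : Fin n → α) :
    ∃ (t : ℕ) (ρ : RamState), Run (12 * (Nat.log 2 n + 1)) s Cmd.main.comp (initState n) t ρ ∧
      HoldsSorted s ρ ∧ ∃ κ, Reached (inputEnv (12 * (Nat.log 2 n + 1)) s) κ ∧
        t ≤ Cmd.main.maxCost * (3 + 2000 * κ * (n + 1)) := by
  have hb := le_two_pow_word n
  set b := 12 * (Nat.log 2 n + 1) with hbdef
  have hn : n < 2 ^ b := by nlinarith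
  obtain ⟨τ, hrun, hsorted, κ, hκ, htime⟩ := wp_main (inputEnv_valid s hb) (σ := startState n)
    (by simp [startState, inputEnv]) (by simp [startState])
  obtain ⟨t, ρ, hr, hρ, ht⟩ := Cmd.comp_correct s (by nlinarith) hrun le_rfl (initState n)
    (represents_startState hn)
  refine ⟨t, ρ, hr, holdsSorted hρ hsorted, κ, hκ, ?_⟩
  simp only [startState, zero_add, mul_zero, add_zero] at htime ht
  exact ht.trans (Nat.mul_le_mul_left _ htime)

/-- If the preceding round failed with `q`, then `κ` is `4 * log₂ q`, and `q < 32 * c` bounds this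
by `4 * (5 + log₂ c)`. The first round has `κ = 6`. -/
theorem Reached.le {b κ : ℕ} {s : Fin n → α} {k : ℕ} {π : Equiv.Perm (Fin k)}
    (h : SeqAvoids s π) (hn : 0 < n) (hκ : Reached (inputEnv b s) κ) :
    (κ : ℝ) ≤ 20 * (Real.logb 2 (fhLimit π) + 1) := by
  have hc := one_le_fhLimit π (two_le_of_seqAvoids h hn)
  have hlog : 0 ≤ Real.logb 2 (fhLimit π) := Real.logb_nonneg (by norm_num) hc
  rcases hκ with rfl | ⟨q, hO, hq⟩
  · push_cast
    linarith
  · have hlt := lt_of_obstruction h hn hO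
    have hq0 : (0 : ℝ) < q := by
      have : 0 < q := by
        refine Nat.pos_of_ne_zero ?_
        rintro rfl
        rw [zero_pow (by norm_num)] at hq
        exact (pow_pos (show 0 < 2 by norm_num) κ).ne hq
      exact_mod_cast this
    have hqR : (q : ℝ) ^ 4 = 2 ^ κ := by exact_mod_cast hq
    have h₁ : Real.logb 2 ((q : ℝ) ^ 4) = κ := by
      rw [hqR, Real.logb_pow, Real.logb_self_eq_one (by norm_num), mul_one]
    have h₂ : Real.logb 2 q ≤ 5 + Real.logb 2 (fhLimit π) := by
      have h₃ : Real.logb 2 (32 * fhLimit π) = 5 + Real.logb 2 (fhLimit π) := by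
        rw [Real.logb_mul (by norm_num) (by positivity), show (32 : ℝ) = 2 ^ 5 by norm_num,
          Real.logb_pow, Real.logb_self_eq_one (by norm_num)]
        norm_num
      rw [← h₃]
      exact Real.logb_le_logb_of_le (by norm_num) hq0 hlt.le
    rw [Real.logb_pow] at h₁
    push_cast at h₁
    linarith

end Final

theorem theorem1 :
    -- the Füredi–Hajnal limits exist
    (∀ (k : ℕ) (π : Equiv.Perm (Fin k)),
      Tendsto (fun n : ℕ => (exNum π n : ℝ) / n) atTop (𝓝 (fhLimit π))) ∧
    -- one program (with words of `O(log n)` bits) and one constant for all inputs and patterns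
    ∃ (P : Prog) (w : ℕ) (C : ℝ),
      ∀ (α : Type*) [LinearOrder α] (n : ℕ) (s : Fin n → α),
        ∃ (t : ℕ) (σ : RamState),
          Run (w * (Nat.log 2 n + 1)) s P (initState n) t σ ∧
          HoldsSorted s σ ∧
          ∀ (k : ℕ) (π : Equiv.Perm (Fin k)), SeqAvoids s π → 0 < n →
            (t : ℝ) ≤ C * (Real.logb 2 (fhLimit π) + 1) * n := by
  refine ⟨fun k π => ?_, Cmd.main.comp, 12, Cmd.main.maxCost * 100000, fun α _ n s => ?_⟩
  · rw [fhLimit_eq]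
    exact tendsto_exNum_div π
  obtain ⟨t, ρ, hrun, hsorted, κ, hκ, ht⟩ := exists_run_main s
  refine ⟨t, ρ, hrun, hsorted, fun k π hπ hn => ?_⟩
  have hκ' := hκ.le hπ hn
  have hlog : 0 ≤ Real.logb 2 (fhLimit π) :=
    Real.logb_nonneg (by norm_num) (one_le_fhLimit π (two_le_of_seqAvoids hπ hn))
  have hn1 : (1 : ℝ) ≤ n := by exact_mod_cast hn
  have ht' : (t : ℝ) ≤ Cmd.main.maxCost * (3 + 2000 * κ * (n + 1)) := by exact_mod_cast ht
  clear ht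
  generalize Cmd.main.maxCost = D at ht' ⊢
  set l := Real.logb 2 (fhLimit π)
  -- For `n ≥ 1` the additive constants are absorbed: `n + 1 ≤ 2 * n`, and `1 ≤ (l + 1) * n` below.
  have h₁ : (κ : ℝ) * (n + 1) ≤ 20 * (l + 1) * (2 * n) :=
    mul_le_mul hκ' (by linarith) (by positivity) (by positivity)
  have h₂ : (1 : ℝ) ≤ (l + 1) * n := by nlinarith
  have h₃ : 3 + 2000 * (κ : ℝ) * (n + 1) ≤ 100000 * (l + 1) * n := by nlinarith
  calc (t : ℝ) ≤ _ := ht'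
    _ ≤ D * (100000 * (l + 1) * n) :=
      mul_le_mul_of_nonneg_left h₃ (Nat.cast_nonneg _)
    _ = _ := by ring
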